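/- Setting. Let $\mathcal P=\{p_\theta:\theta\in\Theta\}$ be a family of probability densities with respect to a $\sigma$-finite measure $\lambda$, let $p_0\in\mathcal P$ be the true density and $P_0=p_0\,d\lambda$. A density in $\mathcal P$ that agrees $\lambda$-a.e. with $p_0$ is taken to be equal to $p_0$. Let $X_1,X_2,\dots$ have law $P_0$, and write $\mathbb P_nf=n^{-1}\sum_{i\le n}f(X_i)$, $\mathbb G_nf=\sqrt n(\mathbb P_n-P_0)f$, $nL_n(\theta)=\sum_{i\le n}\log p_\theta(X_i)$ (with $\log 0=-\infty$). All $o_{\mathbb P}$ statements are in outer probability. Let $h(p,q)^2=\int(\sqrt p-\sqrt q)^2d\lambda$, $S_p=\sqrt{p/p_0}-1$ (set to $0$ where $p_0=0$), $S_\theta=S_{p_\theta}$, and $\mathcal D_\varepsilon=\{S_p/h(p,p_0):p\in\mathcal P,\ 0<h(p,p_0)\le\varepsilon\}$. Let $\mathcal D\subset L^2(P_0)$ be the set of limit points of $\mathcal D_\varepsilon$ as $\varepsilon\to0$, i.e. $\mathcal D=\bigcap_{\varepsilon>0}\overline{\mathcal D_\varepsilon}^{L^2(P_0)}$, let $\overline{\mathcal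 D}_\varepsilon=\mathcal D_\varepsilon\cup\mathcal D$ (each element of $\mathcal D$ being represented by some function in its $L^2(P_0)$-class) and $\overline{\mathcal D}{}^2_\varepsilon=\{f^2:f\in\overline{\mathcal D}_\varepsilon\}$, and let $\mathcal T=\{\tau d:\tau\ge0,\ d\in\mathcal D\}$ be the tangent cone. Assume $\mathcal T$ is closed and convex, and let $\mathbb T$ be the metric projection of $L^2(P_0)$ onto $\mathcal T$. The model is DQM if $P_\theta\ll P_0$ for all $\theta$ and there are $g_p\in\mathcal T$, $R_p\in L^2(\lambda)$ with $\sqrt p-\sqrt{p_0}=g_p\sqrt{p_0}+h(p,p_0)R_p$ $\lambda$-a.e. for each $p\in\mathcal P$, and $\sup\{\|R_p\|_{L^2(\lambda)}:h(p,p_0)\le\varepsilon\}\to0$ as $\varepsilon\to0$. For positive $r_n$, it is $r_n$-DQM if the last condition is replaced by $\sup\{r_n\|R_p\|_{L^2(\lambda)}:h(p,p_0)\le r_n/\sqrt n\}\to0$ as $n\to\infty$. Put $\Theta_{osn}=\{\theta:h(p_\theta,p_0)\le r_n/\sqrt n\}$. When $\mathrm{Span}(\mathcal T)$ has finite dimension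 $d^*\ge1$, let $\psi=(\psi_1,\dots,\psi_{d^*})$ be an orthonormal basis of it in $L^2(P_0)$ (with fixed functions representing the $\psi_j$). We say that the local quadratic expansion holds along $(r_n)$ if the following are true, where $\mathbb V_n=\mathbb G_n(\psi)$, $\ell_n=n\mathbb P_n\log p_0$ and $\sqrt n\hat\gamma_n=\mathbb V_n$: - for every $\theta$, the vector $\gamma(\theta)\in\mathbb R^{d^*}$ of coordinates of $\mathbb T\big(2(\sqrt{p_\theta/p_0}-1)\big)$ in the basis $\psi$ satisfies $\mathbb T\big(2(\sqrt{p_\theta/p_0}-1)\big)=\gamma(\theta)'\psi$; and for some $\varepsilon>0$ and all $\theta$ with $h(p_\theta,p_0)\le\varepsilon$, $\gamma(\theta)=0$ if and only if $h(p_\theta,p_0)=0$; - $\ell_n$ and $\hat\gamma_n$ are measurable functions of $(X_1,\dots,X_n)$ and $$\sup_{\theta\in\Theta_{osn}}\Big|nL_n(\theta)-\Big(\ell_n+\tfrac12\|\sqrt n\hat\gamma_n\|^2-\tfrac12\|\sqrt n(\hat\gamma_n-\gamma(\theta))\|^2\Big)\Big|=o_{\mathbb P}(1);$$ - $\sup_{\theta\in\Theta_{osn}}\|\gamma(\theta)\|\to0$,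 and $\mathbb V_n\rightsquigarrow N(0,I_{d^*})$. Lemma. Let $r_n>0$, $r_n\to\infty$, $r_n=o(n^{1/2})$, and fix functions representing $\mathbb TS_\theta$. Suppose: (i) $\mathcal P$ is $r_n$-DQM; (ii) for some $\varepsilon>0$, $\overline{\mathcal D}{}_\varepsilon^2$ is $P_0$-Glivenko–Cantelli and $\overline{\mathcal D}_\varepsilon$ has an envelope $D\in L^2(P_0)$ with $\max_{i\le n}D(X_i)=o_{\mathbb P}(\sqrt n/r_n^3)$; (iii) $\sup_{\theta\in\Theta_{osn}}|\mathbb G_n(S_\theta-\mathbb TS_\theta)|=o_{\mathbb P}(n^{-1/2})$; (iv) $\sup_{\theta\in\Theta_{osn}}|(\mathbb P_n-P_0)S_\theta^2|=o_{\mathbb P}(n^{-1})$. Then $$\sup_{\theta\in\Theta_{osn}}\Big|nL_n(\theta)-\Big(n\mathbb P_n\log p_0-\tfrac12nP_0\big((2\mathbb TS_\theta)^2\big)+n\mathbb P_n(2\mathbb TS_\theta)\Big)\Big|=o_{\mathbb P}(1).$$ If in addition $X_1,X_2,\dots$ are independent, $\mathrm{Span}(\mathcal T)$ has finite dimension $d^*\ge1$,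 and the functions representing $\mathbb TS_\theta$ are $\tfrac12\gamma(\theta)'\psi$, then the local quadratic expansion holds along $(r_n)$. Proposition. Let $X_1,X_2,\dots$ be i.i.d. from $P_0$ and suppose: (a) $\{\log p:p\in\mathcal P\}$ is $P_0$-Glivenko–Cantelli (in particular each $\log p$ is $P_0$-integrable); (b) $\mathcal P$ is DQM, $\mathcal T$ is closed and convex, and $\mathrm{Span}(\mathcal T)$ has finite dimension $d^*\ge1$; (c) there is $\varepsilon>0$ such that $\overline{\mathcal D}_\varepsilon$ is $P_0$-Donsker and has an envelope $D\in L^2(P_0)$. Then there is a positive sequence $r_n\to\infty$ with $r_n=o(n^{1/4})$ along which the local quadratic expansion holds. -/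

import Mathlib

open MeasureTheory ProbabilityTheory Filter Topology Asymptotics
open scoped NNReal ENNReal

noncomputable section

namespace GenScore

/-! ### Empirical process notation -/

section EmpiricalProcess

variable {𝓧 Ω : Type*} [MeasurableSpace 𝓧] [MeasurableSpace Ω]

/-- The first `n` observations `(X₁, …, Xₙ)`. -/
def sample (X : ℕ → Ω → 𝓧) (n : ℕ) (ω : Ω) : Fin n → 𝓧 := fun i => X i ω

/-- `ℙₙ f = n⁻¹ ∑ f(xᵢ)`, the mean of `f` under the empirical measure of the points `x`. -/
def empMean {n : ℕ} (x : Fin n → 𝓧) (f : 𝓧 → ℝ) : ℝ := (n : ℝ)⁻¹ * ∑ i, f (x i)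

/-- `𝔾ₙ f = √n (ℙₙ f - P f)`, the empirical process. -/
def empProc (P : Measure 𝓧) {n : ℕ} (x : Fin n → 𝓧) (f : 𝓧 → ℝ) : ℝ :=
  √(n : ℝ) * (empMean x f - ∫ y, f y ∂P)

/-- `Yₙ = o_P(aₙ)` for nonnegative, possibly infinite, possibly non-measurable `Yₙ`
(a measure applied to an arbitrary set is the outer measure, so this is convergence in outer
probability). -/
def IsLittleOP (Pr : Measure Ω) (Y : ℕ → Ω → ℝ≥0∞) (a : ℕ → ℝ) : Prop :=
  ∀ ε : ℝ, 0 < ε →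
    Tendsto (fun n => Pr {ω | ENNReal.ofReal (ε * a n) < Y n ω}) atTop (𝓝 0)

/-- The class `F` of functions is `P`-Glivenko–Cantelli (for the sample `X`): it consists of
measurable integrable functions and `sup_{f ∈ F} |ℙₙ f - P f| → 0` in outer probability. -/
def IsGlivenkoCantelli (Pr : Measure Ω) (X : ℕ → Ω → 𝓧) (P : Measure 𝓧) (F : Set (𝓧 → ℝ)) :
    Prop :=
  (∀ f ∈ F, Measurable f ∧ Integrable f P) ∧
  IsLittleOP Pr (fun n ω => ⨆ f ∈ F,
    ENNReal.ofReal |empMean (sample X n ω) f - ∫ y, f y ∂P|) (fun _ => 1)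

/-- The outer expectation `E^* Z` of a bounded, not necessarily measurable, function `Z`. -/
def outerExpectation (μ : Measure Ω) (Z : Ω → ℝ) : ℝ :=
  sInf {c | ∃ U : Ω → ℝ, Measurable U ∧ Integrable U μ ∧ (∀ ω, Z ω ≤ U ω) ∧ c = ∫ ω, U ω ∂μ}

/-- The Banach space `ℓ^∞(F)` of bounded real functions on `F`, with the supremum norm. -/
abbrev EllInfty (F : Set (𝓧 → ℝ)) : Type _ := lp (fun _ : F => ℝ) ∞

instance (F : Set (𝓧 → ℝ)) : MeasurableSpace (EllInfty F) := borel _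

instance (F : Set (𝓧 → ℝ)) : BorelSpace (EllInfty F) := ⟨rfl⟩

/-- Every sample path `f ↦ f(x) - P f`, `f ∈ F`, is bounded. -/
def HasBoundedPaths (P : Measure 𝓧) (F : Set (𝓧 → ℝ)) : Prop :=
  ∀ x : 𝓧, ∃ C : ℝ, ∀ f ∈ F, |f x - ∫ y, f y ∂P| ≤ C

theorem memℓp_empProc {P : Measure 𝓧} {F : Set (𝓧 → ℝ)} (hF : HasBoundedPaths P F)
    {n : ℕ} (x : Fin n → 𝓧) : Memℓp (fun f : F => empProc P x f.1) ∞ := by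
  choose C hC using hF
  refine memℓp_infty ⟨√(n : ℝ) * ((n : ℝ)⁻¹ * ∑ i, C (x i)), ?_⟩
  rintro _ ⟨f, rfl⟩
  have hsum : |∑ i, (f.1 (x i) - ∫ y, f.1 y ∂P)| ≤ ∑ i, C (x i) :=
    (Finset.abs_sum_le_sum_abs _ _).trans (Finset.sum_le_sum fun i _ => hC (x i) f.1 f.2)
  have heq : empProc P x f.1
      = √(n : ℝ) * ((n : ℝ)⁻¹ * ∑ i, (f.1 (x i) - ∫ y, f.1 y ∂P)) := by
    rcases Nat.eq_zero_or_pos n with rfl | hn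
    · simp [empProc]
    · have hn' : (n : ℝ) ≠ 0 := by positivity
      simp only [empProc, empMean, Finset.sum_sub_distrib, Finset.sum_const, Finset.card_univ,
        Fintype.card_fin, nsmul_eq_mul]
      field_simp
  simp only [heq, Real.norm_eq_abs, abs_mul, abs_inv, Nat.abs_cast, abs_of_nonneg (Real.sqrt_nonneg _)]
  gcongr

/-- The empirical process as a random element of `ℓ^∞(F)`. -/
def empProcLInfty {P : Measure 𝓧} {F : Set (𝓧 → ℝ)} (hF : HasBoundedPaths P F)
    {n : ℕ} (x : Fin n → 𝓧) : EllInfty F :=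
  ⟨fun f => empProc P x f.1, memℓp_empProc hF x⟩

/-- The class `F` is `P`-Donsker: for i.i.d. observations from `P`, the empirical process
`𝔾ₙ` converges weakly (in the sense of outer expectations of bounded continuous functions) in
`ℓ^∞(F)` to a tight Borel probability measure. -/
def IsDonsker (P : Measure 𝓧) (F : Set (𝓧 → ℝ)) : Prop :=
  (∀ f ∈ F, Measurable f ∧ MemLp f 2 P) ∧
  ∃ hF : HasBoundedPaths P F,
  ∃ G : Measure (EllInfty F), IsProbabilityMeasure G ∧ IsTightMeasureSet {G} ∧
    ∀ φ : BoundedContinuousFunction (EllInfty F) ℝ,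
      Tendsto (fun n : ℕ => outerExpectation (Measure.pi fun _ : Fin n => P)
        (fun x => φ (empProcLInfty hF x))) atTop (𝓝 (∫ z, φ z ∂G))

end EmpiricalProcess

/-! ### Metric projections -/

section Projection

variable {E : Type*} [NormedAddCommGroup E]

/-- `t` is a nearest point of `K` to `f`. -/
def IsMetricProj (K : Set E) (f t : E) : Prop := t ∈ K ∧ ∀ s ∈ K, ‖f - t‖ ≤ ‖f - s‖

/-- The metric projection of `f` onto `K`: the nearest point, which exists and is unique when `K`
is a nonempty closed convex subset of a Hilbert space. -/
def metricProj (K : Set E) (f : E) : E := Classical.epsilon (IsMetricProj K f)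

end Projection

/-! ### Likelihood models, Hellinger scores and the tangent cone -/

/-- The Hellinger distance, `h(p,q)² = ∫ (√p - √q)² dλ`. -/
def hellinger {𝓧 : Type*} [MeasurableSpace 𝓧] (lam : Measure 𝓧) (p q : 𝓧 → ℝ≥0) : ℝ :=
  √(∫ x, (√(p x : ℝ) - √(q x : ℝ)) ^ 2 ∂lam)

/-- A model `{p_θ : θ ∈ Θ}` of probability densities with respect to `lam`, containing the true
density `p₀ = p_{θ₀}`. -/
structure LikelihoodModel (Θ : Type*) {𝓧 : Type*} [MeasurableSpace 𝓧] (lam : Measure 𝓧) where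
  /-- the density `p_θ` -/
  p : Θ → 𝓧 → ℝ≥0
  measurable_p : ∀ θ, Measurable (p θ)
  lintegral_p : ∀ θ, ∫⁻ x, (p θ x : ℝ≥0∞) ∂lam = 1
  /-- a parameter value that generates the data -/
  θ₀ : Θ

namespace LikelihoodModel

variable {Θ 𝓧 : Type*} [MeasurableSpace 𝓧] {lam : Measure 𝓧} (M : LikelihoodModel Θ lam)

/-- The true density `p₀`. -/
def p₀ : 𝓧 → ℝ≥0 := M.p M.θ₀

/-- The probability measure `P_θ` with density `p_θ`. -/
def law (θ : Θ) : Measure 𝓧 := lam.withDensity fun x => (M.p θ x : ℝ≥0∞)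

/-- The true probability measure `P₀`. -/
def P₀ : Measure 𝓧 := M.law M.θ₀

instance (θ : Θ) : IsProbabilityMeasure (M.law θ) :=
  ⟨by rw [law, withDensity_apply _ MeasurableSet.univ, Measure.restrict_univ, M.lintegral_p]⟩

instance : IsProbabilityMeasure M.P₀ := inferInstanceAs (IsProbabilityMeasure (M.law M.θ₀))

/-- The Hellinger distance `h(p_θ, p₀)`. -/
def h (θ : Θ) : ℝ := hellinger lam (M.p θ) M.p₀

/-- `S_θ = √(p_θ/p₀) - 1`. The ratio is read as `1` on the `P₀`-null set `{p₀ = 0}`. -/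
def S (θ : Θ) (x : 𝓧) : ℝ :=
  if M.p₀ x = 0 then 0 else √((M.p θ x : ℝ) / (M.p₀ x : ℝ)) - 1

theorem measurable_S (θ : Θ) : Measurable (M.S θ) := by
  have h0 : Measurable M.p₀ := M.measurable_p _
  have h1 := M.measurable_p θ
  unfold S
  refine Measurable.ite (h0 (measurableSet_singleton 0)) measurable_const ?_
  fun_prop

theorem memLp_S (θ : Θ) : MemLp (M.S θ) 2 M.P₀ := by
  rw [memLp_two_iff_integrable_sq (M.measurable_S θ).aestronglyMeasurable]
  refine ⟨((M.measurable_S θ).pow_const 2).aestronglyMeasurable, ?_⟩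
  have h0 : Measurable fun x => (M.p M.θ₀ x : ℝ≥0∞) := (M.measurable_p _).coe_nnreal_ennreal
  rw [hasFiniteIntegral_iff_enorm, P₀, law,
    lintegral_withDensity_eq_lintegral_mul _ h0 ((M.measurable_S θ).pow_const 2).enorm]
  calc _ ≤ ∫⁻ x, ((M.p θ x : ℝ≥0∞) + (M.p M.θ₀ x : ℝ≥0∞)) ∂lam := by
        refine lintegral_mono fun x => ?_
        simp only [Pi.mul_apply]
        by_cases hx : M.p₀ x = 0
        · simp [S, hx]
        · have hpos : (0 : ℝ) < M.p₀ x := by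
            have := pos_iff_ne_zero.2 hx
            exact_mod_cast this
          have hq : (0 : ℝ) ≤ M.p θ x := (M.p θ x).2
          have e1 : (M.p M.θ₀ x : ℝ≥0∞) = ENNReal.ofReal (M.p₀ x : ℝ) := by
            simp [p₀]
          have e2 : (M.p θ x : ℝ≥0∞) = ENNReal.ofReal (M.p θ x : ℝ) := by simp
          rw [e1, e2, Real.enorm_eq_ofReal (sq_nonneg _), ← ENNReal.ofReal_mul hpos.le,
            ← ENNReal.ofReal_add hq hpos.le]
          refine ENNReal.ofReal_le_ofReal ?_
          simp only [S, hx, if_false]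
          have hs := Real.sq_sqrt (div_nonneg hq hpos.le)
          have hs0 := Real.sqrt_nonneg ((M.p θ x : ℝ) / (M.p₀ x : ℝ))
          have hd : (M.p₀ x : ℝ) * ((M.p θ x : ℝ) / (M.p₀ x : ℝ)) = M.p θ x := by
            field_simp
          nlinarith [mul_nonneg hpos.le hs0]
    _ = 1 + 1 := by
        rw [lintegral_add_left (M.measurable_p θ).coe_nnreal_ennreal, M.lintegral_p, M.lintegral_p]
    _ < ∞ := by simp

/-- `S_θ` as an element of `L²(P₀)`. -/
def SLp (θ : Θ) : Lp ℝ 2 M.P₀ := (M.memLp_S θ).toLp (M.S θ)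

/-- The normalized Hellinger scores `s_p = (√(p/p₀) - 1)/h(p,p₀)` with `0 < h(p,p₀) ≤ ε`,
that is, the class `𝓓_ε`, as a class of functions. -/
def scores (ε : ℝ) : Set (𝓧 → ℝ) :=
  {f | ∃ θ, 0 < M.h θ ∧ M.h θ ≤ ε ∧ f = fun x => M.S θ x / M.h θ}

/-- The generalized Hellinger scores `𝓓 ⊆ L²(P₀)`: all limit points of `𝓓_ε` as `ε → 0`. -/
def limitScores : Set (Lp ℝ 2 M.P₀) :=
  {d | ∀ ε : ℝ, 0 < ε → d ∈ closure {e : Lp ℝ 2 M.P₀ | ∃ f ∈ M.scores ε, e =ᵐ[M.P₀] f}}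

/-- `v` selects, for each limit score, a function in its `L²(P₀)` class. -/
def IsVersion (v : Lp ℝ 2 M.P₀ → 𝓧 → ℝ) : Prop := ∀ d ∈ M.limitScores, v d =ᵐ[M.P₀] d

/-- The class `𝓓_ε ∪ 𝓓` of functions, the elements of `𝓓` being represented through `v`. -/
def closedScores (ε : ℝ) (v : Lp ℝ 2 M.P₀ → 𝓧 → ℝ) : Set (𝓧 → ℝ) :=
  M.scores ε ∪ v '' M.limitScores

/-- The tangent cone `𝓣 = {τ d : τ ≥ 0, d ∈ 𝓓}`. -/
def tangentCone : Set (Lp ℝ 2 M.P₀) :=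
  {t | ∃ τ : ℝ, 0 ≤ τ ∧ ∃ d ∈ M.limitScores, t = τ • d}

/-- The projection `𝕋 S_θ` of `S_θ` onto the tangent cone. -/
def projS (θ : Θ) : Lp ℝ 2 M.P₀ := metricProj M.tangentCone (M.SLp θ)

/-- The tangents `g_p ∈ 𝓣` and remainders `R_p ∈ L²(λ)` satisfy
`√p - √p₀ = g_p √p₀ + h(p,p₀) R_p`. -/
def IsHellingerExpansion (g : Θ → Lp ℝ 2 M.P₀) (R : Θ → Lp ℝ 2 lam) : Prop :=
  ∀ θ, g θ ∈ M.tangentCone ∧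
    ∀ᵐ x ∂lam, √(M.p θ x : ℝ) - √(M.p₀ x : ℝ)
      = g θ x * √(M.p₀ x : ℝ) + M.h θ * R θ x

/-- Differentiability in quadratic mean. -/
def IsDQM : Prop :=
  (∀ θ, M.law θ ≪ M.P₀) ∧
  ∃ (g : Θ → Lp ℝ 2 M.P₀) (R : Θ → Lp ℝ 2 lam), M.IsHellingerExpansion g R ∧
    Tendsto (fun ε : ℝ => ⨆ θ ∈ {θ | M.h θ ≤ ε}, ‖R θ‖ₑ) (𝓝[>] 0) (𝓝 0)

/-- The local neighborhood `{θ : h(p_θ, p₀) ≤ rₙ/√n}`. -/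
def nbhd (r : ℕ → ℝ) (n : ℕ) : Set Θ := {θ | M.h θ ≤ r n / √(n : ℝ)}

/-- `rₙ`-differentiability in quadratic mean. -/
def IsRateDQM (r : ℕ → ℝ) : Prop :=
  (∀ θ, M.law θ ≪ M.P₀) ∧
  ∃ (g : Θ → Lp ℝ 2 M.P₀) (R : Θ → Lp ℝ 2 lam), M.IsHellingerExpansion g R ∧
    Tendsto (fun n => ⨆ θ ∈ M.nbhd r n, ENNReal.ofReal (r n) * ‖R θ‖ₑ) atTop (𝓝 0)

/-- `n Lₙ(θ) = ∑ log p_θ(xᵢ)`, with `log 0 = -∞`. -/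
def logLik (n : ℕ) (x : Fin n → 𝓧) (θ : Θ) : EReal := ∑ i, ENNReal.log (M.p θ (x i) : ℝ≥0∞)

/-- `ℓₙ = n ℙₙ log p₀`. -/
def ell (n : ℕ) (x : Fin n → 𝓧) : ℝ := n * empMean x fun y => Real.log (M.p₀ y)

/-- The class `{log p : p ∈ 𝓟}` is `P₀`-Glivenko–Cantelli. In particular each `log p` is
`P₀`-integrable, so that `p > 0` holds `P₀`-almost everywhere. -/
def LogDensitiesGC {Ω : Type*} [MeasurableSpace Ω] (Pr : Measure Ω) (X : ℕ → Ω → 𝓧) : Prop :=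
  (∀ θ, ∀ᵐ x ∂M.P₀, 0 < M.p θ x) ∧
  IsGlivenkoCantelli Pr X M.P₀ (Set.range fun θ x => Real.log (M.p θ x))

/-- The Donsker and envelope condition: for some `ε > 0` the class `𝓓_ε ∪ 𝓓` is `P₀`-Donsker and
has an envelope in `L²(P₀)`. -/
def ScoresDonsker : Prop :=
  ∃ ε : ℝ, 0 < ε ∧ ∃ v, M.IsVersion v ∧ IsDonsker M.P₀ (M.closedScores ε v) ∧
    ∃ D : 𝓧 → ℝ, MemLp D 2 M.P₀ ∧ ∀ f ∈ M.closedScores ε v, ∀ x, |f x| ≤ D x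

/-- High-level conditions on the scores along `rₙ`; `t θ` is the function that represents the
projection `𝕋 S_θ` of `S_θ` onto the tangent cone. -/
structure ScoreConditions {Ω : Type*} [MeasurableSpace Ω] (Pr : Measure Ω) (X : ℕ → Ω → 𝓧)
    (r : ℕ → ℝ) (t : Θ → 𝓧 → ℝ) : Prop where
  dqm : M.IsRateDQM r
  envelope : ∃ ε : ℝ, 0 < ε ∧ ∃ v, M.IsVersion v ∧
    IsGlivenkoCantelli Pr X M.P₀ ((fun f x => f x ^ 2) '' M.closedScores ε v) ∧
    ∃ D : 𝓧 → ℝ, MemLp D 2 M.P₀ ∧ (∀ f ∈ M.closedScores ε v, ∀ x, |f x| ≤ D x) ∧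
      IsLittleOP Pr (fun n ω => ⨆ i : Fin n, ENNReal.ofReal (D (sample X n ω i)))
        (fun n => √(n : ℝ) / r n ^ 3)
  empirical : IsLittleOP Pr (fun n ω => ⨆ θ ∈ M.nbhd r n,
      ENNReal.ofReal |empProc M.P₀ (sample X n ω) (fun y => M.S θ y - t θ y)|)
    (fun n => 1 / √(n : ℝ))
  squares : IsLittleOP Pr (fun n ω => ⨆ θ ∈ M.nbhd r n,
      ENNReal.ofReal |empMean (sample X n ω) (fun y => M.S θ y ^ 2) - ∫ y, M.S θ y ^ 2 ∂M.P₀|)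
    (fun n => 1 / (n : ℝ))

section FiniteDimensional

variable {d : ℕ} (ψ : OrthonormalBasis (Fin d) ℝ (Submodule.span ℝ M.tangentCone))

/-- The basis function `ψ_j`, as a function. -/
def psiFun (j : Fin d) (x : 𝓧) : ℝ := (ψ j : Lp ℝ 2 M.P₀) x

/-- The local parameter `γ(θ)`: the coordinates, in the basis `ψ`, of the projection of
`2 (√(p_θ/p₀) - 1)` onto the tangent cone. -/
def gamma (θ : Θ) : EuclideanSpace ℝ (Fin d) :=
  WithLp.toLp 2 fun j =>
    inner ℝ (ψ j : Lp ℝ 2 M.P₀) (metricProj M.tangentCone ((2 : ℝ) • M.SLp θ))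

/-- `𝕍ₙ = 𝔾ₙ(ψ)`. -/
def V (n : ℕ) (x : Fin n → 𝓧) : EuclideanSpace ℝ (Fin d) :=
  WithLp.toLp 2 fun j => empProc M.P₀ x (M.psiFun ψ j)

/-- `γ̂ₙ`, determined by `√n γ̂ₙ = 𝕍ₙ`. -/
def gammaHat (n : ℕ) (x : Fin n → 𝓧) : EuclideanSpace ℝ (Fin d) := (√(n : ℝ))⁻¹ • M.V ψ n x

end FiniteDimensional

end LikelihoodModel

/-! ### Local quadratic approximation of a criterion function -/

/-- The local quadratic approximation for the criterion `n Lₙ` over the sets `Θₙ`, with local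
parameter `γ`, closed convex cone `T`, asymptotic variance `Sigma` and the statistics `ℓₙ`, `γ̂ₙ`,
`𝕍ₙ` of the sample `(X₁, …, Xₙ)`. -/
structure LocalQuadraticApprox {Θ 𝓧 Ω : Type*} [MeasurableSpace 𝓧] [MeasurableSpace Ω]
    (Pr : Measure Ω) [IsProbabilityMeasure Pr] (X : ℕ → Ω → 𝓧)
    (nL : ∀ n : ℕ, (Fin n → 𝓧) → Θ → EReal) (Θn : ℕ → Set Θ) {d : ℕ}
    (γ : Θ → EuclideanSpace ℝ (Fin d)) (T : Set (EuclideanSpace ℝ (Fin d)))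
    (Sigma : Matrix (Fin d) (Fin d) ℝ) (ell : ∀ n : ℕ, (Fin n → 𝓧) → ℝ)
    (γhat V : ∀ n : ℕ, (Fin n → 𝓧) → EuclideanSpace ℝ (Fin d)) : Prop where
  measurable_ell : ∀ n, Measurable (ell n)
  measurable_γhat : ∀ n, Measurable (γhat n)
  expansion : IsLittleOP Pr (fun n ω => ⨆ θ ∈ Θn n,
      EReal.abs (nL n (sample X n ω) θ -
        ((ell n (sample X n ω) + 1 / 2 * ‖√(n : ℝ) • γhat n (sample X n ω)‖ ^ 2
          - 1 / 2 * ‖√(n : ℝ) • (γhat n (sample X n ω) - γ θ)‖ ^ 2 : ℝ) : EReal)))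
    (fun _ => 1)
  γ_tendsto : Tendsto (fun n => ⨆ θ ∈ Θn n, ‖γ θ‖ₑ) atTop (𝓝 0)
  proj : ∀ n x, IsMetricProj T (V n x) (√(n : ℝ) • γhat n x)
  clt : TendstoInDistribution (fun n ω => V n (sample X n ω)) atTop id (fun _ => Pr)
    (multivariateGaussian 0 Sigma)

/-- The local quadratic approximation of the log-likelihood over `{θ : h(p_θ,p₀) ≤ rₙ/√n}` with
`ℓₙ = n ℙₙ log p₀`, `√n γ̂ₙ = 𝕍ₙ = 𝔾ₙ(ψ)`, `Σ = I_d`, where `γ` is given by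
`𝕋 (2 (√(p_θ/p₀) - 1)) = γ(θ)'ψ` and is a local reparameterization: near the identified set
`{θ : h(p_θ,p₀) = 0}` it vanishes exactly on that set. -/
def LikelihoodModel.QuadraticExpansion {Θ 𝓧 Ω : Type*} [MeasurableSpace 𝓧] [MeasurableSpace Ω]
    {lam : Measure 𝓧} (M : LikelihoodModel Θ lam)
    {d : ℕ} (ψ : OrthonormalBasis (Fin d) ℝ (Submodule.span ℝ M.tangentCone))
    (Pr : Measure Ω) [IsProbabilityMeasure Pr] (X : ℕ → Ω → 𝓧) (r : ℕ → ℝ) : Prop :=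
  (∀ θ, IsMetricProj M.tangentCone ((2 : ℝ) • M.SLp θ)
    (∑ j, M.gamma ψ θ j • (ψ j : Lp ℝ 2 M.P₀))) ∧
  (∃ ε : ℝ, 0 < ε ∧ ∀ θ, M.h θ ≤ ε → (M.gamma ψ θ = 0 ↔ M.h θ = 0)) ∧
  LocalQuadraticApprox Pr X M.logLik (M.nbhd r) (M.gamma ψ) Set.univ 1 M.ell
    (M.gammaHat ψ) (M.V ψ)

end GenScore

end

open GenScore

/-! The expansion rests on `log (p_θ/p₀) = 2 log (1 + S_θ)` and the second-order Taylor formula `2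
log (1 + s) = 2s - s² + O(b s²)` for `|s| ≤ b ≤ 1/2`. On the neighbourhood `h ≤ rₙ/√n` the envelope
gives `|S_θ(Xᵢ)| ≤ h D(Xᵢ) = o(rₙ⁻²)`, while the sum of the `S_θ(Xᵢ)²` is at most `rₙ² + o(1)`, so
the Taylor remainder vanishes. The mean of `S_θ` is `-h²/2` and that of `S_θ²` is `h²`, whereas
tangents have mean zero. Replacing `S_θ` by its projection in the linear term therefore leaves the
quadratic term `-2 n h²`. Pythagoras on the cone gives `h² = ‖𝕋S‖² + ‖S - 𝕋S‖²`, and `n ‖S - 𝕋S‖² ≤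
(rₙ ‖R‖)²` is negligible by differentiability in quadratic mean. The deterministic part is
`abs_logLik_sub_le`, the uniform part `LocalScoreBounds.isLittleOP_logLik`. In coordinates,
completing the square and Cramér–Wold give `LocalScoreBounds.quadraticExpansion`.

Under the Donsker hypothesis a rate has to be produced. For every fixed level `K` in place of `rₙ`
the required bounds hold for all large `n` (`eventually_levelBounds`), and a diagonal sequence `rₙ =
kₙ + 1` with `kₙ` growing slowly then works. At a fixed level everything reduces to two facts about
normalized scores near `p₀`: the empirical process at `(S_θ - 𝕋S_θ)/h` is uniformly small, and `ℙₙ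
(S_θ/h)²` is uniformly close to `1`.

Both come from finite partitions. Tightness of the limit concentrates the paths near a compact set
of `ℓ^∞(F)`, so `F` has finitely many cells over each of which the empirical process oscillates
little. For the first fact, one representative per cell is handled by Chebyshev, its variance being
at most `‖R‖²`; the number of cells is fixed before the neighbourhood shrinks.

For the second fact one needs small empirical second moments of differences within a cell. The
oscillation bound holds for the partial sums over every subsample, since a subsample is again i.i.d.
A signed sum is a difference of two such partial sums, and by Paley–Zygmund a large sum of squares
makes at least a fifth of all signed sums large. Averaging over the sign vectors bounds the
probability of a large sum of squares (`IsDonsker.exists_finite_partition_sq`). -/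

namespace GenScore

/-! ### Metric projection onto a closed convex cone -/

section Projection

variable {E : Type*} [NormedAddCommGroup E] [InnerProductSpace ℝ E]

theorem exists_isMetricProj [CompleteSpace E] {K : Set E} (hne : K.Nonempty) (hc : IsClosed K)
    (hK : Convex ℝ K) (f : E) : ∃ t, IsMetricProj K f t := by
  obtain ⟨t, ht, h⟩ := exists_norm_eq_iInf_of_complete_convex hne hc.isComplete hK f
  refine ⟨t, ht, fun s hs => ?_⟩
  rw [h]
  exact ciInf_le ⟨0, by rintro _ ⟨w, rfl⟩; positivity⟩ (⟨s, hs⟩ : K)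

theorem isMetricProj_metricProj [CompleteSpace E] {K : Set E} (hne : K.Nonempty)
    (hc : IsClosed K) (hK : Convex ℝ K) (f : E) : IsMetricProj K f (metricProj K f) :=
  Classical.epsilon_spec (exists_isMetricProj hne hc hK f)

theorem IsMetricProj.inner_le_zero {K : Set E} (hK : Convex ℝ K) {f t : E}
    (h : IsMetricProj K f t) {w : E} (hw : w ∈ K) : inner ℝ (f - t) (w - t) ≤ 0 := by
  refine (norm_eq_iInf_iff_real_inner_le_zero hK h.1).1 (le_antisymm ?_ ?_) w hw
  · have : Nonempty K := ⟨⟨t, h.1⟩⟩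
    exact le_ciInf fun s => h.2 s.1 s.2
  · exact ciInf_le ⟨0, by rintro _ ⟨w, rfl⟩; positivity⟩ (⟨t, h.1⟩ : K)

theorem IsMetricProj.unique {K : Set E} (hK : Convex ℝ K) {f t u : E}
    (ht : IsMetricProj K f t) (hu : IsMetricProj K f u) : t = u := by
  have h1 := ht.inner_le_zero hK hu.1
  have h2 := hu.inner_le_zero hK ht.1
  have h3 : inner ℝ (f - t) (u - t) + inner ℝ (f - u) (t - u) = ‖u - t‖ ^ 2 := by
    rw [← real_inner_self_eq_norm_sq, ← neg_sub u t, inner_neg_right, ← sub_eq_add_neg,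
      ← inner_sub_left]
    congr 1
    abel
  have h4 : ‖u - t‖ = 0 := by
    have := sq_nonneg ‖u - t‖
    exact pow_eq_zero_iff (two_ne_zero) |>.1 (by linarith)
  exact (sub_eq_zero.1 (norm_eq_zero.1 h4)).symm

theorem IsMetricProj.smul {K : Set E} (hcone : ∀ c : ℝ, 0 ≤ c → ∀ s ∈ K, c • s ∈ K) {f t : E}
    (h : IsMetricProj K f t) {c : ℝ} (hc : 0 < c) : IsMetricProj K (c • f) (c • t) := by
  refine ⟨hcone c hc.le t h.1, fun s hs => ?_⟩
  have h1 := h.2 (c⁻¹ • s) (hcone _ (inv_nonneg.2 hc.le) s hs)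
  have e : c • f - s = c • (f - c⁻¹ • s) := by
    rw [smul_sub, smul_inv_smul₀ hc.ne']
  rw [← smul_sub, e, norm_smul, norm_smul]
  gcongr

/-- The cone contains the whole ray through `t`, so the variational inequality may be tested at both
`0` and `2t`; the two resulting signs are opposite. -/
theorem IsMetricProj.inner_self_eq_zero {K : Set E} (hK : Convex ℝ K)
    (hcone : ∀ c : ℝ, 0 ≤ c → ∀ s ∈ K, c • s ∈ K) {f t : E}
    (h : IsMetricProj K f t) : inner ℝ (f - t) t = 0 := by
  have h1 := h.inner_le_zero hK (hcone 0 le_rfl t h.1)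
  have h2 := h.inner_le_zero hK (hcone 2 zero_le_two t h.1)
  rw [zero_smul, zero_sub, inner_neg_right] at h1
  rw [two_smul, add_sub_cancel_right] at h2
  linarith

theorem IsMetricProj.norm_sq_eq {K : Set E} (hK : Convex ℝ K)
    (hcone : ∀ c : ℝ, 0 ≤ c → ∀ s ∈ K, c • s ∈ K) {f t : E}
    (h : IsMetricProj K f t) : ‖f‖ ^ 2 = ‖t‖ ^ 2 + ‖f - t‖ ^ 2 := by
  have h1 := norm_add_sq_real (f - t) t
  rw [sub_add_cancel, h.inner_self_eq_zero hK hcone] at h1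
  linarith

end Projection

/-! ### Norms in `L²` as integrals of squares -/

section LTwo

variable {α : Type*} [MeasurableSpace α] {μ : Measure α}

theorem norm_sq_Lp_two (f : Lp ℝ 2 μ) : ‖f‖ ^ 2 = ∫ x, f x ^ 2 ∂μ := by
  rw [← real_inner_self_eq_norm_sq, L2.inner_def]
  refine integral_congr_ae (Eventually.of_forall fun x => ?_)
  simp [sq]

theorem integrable_sq_Lp_two (f : Lp ℝ 2 μ) : Integrable (fun x => f x ^ 2) μ :=
  (Lp.memLp f).integrable_sq

end LTwo

namespace LikelihoodModel

variable {Θ 𝓧 : Type*} [MeasurableSpace 𝓧] {lam : Measure 𝓧} (M : LikelihoodModel Θ lam)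

/-! ### Hellinger scores -/

theorem integral_P₀ (f : 𝓧 → ℝ) : ∫ x, f x ∂M.P₀ = ∫ x, (M.p₀ x : ℝ) * f x ∂lam :=
  integral_withDensity_eq_integral_smul (M.measurable_p _) f

theorem ae_p₀_pos : ∀ᵐ x ∂M.P₀, 0 < M.p₀ x := by
  have h0 : Measurable M.p₀ := M.measurable_p _
  rw [P₀, law, ae_withDensity_iff (M.measurable_p _).coe_nnreal_ennreal]
  refine Eventually.of_forall fun x hx => ?_
  exact pos_iff_ne_zero.2 fun h => hx (by simpa [p₀] using h)

/-- Absolute continuity forbids mass on `{p₀ = 0}`. This makes `h` equal to the `L²(P₀)` norm of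
`S_θ`, with nothing lost off the support of `p₀`. -/
theorem ae_eq_zero_of_law_absolutelyContinuous {θ : Θ} (hac : M.law θ ≪ M.P₀) :
    ∀ᵐ x ∂lam, M.p₀ x = 0 → M.p θ x = 0 := by
  have h : ∀ᵐ x ∂M.law θ, 0 < M.p₀ x := hac.ae_le M.ae_p₀_pos
  rw [law, ae_withDensity_iff (M.measurable_p _).coe_nnreal_ennreal] at h
  filter_upwards [h] with x hx h0
  by_contra hne
  exact (hx (by exact_mod_cast hne)).ne' h0

theorem integrable_p (θ : Θ) : Integrable (fun x => (M.p θ x : ℝ)) lam := by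
  refine ⟨(M.measurable_p θ).coe_nnreal_real.aestronglyMeasurable, ?_⟩
  rw [hasFiniteIntegral_iff_enorm]
  have : (fun x => ‖(M.p θ x : ℝ)‖ₑ) = fun x => (M.p θ x : ℝ≥0∞) := by
    funext x
    simp [Real.enorm_eq_ofReal]
  rw [this, M.lintegral_p]
  simp

theorem integral_p (θ : Θ) : ∫ x, (M.p θ x : ℝ) ∂lam = 1 := by
  rw [integral_eq_lintegral_of_nonneg_ae (Eventually.of_forall fun x => NNReal.coe_nonneg _)
    (M.measurable_p θ).coe_nnreal_real.aestronglyMeasurable]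
  simp [M.lintegral_p]

theorem integrable_sqrt_mul_sqrt (θ : Θ) :
    Integrable (fun x => √(M.p θ x : ℝ) * √(M.p₀ x : ℝ)) lam := by
  have h1 := (M.measurable_p θ).coe_nnreal_real
  have h2 : Measurable fun x => (M.p₀ x : ℝ) := (M.measurable_p M.θ₀).coe_nnreal_real
  refine ((M.integrable_p θ).add (M.integrable_p M.θ₀)).mono'
    (h1.sqrt.mul h2.sqrt).aestronglyMeasurable (Eventually.of_forall fun x => ?_)
  rw [Real.norm_eq_abs, abs_of_nonneg (by positivity)]
  have e1 := Real.sq_sqrt (NNReal.coe_nonneg (M.p θ x))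
  have e2 := Real.sq_sqrt (NNReal.coe_nonneg (M.p₀ x))
  change _ ≤ (M.p θ x : ℝ) + (M.p₀ x : ℝ)
  nlinarith [sq_nonneg (√(M.p θ x : ℝ) - √(M.p₀ x : ℝ))]

theorem sqrt_sub_sqrt_sq (θ : Θ) (x : 𝓧) : (√(M.p θ x : ℝ) - √(M.p₀ x : ℝ)) ^ 2
    = (M.p θ x : ℝ) + (M.p₀ x : ℝ) - 2 * (√(M.p θ x : ℝ) * √(M.p₀ x : ℝ)) := by
  have e1 := Real.sq_sqrt (NNReal.coe_nonneg (M.p θ x))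
  have e2 := Real.sq_sqrt (NNReal.coe_nonneg (M.p₀ x))
  nlinarith

theorem integrable_sqrt_sub_sqrt_sq (θ : Θ) :
    Integrable (fun x => (√(M.p θ x : ℝ) - √(M.p₀ x : ℝ)) ^ 2) lam := by
  simp only [sqrt_sub_sqrt_sq]
  exact ((M.integrable_p θ).add (M.integrable_p M.θ₀)).sub
    ((M.integrable_sqrt_mul_sqrt θ).const_mul 2)

theorem h_nonneg (θ : Θ) : 0 ≤ M.h θ := Real.sqrt_nonneg _

theorem h_sq (θ : Θ) : M.h θ ^ 2 = ∫ x, (√(M.p θ x : ℝ) - √(M.p₀ x : ℝ)) ^ 2 ∂lam :=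
  Real.sq_sqrt (integral_nonneg fun _ => sq_nonneg _)

theorem sqrt_p₀_mul_S (θ : Θ) {x : 𝓧} (hx : M.p₀ x ≠ 0) :
    √(M.p₀ x : ℝ) * M.S θ x = √(M.p θ x : ℝ) - √(M.p₀ x : ℝ) := by
  have hpos : 0 < √(M.p₀ x : ℝ) := Real.sqrt_pos.2 (by exact_mod_cast pos_iff_ne_zero.2 hx)
  rw [S, if_neg hx, Real.sqrt_div (NNReal.coe_nonneg (M.p θ x))]
  field_simp

/-- Since `p₀ S_θ = √p_θ √p₀ - p₀`, the mean is the Hellinger affinity minus one, and `h²` is twice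
one minus the affinity. -/
theorem integral_S (θ : Θ) : ∫ x, M.S θ x ∂M.P₀ = -(M.h θ ^ 2 / 2) := by
  have e : ∀ x, (M.p₀ x : ℝ) * M.S θ x = √(M.p θ x : ℝ) * √(M.p₀ x : ℝ) - (M.p₀ x : ℝ) := by
    intro x
    by_cases hx : M.p₀ x = 0
    · simp [hx]
    · have e2 := Real.mul_self_sqrt (NNReal.coe_nonneg (M.p₀ x))
      have h1 := M.sqrt_p₀_mul_S θ hx
      calc (M.p₀ x : ℝ) * M.S θ x = √(M.p₀ x : ℝ) * (√(M.p₀ x : ℝ) * M.S θ x) := by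
            rw [← mul_assoc, e2]
        _ = _ := by rw [h1, mul_sub, e2, mul_comm]
  have hint := M.integrable_sqrt_mul_sqrt θ
  have h0 : ∫ x, (M.p₀ x : ℝ) ∂lam = 1 := M.integral_p M.θ₀
  have i0 : Integrable (fun x => (M.p₀ x : ℝ)) lam := M.integrable_p M.θ₀
  rw [integral_P₀, h_sq]
  simp only [e, sqrt_sub_sqrt_sq]
  rw [integral_sub hint i0, integral_sub (f := fun x => (M.p θ x : ℝ) + (M.p₀ x : ℝ))
    ((M.integrable_p θ).add i0) (hint.const_mul 2),
    integral_add (M.integrable_p θ) i0, integral_const_mul, h0, M.integral_p]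
  ring

theorem integral_S_sq {θ : Θ} (hac : M.law θ ≪ M.P₀) :
    ∫ x, M.S θ x ^ 2 ∂M.P₀ = M.h θ ^ 2 := by
  rw [integral_P₀, h_sq]
  refine integral_congr_ae ?_
  filter_upwards [M.ae_eq_zero_of_law_absolutelyContinuous hac] with x hx
  by_cases h0 : M.p₀ x = 0
  · simp [h0, hx h0]
  · have e2 := Real.sq_sqrt (NNReal.coe_nonneg (M.p₀ x))
    rw [← M.sqrt_p₀_mul_S θ h0, mul_pow, e2]

theorem norm_SLp {θ : Θ} (hac : M.law θ ≪ M.P₀) : ‖M.SLp θ‖ = M.h θ := by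
  refine (pow_left_inj₀ (norm_nonneg _) (M.h_nonneg θ) two_ne_zero).1 ?_
  rw [norm_sq_Lp_two, ← M.integral_S_sq hac]
  refine integral_congr_ae ?_
  filter_upwards [(M.memLp_S θ).coeFn_toLp] with x hx
  rw [SLp, hx]

theorem p_eq_of_h_eq_zero (hid : ∀ θ, M.p θ =ᵐ[lam] M.p₀ → M.p θ = M.p₀) {θ : Θ}
    (h : M.h θ = 0) : M.p θ = M.p₀ := by
  refine hid θ ?_
  have h2 := M.h_sq θ
  rw [h, zero_pow two_ne_zero, eq_comm,
    integral_eq_zero_iff_of_nonneg (fun _ => sq_nonneg _) (M.integrable_sqrt_sub_sqrt_sq θ)] at h2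
  filter_upwards [h2] with x hx
  have h3 : √(M.p θ x : ℝ) = √(M.p₀ x : ℝ) := by
    have : (√(M.p θ x : ℝ) - √(M.p₀ x : ℝ)) ^ 2 = 0 := hx
    exact sub_eq_zero.1 (pow_eq_zero_iff two_ne_zero |>.1 this)
  exact NNReal.coe_injective <| (Real.sqrt_inj (NNReal.coe_nonneg (M.p θ x)) (NNReal.coe_nonneg (M.p₀ x))).1 h3

/-- Normalized scores exist only for `h > 0`, so the envelope and Donsker conditions say nothing
about parameters with `h = 0`. The convention `hid` removes them pointwise, hence at every
observation. -/
theorem S_eq_zero_of_h_eq_zero (hid : ∀ θ, M.p θ =ᵐ[lam] M.p₀ → M.p θ = M.p₀) {θ : Θ}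
    (h : M.h θ = 0) (x : 𝓧) : M.S θ x = 0 := by
  rw [S, M.p_eq_of_h_eq_zero hid h]
  split_ifs with h0
  · rfl
  · rw [div_self (by exact_mod_cast h0)]
    simp

/-! ### The tangent cone -/

theorem smul_mem_tangentCone {c : ℝ} (hc : 0 ≤ c) {s : Lp ℝ 2 M.P₀} (hs : s ∈ M.tangentCone) :
    c • s ∈ M.tangentCone := by
  obtain ⟨τ, hτ, d, hd, rfl⟩ := hs
  exact ⟨c * τ, mul_nonneg hc hτ, d, hd, smul_smul _ _ _⟩

theorem continuous_integral_Lp_two :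
    Continuous fun f : Lp ℝ 2 M.P₀ => ∫ x, f x ∂M.P₀ := by
  have : (fun f : Lp ℝ 2 M.P₀ => ∫ x, f x ∂M.P₀)
      = fun f => inner ℝ ((memLp_const (1 : ℝ)).toLp (fun _ : 𝓧 => (1 : ℝ)) : Lp ℝ 2 M.P₀) f := by
    funext f
    rw [L2.inner_def]
    refine integral_congr_ae ?_
    filter_upwards [(memLp_const (μ := M.P₀) (p := 2) (1 : ℝ)).coeFn_toLp] with x hx
    rw [hx]
    simp
  rw [this]
  fun_prop

/-- A normalized score has mean `-h/2`, which tends to zero as `h` does, and the mean is continuous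
on `L²(P₀)`. -/
theorem integral_limitScore {d : Lp ℝ 2 M.P₀} (hd : d ∈ M.limitScores) :
    ∫ x, d x ∂M.P₀ = 0 := by
  have key : ∀ ε : ℝ, 0 < ε → |∫ x, d x ∂M.P₀| ≤ ε / 2 := by
    intro ε hε
    have hcl : IsClosed {f : Lp ℝ 2 M.P₀ | |∫ x, f x ∂M.P₀| ≤ ε / 2} :=
      isClosed_le M.continuous_integral_Lp_two.abs continuous_const
    refine closure_minimal ?_ hcl (hd ε hε)
    rintro e ⟨f, ⟨θ, h0, h1, rfl⟩, he⟩
    rw [Set.mem_ofPred_eq, integral_congr_ae he, integral_div, M.integral_S, abs_div, abs_neg,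
      abs_of_nonneg (by positivity), abs_of_pos h0, div_le_iff₀ h0]
    nlinarith
  by_contra hne
  have := key _ (abs_pos.2 hne)
  linarith [abs_pos.2 hne]

theorem integral_tangentCone {t : Lp ℝ 2 M.P₀} (ht : t ∈ M.tangentCone) :
    ∫ x, t x ∂M.P₀ = 0 := by
  obtain ⟨τ, hτ, d, hd, rfl⟩ := ht
  rw [integral_congr_ae (Lp.coeFn_smul τ d)]
  simp [integral_const_mul, M.integral_limitScore hd]

theorem integral_span_tangentCone {t : Lp ℝ 2 M.P₀}
    (ht : t ∈ Submodule.span ℝ M.tangentCone) : ∫ x, t x ∂M.P₀ = 0 := by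
  induction ht using Submodule.span_induction with
  | mem x hx => exact M.integral_tangentCone hx
  | zero => rw [integral_congr_ae (Lp.coeFn_zero ℝ 2 M.P₀)]; simp
  | add x y _ _ hx hy =>
    rw [integral_congr_ae (Lp.coeFn_add x y)]
    simp only [Pi.add_apply]
    rw [integral_add ((Lp.memLp x).integrable one_le_two) ((Lp.memLp y).integrable one_le_two),
      hx, hy, add_zero]
  | smul c x _ hx =>
    rw [integral_congr_ae (Lp.coeFn_smul c x)]
    simp [integral_const_mul, hx]

/-! ### Consequences of the Hellinger expansion -/

variable {M}

theorem IsHellingerExpansion.tangentCone_nonempty {g : Θ → Lp ℝ 2 M.P₀} {R : Θ → Lp ℝ 2 lam}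
    (hg : M.IsHellingerExpansion g R) : M.tangentCone.Nonempty := ⟨_, (hg M.θ₀).1⟩

/-- Multiplied by `√p₀`, the difference `S_θ - g_θ` becomes `h R_θ` on `{p₀ > 0}`; integrating over
all of the space only adds to the right side. -/
theorem IsHellingerExpansion.norm_SLp_sub_le {g : Θ → Lp ℝ 2 M.P₀} {R : Θ → Lp ℝ 2 lam}
    (hg : M.IsHellingerExpansion g R) (θ : Θ) : ‖M.SLp θ - g θ‖ ≤ M.h θ * ‖R θ‖ := by
  refine (pow_le_pow_iff_left₀ (norm_nonneg _)
    (mul_nonneg (M.h_nonneg θ) (norm_nonneg _)) two_ne_zero).1 ?_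
  rw [mul_pow, norm_sq_Lp_two, norm_sq_Lp_two, ← integral_const_mul]
  have e : ∫ x, (M.SLp θ - g θ : Lp ℝ 2 M.P₀) x ^ 2 ∂M.P₀
      = ∫ x, (M.S θ x - g θ x) ^ 2 ∂M.P₀ := by
    refine integral_congr_ae ?_
    filter_upwards [Lp.coeFn_sub (M.SLp θ) (g θ), (M.memLp_S θ).coeFn_toLp] with x h1 h2
    rw [h1, Pi.sub_apply, SLp, h2]
  rw [e, integral_P₀]
  refine integral_mono_of_nonneg (Eventually.of_forall fun x => ?_)
    ((integrable_sq_Lp_two (R θ)).const_mul _) ?_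
  · have := (NNReal.coe_nonneg (M.p₀ x))
    simp only [Pi.zero_apply]
    positivity
  · filter_upwards [(hg θ).2] with x hx
    by_cases h0 : M.p₀ x = 0
    · simp only [h0, NNReal.coe_zero, zero_mul]
      positivity
    · have e2 := Real.sq_sqrt (NNReal.coe_nonneg (M.p₀ x))
      have h1 := M.sqrt_p₀_mul_S θ h0
      have h3 : √(M.p₀ x : ℝ) * (M.S θ x - g θ x) = M.h θ * R θ x := by
        rw [mul_sub, h1, hx]
        ring
      rw [← e2, ← mul_pow, h3, mul_pow]

/-- The projection is at least as close to `S_θ` as the competitor `g_θ` in the cone, so the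
remainder bound passes to `𝕋S_θ`. -/
theorem IsHellingerExpansion.norm_SLp_sub_projS_le {g : Θ → Lp ℝ 2 M.P₀} {R : Θ → Lp ℝ 2 lam}
    (hg : M.IsHellingerExpansion g R) (hclosed : IsClosed M.tangentCone)
    (hconvex : Convex ℝ M.tangentCone) (θ : Θ) : ‖M.SLp θ - M.projS θ‖ ≤ M.h θ * ‖R θ‖ :=
  ((isMetricProj_metricProj hg.tangentCone_nonempty hclosed hconvex _).2 _ (hg θ).1).trans
    (hg.norm_SLp_sub_le θ)

variable (M)

theorem norm_projS_sq (hne : M.tangentCone.Nonempty) (hclosed : IsClosed M.tangentCone)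
    (hconvex : Convex ℝ M.tangentCone) {θ : Θ} (hac : M.law θ ≪ M.P₀) :
    M.h θ ^ 2 = ‖M.projS θ‖ ^ 2 + ‖M.SLp θ - M.projS θ‖ ^ 2 := by
  rw [← M.norm_SLp hac]
  exact (isMetricProj_metricProj hne hclosed hconvex _).norm_sq_eq hconvex
    fun c hc s hs => M.smul_mem_tangentCone hc hs

end LikelihoodModel

/-! ### Linearity of the empirical mean and process; Taylor expansion of the logarithm -/

section EmpiricalMean

variable {𝓧 : Type*}

theorem empMean_add {n : ℕ} (x : Fin n → 𝓧) (f g : 𝓧 → ℝ) :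
    empMean x (fun y => f y + g y) = empMean x f + empMean x g := by
  simp [empMean, Finset.sum_add_distrib, mul_add]

theorem empMean_sub {n : ℕ} (x : Fin n → 𝓧) (f g : 𝓧 → ℝ) :
    empMean x (fun y => f y - g y) = empMean x f - empMean x g := by
  simp [empMean, Finset.sum_sub_distrib, mul_sub]

theorem empMean_const_mul {n : ℕ} (x : Fin n → 𝓧) (c : ℝ) (f : 𝓧 → ℝ) :
    empMean x (fun y => c * f y) = c * empMean x f := by
  simp [empMean, ← Finset.mul_sum]
  ring

theorem natCast_mul_empMean {n : ℕ} (hn : 0 < n) (x : Fin n → 𝓧) (f : 𝓧 → ℝ) :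
    n * empMean x f = ∑ i, f (x i) := by
  have : (n : ℝ) ≠ 0 := by positivity
  rw [empMean, mul_inv_cancel_left₀ this]

theorem empProc_sub [MeasurableSpace 𝓧] {P : Measure 𝓧} {n : ℕ} (x : Fin n → 𝓧) {f g : 𝓧 → ℝ}
    (hf : Integrable f P) (hg : Integrable g P) :
    empProc P x (fun y => f y - g y) = empProc P x f - empProc P x g := by
  rw [empProc, empMean_sub, integral_sub hf hg, empProc, empProc]
  ring

theorem empProc_const_mul [MeasurableSpace 𝓧] {P : Measure 𝓧} {n : ℕ} (x : Fin n → 𝓧) (c : ℝ)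
    (f : 𝓧 → ℝ) : empProc P x (fun y => c * f y) = c * empProc P x f := by
  rw [empProc, empMean_const_mul, integral_const_mul, empProc]
  ring

end EmpiricalMean

theorem EReal.coe_sum_univ {ι : Type*} [Fintype ι] (f : ι → ℝ) :
    ((∑ i, f i : ℝ) : EReal) = ∑ i, (f i : EReal) :=
  map_sum (⟨⟨Real.toEReal, EReal.coe_zero⟩, EReal.coe_add⟩ : ℝ →+ EReal) f Finset.univ

/-- The Taylor remainder `|s|³/(1 - |s|)` is at most `2 b s²` because `1 - |s| ≥ 1/2`. Keeping it
proportional to `s²` lets a sum of remainders be controlled by the empirical second moment. -/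
theorem abs_two_mul_log_one_add_sub_le {s b : ℝ} (hs : |s| ≤ b) (hb : b ≤ 1 / 2) :
    |2 * Real.log (1 + s) - 2 * s + s ^ 2| ≤ 4 * b * s ^ 2 := by
  have h := Real.abs_log_sub_add_sum_range_le (x := -s) (by rw [abs_neg]; linarith) 2
  rw [Finset.sum_range_succ, Finset.sum_range_one, abs_neg, sub_neg_eq_add] at h
  have h1 : |s| ^ (2 + 1) / (1 - |s|) ≤ 2 * b * s ^ 2 := by
    rw [div_le_iff₀ (by linarith), pow_succ, sq_abs]
    nlinarith [mul_nonneg (sq_nonneg s) (abs_nonneg s), mul_le_mul_of_nonneg_left hs (sq_nonneg s),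
      mul_nonneg (sq_nonneg s) ((abs_nonneg s).trans hs)]
  have e : 2 * Real.log (1 + s) - 2 * s + s ^ 2 =
      2 * ((-s) ^ (0 + 1) / ((0 : ℕ) + 1) + (-s) ^ (1 + 1) / ((1 : ℕ) + 1) + Real.log (1 + s)) := by
    push_cast
    ring
  rw [e, abs_mul, abs_two]
  linarith

namespace LikelihoodModel

variable {Θ 𝓧 : Type*} [MeasurableSpace 𝓧] {lam : Measure 𝓧} (M : LikelihoodModel Θ lam)

/-! ### Expansion of the log-likelihood at a fixed sample -/

theorem log_p_eq {θ : Θ} {x : 𝓧} (h0 : 0 < M.p₀ x) (hS : |M.S θ x| ≤ 1 / 2) :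
    0 < M.p θ x ∧ Real.log (M.p θ x) = Real.log (M.p₀ x) + 2 * Real.log (1 + M.S θ x) := by
  have h0' : (0 : ℝ) < M.p₀ x := by exact_mod_cast h0
  have hSx : M.S θ x = √((M.p θ x : ℝ) / (M.p₀ x : ℝ)) - 1 := by rw [S, if_neg h0.ne']
  have hp : 0 < M.p θ x := by
    refine pos_iff_ne_zero.2 fun h => ?_
    rw [hSx, h] at hS
    norm_num at hS
  have hp' : (0 : ℝ) < M.p θ x := by exact_mod_cast hp
  refine ⟨hp, ?_⟩
  rw [hSx, add_sub_cancel, Real.log_sqrt (by positivity), Real.log_div hp'.ne' h0'.ne']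
  ring

/-- The bound `1/2` keeps `1 + S_θ` away from zero, so all densities at the sample are positive and
the extended-real log-likelihood is a real number. -/
theorem exists_logLik_eq {n : ℕ} (hn : 0 < n) {x : Fin n → 𝓧} (hpos : ∀ i, 0 < M.p₀ (x i))
    {θ : Θ} {b : ℝ} (hb : b ≤ 1 / 2) (hS : ∀ i, |M.S θ (x i)| ≤ b) :
    ∃ L : ℝ, M.logLik n x θ = L ∧
      |L - M.ell n x - 2 * ∑ i, M.S θ (x i) + ∑ i, M.S θ (x i) ^ 2|
        ≤ 4 * b * ∑ i, M.S θ (x i) ^ 2 := by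
  refine ⟨∑ i, Real.log (M.p θ (x i)), ?_, ?_⟩
  · rw [logLik, EReal.coe_sum_univ]
    refine Finset.sum_congr rfl fun i _ => ?_
    exact ENNReal.log_of_nnreal (M.log_p_eq (hpos i) ((hS i).trans hb)).1.ne'
  · rw [ell, natCast_mul_empMean hn, Finset.mul_sum, Finset.mul_sum, ← Finset.sum_sub_distrib,
      ← Finset.sum_sub_distrib, ← Finset.sum_add_distrib]
    refine (Finset.abs_sum_le_sum_abs _ _).trans (Finset.sum_le_sum fun i _ => ?_)
    rw [(M.log_p_eq (hpos i) ((hS i).trans hb)).2, add_sub_cancel_left]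
    exact abs_two_mul_log_one_add_sub_le (hS i) hb

theorem integrable_S (θ : Θ) : Integrable (M.S θ) M.P₀ := (M.memLp_S θ).integrable one_le_two

/-- Centring gives `2n ℙₙS = 2n ℙₙt - n h² + 2√n 𝔾ₙ(S - t)` and `n ℙₙS² = n h² + n(ℙₙ - P₀)S²`. The
quadratic part is thus `-2n h²` where `-2n P₀t²` is wanted, which accounts for the last error term;
the first is the Taylor remainder. -/
theorem abs_logLik_sub_le {n : ℕ} (hn : 0 < n) {x : Fin n → 𝓧} (hpos : ∀ i, 0 < M.p₀ (x i))
    {θ : Θ} {b : ℝ} (hb : b ≤ 1 / 2) (hS : ∀ i, |M.S θ (x i)| ≤ b) (hb0 : 0 ≤ b)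
    (hac : M.law θ ≪ M.P₀) {t : 𝓧 → ℝ} (ht : Integrable t M.P₀) (ht0 : ∫ y, t y ∂M.P₀ = 0)
    (hth : ∫ y, t y ^ 2 ∂M.P₀ ≤ M.h θ ^ 2) :
    EReal.abs (M.logLik n x θ -
      ((M.ell n x - 1 / 2 * (n * ∫ y, (2 * t y) ^ 2 ∂M.P₀)
        + n * empMean x (fun y => 2 * t y) : ℝ) : EReal)) ≤
    ENNReal.ofReal (4 * b * (n * M.h θ ^ 2 +
        n * |empMean x (fun y => M.S θ y ^ 2) - ∫ y, M.S θ y ^ 2 ∂M.P₀|)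
      + 2 * (√n * |empProc M.P₀ x (fun y => M.S θ y - t y)|)
      + n * |empMean x (fun y => M.S θ y ^ 2) - ∫ y, M.S θ y ^ 2 ∂M.P₀|
      + 2 * (n * (M.h θ ^ 2 - ∫ y, t y ^ 2 ∂M.P₀))) := by
  obtain ⟨L, hL, hbound⟩ := M.exists_logLik_eq hn hpos hb hS
  rw [hL, ← EReal.coe_sub, EReal.abs_def]
  refine ENNReal.ofReal_le_ofReal ?_
  have hn0 : (0 : ℝ) < n := by exact_mod_cast hn
  set Q := empMean x (fun y => M.S θ y ^ 2) - ∫ y, M.S θ y ^ 2 ∂M.P₀ with hQ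
  have hsum1 : ∑ i, M.S θ (x i) = n * empMean x (M.S θ) := (natCast_mul_empMean hn x _).symm
  have hsum2 : ∑ i, M.S θ (x i) ^ 2 = n * Q + n * M.h θ ^ 2 := by
    rw [hQ, M.integral_S_sq hac, ← natCast_mul_empMean hn x (fun y => M.S θ y ^ 2)]
    ring
  have hG : √n * empProc M.P₀ x (fun y => M.S θ y - t y)
      = n * (empMean x (M.S θ) - empMean x t + M.h θ ^ 2 / 2) := by
    rw [empProc, empMean_sub, integral_sub (M.integrable_S θ) ht, ht0, M.integral_S, ← mul_assoc,
      Real.mul_self_sqrt hn0.le]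
    ring
  have hsq : ∫ y, (2 * t y) ^ 2 ∂M.P₀ = 4 * ∫ y, t y ^ 2 ∂M.P₀ := by
    rw [← integral_const_mul]
    congr 1
    funext y
    ring
  rw [hsq, empMean_const_mul]
  rw [hsum1, hsum2] at hbound
  set G := empProc M.P₀ x (fun y => M.S θ y - t y)
  have habs : √(n : ℝ) * |G| = |√n * G| := by
    rw [abs_mul, abs_of_nonneg (Real.sqrt_nonneg _)]
  have hnQ : (n : ℝ) * |Q| = |n * Q| := by rw [abs_mul, abs_of_pos hn0]
  rw [habs, hnQ]
  have h4b : 4 * b * (n * Q + n * M.h θ ^ 2) ≤ 4 * b * (n * M.h θ ^ 2 + |n * Q|) := by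
    have := le_abs_self (n * Q)
    exact mul_le_mul_of_nonneg_left (by linarith) (by positivity)
  have hb1 := abs_le.1 hbound
  have hg1 := neg_abs_le (√n * G)
  have hg2 := le_abs_self (√n * G)
  have hq1 := neg_abs_le (n * Q)
  have hq2 := le_abs_self (n * Q)
  have h5 : 0 ≤ n * (M.h θ ^ 2 - ∫ y, t y ^ 2 ∂M.P₀) := mul_nonneg hn0.le (by linarith)
  rw [abs_le]
  constructor <;> nlinarith

/-! ### Uniform expansion over shrinking neighbourhoods -/

/-- Stochastic bounds on the scores over `{θ : h(p_θ, p₀) ≤ rₙ/√n}` that suffice for the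
quadratic expansion of the log-likelihood. -/
structure LocalScoreBounds {Ω : Type*} [MeasurableSpace Ω] (Pr : Measure Ω) (X : ℕ → Ω → 𝓧)
    (r : ℕ → ℝ) (t : Θ → 𝓧 → ℝ) : Prop where
  dqm : M.IsRateDQM r
  envelope : ∃ ε : ℝ, 0 < ε ∧ ∃ D : 𝓧 → ℝ, (∀ f ∈ M.scores ε, ∀ x, |f x| ≤ D x) ∧
    IsLittleOP Pr (fun n ω => ⨆ i : Fin n, ENNReal.ofReal (D (sample X n ω i)))
      (fun n => √(n : ℝ) / r n ^ 3)
  empirical : IsLittleOP Pr (fun n ω => ⨆ θ ∈ M.nbhd r n,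
      ENNReal.ofReal |empProc M.P₀ (sample X n ω) (fun y => M.S θ y - t θ y)|)
    (fun n => 1 / √(n : ℝ))
  squares : IsLittleOP Pr (fun n ω => ⨆ θ ∈ M.nbhd r n,
      ENNReal.ofReal |empMean (sample X n ω) (fun y => M.S θ y ^ 2) - ∫ y, M.S θ y ^ 2 ∂M.P₀|)
    (fun n => 1 / (n : ℝ))

variable {M} in
theorem ScoreConditions.localScoreBounds {Ω : Type*} [MeasurableSpace Ω] {Pr : Measure Ω}
    {X : ℕ → Ω → 𝓧} {r : ℕ → ℝ} {t : Θ → 𝓧 → ℝ} (h : M.ScoreConditions Pr X r t) :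
    M.LocalScoreBounds Pr X r t where
  dqm := h.dqm
  envelope := by
    obtain ⟨ε, hε, v, _, _, D, _, hD, hmax⟩ := h.envelope
    exact ⟨ε, hε, D, fun f hf => hD f (Or.inl hf), hmax⟩
  empirical := h.empirical
  squares := h.squares

theorem abs_S_le {ε : ℝ} {D : 𝓧 → ℝ} (hD : ∀ f ∈ M.scores ε, ∀ x, |f x| ≤ D x)
    (hid : ∀ θ, M.p θ =ᵐ[lam] M.p₀ → M.p θ = M.p₀) {θ : Θ} (hθ : M.h θ ≤ ε) {x : 𝓧}
    {B : ℝ} (hB : D x ≤ B) : |M.S θ x| ≤ M.h θ * B := by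
  rcases (M.h_nonneg θ).eq_or_lt with h0 | h0
  · rw [M.S_eq_zero_of_h_eq_zero hid h0.symm, ← h0]
    simp
  · have := (hD _ ⟨θ, h0, hθ, rfl⟩ x).trans hB
    rw [abs_div, abs_of_pos h0, div_le_iff₀ h0] at this
    linarith

theorem tendsto_div_sqrt_of_isLittleO {r : ℕ → ℝ}
    (hr : r =o[atTop] (fun n => (n : ℝ) ^ (1 / 2 : ℝ))) :
    Tendsto (fun n => r n / √(n : ℝ)) atTop (𝓝 0) := by
  simpa only [Real.sqrt_eq_rpow] using hr.tendsto_div_nhds_zero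

variable {M} in
theorem LocalScoreBounds.isLittleOP_logLik {Ω : Type*} [MeasurableSpace Ω] {Pr : Measure Ω}
    {X : ℕ → Ω → 𝓧} (hX : ∀ i, Measurable (X i)) (hlaw : ∀ i, Pr.map (X i) = M.P₀)
    (hid : ∀ θ, M.p θ =ᵐ[lam] M.p₀ → M.p θ = M.p₀)
    (hclosed : IsClosed M.tangentCone) (hconvex : Convex ℝ M.tangentCone)
    {r : ℕ → ℝ} (hr0 : ∀ n, 0 < r n) (hrt : Tendsto r atTop atTop)
    (hro : r =o[atTop] (fun n => (n : ℝ) ^ (1 / 2 : ℝ)))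
    {t : Θ → 𝓧 → ℝ} (ht : ∀ θ, t θ =ᵐ[M.P₀] M.projS θ)
    (hb : M.LocalScoreBounds Pr X r t) :
    IsLittleOP Pr (fun n ω => ⨆ θ ∈ M.nbhd r n,
      EReal.abs (M.logLik n (sample X n ω) θ -
        ((M.ell n (sample X n ω) - 1 / 2 * (n * ∫ x, (2 * t θ x) ^ 2 ∂M.P₀)
          + n * empMean (sample X n ω) (fun x => 2 * t θ x) : ℝ) : EReal)))
      (fun _ => 1) := by
  obtain ⟨hac, g, R, hg, hR⟩ := hb.dqm
  obtain ⟨ε₀, hε₀, D, hD, hmax⟩ := hb.envelope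
  have hne := hg.tangentCone_nonempty
  intro ε hε
  -- The errors below add up to at most `4η(1 + η) + 2η + η + 2η²`, which is less than `13η` when `η
  -- ≤ 1/2`.
  obtain ⟨η, hη0, hη1, hηε⟩ : ∃ η : ℝ, 0 < η ∧ η ≤ 1 / 2 ∧ 13 * η ≤ ε :=
    ⟨min (1 / 2) (ε / 13), by positivity, min_le_left _ _, by
      have := min_le_right (1 / 2 : ℝ) (ε / 13)
      linarith⟩
  have hnull : ∀ᵐ ω ∂Pr, ∀ i, 0 < M.p₀ (X i ω) := by
    rw [ae_all_iff]
    intro i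
    have := M.ae_p₀_pos
    rw [← hlaw i] at this
    exact ae_of_ae_map (hX i).aemeasurable this
  have hlim := ((hmax η hη0).add (hb.empirical η hη0)).add (hb.squares η hη0)
  simp only [add_zero] at hlim
  refine tendsto_of_tendsto_of_tendsto_of_le_of_le' tendsto_const_nhds hlim
    (Eventually.of_forall fun _ => zero_le) ?_
  have hRη := hR.eventually (ge_mem_nhds (ENNReal.ofReal_pos.2 hη0))
  filter_upwards [hRη, hrt.eventually_ge_atTop 1, eventually_gt_atTop 0,
    (tendsto_div_sqrt_of_isLittleO hro).eventually (ge_mem_nhds hε₀)] with n hRn hr1 hn hrε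
  have hn0 : (0 : ℝ) < n := by exact_mod_cast hn
  have hsn : 0 < √(n : ℝ) := Real.sqrt_pos.2 hn0
  have hrn := hr0 n
  -- The added zero becomes the measure of the null event that `p₀` vanishes at some observation, so
  -- that the bad event can be covered by four sets.
  rw [← zero_add (Pr _ + _ + _), ← ae_iff.1 hnull]
  refine (measure_mono ?_).trans ((measure_union_le _ _).trans
    (add_le_add le_rfl ((measure_union_le _ _).trans (add_le_add (measure_union_le _ _) le_rfl))))
  intro ω hω
  by_contra hcon
  simp only [Set.mem_union, Set.mem_ofPred_eq, not_or, not_lt, not_not] at hcon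
  obtain ⟨hpos, ⟨hmaxω, hempω⟩, hsqω⟩ := hcon
  rw [Set.mem_ofPred_eq] at hω
  refine absurd hω (not_lt.2 (iSup₂_le fun θ hθ => ?_))
  rw [mul_one]
  have hθr : M.h θ ≤ r n / √n := hθ
  have hDi : ∀ i : Fin n, D (sample X n ω i) ≤ η * (√n / r n ^ 3) := fun i =>
    (ENNReal.ofReal_le_ofReal_iff (by positivity)).1 ((le_iSup _ i).trans hmaxω)
  have hemp : |empProc M.P₀ (sample X n ω) (fun y => M.S θ y - t θ y)| ≤ η * (1 / √n) :=
    (ENNReal.ofReal_le_ofReal_iff (by positivity)).1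
      ((le_iSup₂ (f := fun θ (_ : θ ∈ M.nbhd r n) =>
        ENNReal.ofReal |empProc M.P₀ (sample X n ω) (fun y => M.S θ y - t θ y)|) θ hθ).trans hempω)
  have hsq : |empMean (sample X n ω) (fun y => M.S θ y ^ 2) - ∫ y, M.S θ y ^ 2 ∂M.P₀|
      ≤ η * (1 / n) :=
    (ENNReal.ofReal_le_ofReal_iff (by positivity)).1
      ((le_iSup₂ (f := fun θ (_ : θ ∈ M.nbhd r n) => ENNReal.ofReal
        |empMean (sample X n ω) (fun y => M.S θ y ^ 2) - ∫ y, M.S θ y ^ 2 ∂M.P₀|) θ hθ).trans hsqω)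
  have hRθ : r n * ‖R θ‖ ≤ η := by
    have h1 := (le_iSup₂ (f := fun θ (_ : θ ∈ M.nbhd r n) =>
      ENNReal.ofReal (r n) * ‖R θ‖ₑ) θ hθ).trans hRn
    rw [← ofReal_norm, ← ENNReal.ofReal_mul hrn.le] at h1
    exact (ENNReal.ofReal_le_ofReal_iff hη0.le).1 h1
  -- The cube in the envelope rate is used here: one power is spent on `h ≤ rₙ/√n`, and the other
  -- two will cancel the size `rₙ²` of the sum of squares.
  have hSb : ∀ i : Fin n, |M.S θ (sample X n ω i)| ≤ η / r n ^ 2 := fun i => by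
    refine (M.abs_S_le hD hid (hθr.trans hrε) (hDi i)).trans ?_
    calc M.h θ * (η * (√n / r n ^ 3)) ≤ r n / √n * (η * (√n / r n ^ 3)) := by gcongr
      _ = η / r n ^ 2 := by field_simp
  have hr2 : 1 ≤ r n ^ 2 := one_le_pow₀ hr1
  have hηr : η / r n ^ 2 ≤ η := div_le_self hη0.le hr2
  have htint : Integrable (t θ) M.P₀ :=
    ((Lp.memLp (M.projS θ)).integrable one_le_two).congr (ht θ).symm
  have hproj := isMetricProj_metricProj hne hclosed hconvex (M.SLp θ)
  have ht0 : ∫ y, t θ y ∂M.P₀ = 0 := by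
    rw [integral_congr_ae (ht θ)]
    exact M.integral_tangentCone hproj.1
  have ht2 : ∫ y, t θ y ^ 2 ∂M.P₀ = ‖M.projS θ‖ ^ 2 := by
    rw [norm_sq_Lp_two]
    exact integral_congr_ae ((ht θ).mono fun y hy => by simp only [hy])
  have hpyth := M.norm_projS_sq hne hclosed hconvex (hac θ)
  have hgap := hg.norm_SLp_sub_projS_le hclosed hconvex θ
  refine (M.abs_logLik_sub_le (x := sample X n ω) hn (fun i => hpos i) (hηr.trans hη1) hSb (by positivity) (hac θ)
    htint ht0 (by rw [ht2]; nlinarith [sq_nonneg ‖M.SLp θ - M.projS θ‖])).trans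
    (ENNReal.ofReal_le_ofReal ?_)
  have hh := M.h_nonneg θ
  have hnh : n * M.h θ ^ 2 ≤ r n ^ 2 := by
    calc n * M.h θ ^ 2 ≤ n * (r n / √n) ^ 2 := by gcongr
      _ = r n ^ 2 := by
        rw [div_pow, Real.sq_sqrt hn0.le]
        field_simp
  have hA : n * |empMean (sample X n ω) (fun y => M.S θ y ^ 2) - ∫ y, M.S θ y ^ 2 ∂M.P₀| ≤ η := by
    calc _ ≤ n * (η * (1 / n)) := by gcongr
      _ = η := by field_simp
  have hB : √n * |empProc M.P₀ (sample X n ω) (fun y => M.S θ y - t θ y)| ≤ η := by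
    calc _ ≤ √n * (η * (1 / √n)) := by gcongr
      _ = η := by field_simp
  have hC : n * (M.h θ ^ 2 - ∫ y, t θ y ^ 2 ∂M.P₀) ≤ η ^ 2 := by
    rw [ht2, hpyth, add_sub_cancel_left]
    calc n * ‖M.SLp θ - M.projS θ‖ ^ 2 ≤ n * (M.h θ * ‖R θ‖) ^ 2 := by gcongr
      _ = (n * M.h θ ^ 2) * ‖R θ‖ ^ 2 := by ring
      _ ≤ r n ^ 2 * ‖R θ‖ ^ 2 := by gcongr
      _ = (r n * ‖R θ‖) ^ 2 := by ring
      _ ≤ η ^ 2 := by gcongr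
  have hE : 4 * (η / r n ^ 2) * (n * M.h θ ^ 2 +
      n * |empMean (sample X n ω) (fun y => M.S θ y ^ 2) - ∫ y, M.S θ y ^ 2 ∂M.P₀|)
      ≤ 4 * η * (1 + η) := by
    calc _ ≤ 4 * (η / r n ^ 2) * (r n ^ 2 + r n ^ 2 * η) := by
          exact mul_le_mul_of_nonneg_left
            (add_le_add hnh (hA.trans (le_mul_of_one_le_left hη0.le hr2))) (by positivity)
      _ = 4 * η * (1 + η) := by field_simp
  have hη2 : η ^ 2 ≤ η * (1 / 2) := by
    rw [sq]
    gcongr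
  have hη3 : 4 * η * (1 + η) = 4 * η + 4 * η ^ 2 := by ring
  linarith

end LikelihoodModel

/-! ### The central limit theorem for finitely many functions -/

section CLT

variable {𝓧 Ω : Type*} [MeasurableSpace 𝓧] [MeasurableSpace Ω]

theorem sqrt_mul_inv_self (n : ℕ) : √(n : ℝ) * (n : ℝ)⁻¹ = (√(n : ℝ))⁻¹ := by
  rcases n.eq_zero_or_pos with rfl | hn
  · simp
  · have hn' : (0 : ℝ) < n := by exact_mod_cast hn
    have h : √(n : ℝ) ≠ 0 := (Real.sqrt_pos.2 hn').ne'
    rw [← div_eq_mul_inv, Real.sqrt_div_self', one_div]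

theorem empProc_of_integral_eq_zero {P : Measure 𝓧} {n : ℕ} (x : Fin n → 𝓧) {f : 𝓧 → ℝ}
    (hf : ∫ y, f y ∂P = 0) : empProc P x f = (√(n : ℝ))⁻¹ * ∑ i, f (x i) := by
  rw [empProc, hf, sub_zero, empMean, ← mul_assoc, sqrt_mul_inv_self]

theorem measurable_sample {X : ℕ → Ω → 𝓧} (hX : ∀ i, Measurable (X i)) (n : ℕ) :
    Measurable (sample X n) := measurable_pi_lambda _ fun i => hX i

theorem measurable_empMean {n : ℕ} {f : 𝓧 → ℝ} (hf : Measurable f) :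
    Measurable fun x : Fin n → 𝓧 => empMean x f := by
  unfold empMean
  exact (Finset.measurable_sum _ fun i _ => hf.comp (measurable_pi_apply i)).const_mul _

theorem measurable_empProc {P : Measure 𝓧} {n : ℕ} {f : 𝓧 → ℝ} (hf : Measurable f) :
    Measurable fun x : Fin n → 𝓧 => empProc P x f :=
  ((measurable_empMean hf).sub_const _).const_mul _

theorem identDistrib_comp {Pr : Measure Ω} {P : Measure 𝓧} {X : ℕ → Ω → 𝓧}
    (hX : ∀ i, Measurable (X i)) (hlaw : ∀ i, Pr.map (X i) = P) {f : 𝓧 → ℝ} (hf : Measurable f)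
    (i j : ℕ) : IdentDistrib (fun ω => f (X i ω)) (fun ω => f (X j ω)) Pr Pr :=
  IdentDistrib.comp (u := f)
    ⟨(hX i).aemeasurable, (hX j).aemeasurable, by rw [hlaw i, hlaw j]⟩ hf

/-- The scalar central limit theorem read at frequency `1` only; other frequencies are absorbed into
`f`. -/
theorem tendsto_charFun_empProc {Pr : Measure Ω} [IsProbabilityMeasure Pr] {P : Measure 𝓧}
    {X : ℕ → Ω → 𝓧} (hX : ∀ i, Measurable (X i)) (hlaw : ∀ i, Pr.map (X i) = P)
    (hindep : iIndepFun X Pr) {f : 𝓧 → ℝ} (hf : Measurable f) (hf2 : MemLp f 2 P)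
    (hf0 : ∫ y, f y ∂P = 0) :
    Tendsto (fun n => ∫ ω, Complex.exp (empProc P (sample X n ω) f * Complex.I) ∂Pr) atTop
      (𝓝 (Complex.exp (-((∫ y, f y ^ 2 ∂P : ℝ) : ℂ) / 2))) := by
  have hmap : ∀ i, MemLp (fun ω => f (X i ω)) 2 Pr := fun i => by
    rw [← hlaw i] at hf2
    exact hf2.comp_measurePreserving ((hX i).measurePreserving Pr)
  have hmean : ∫ ω, f (X 0 ω) ∂Pr = 0 := by
    rw [← hf0, ← hlaw 0, integral_map (hX 0).aemeasurable hf.aestronglyMeasurable]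
  have hvar : Var[fun ω => f (X 0 ω); Pr] = ∫ y, f y ^ 2 ∂P := by
    rw [variance_of_integral_eq_zero (X := fun ω => f (X 0 ω)) (hf.comp (hX 0)).aemeasurable hmean, ← hlaw 0,
      integral_map (hX 0).aemeasurable (hf.pow_const 2).aestronglyMeasurable]
  set v : ℝ≥0 := Var[fun ω => f (X 0 ω); Pr].toNNReal with hv
  have hclt := tendstoInDistribution_inv_sqrt_mul_sum_sub (Y := id) (P' := gaussianReal 0 v)
    (X := fun i ω => f (X i ω)) ⟨aemeasurable_id, by rw [Measure.map_id]⟩ (hmap 0)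
    (hindep.comp (fun _ => f) fun _ => hf) fun i => identDistrib_comp hX hlaw hf i 0
  have h := ProbabilityMeasure.tendsto_iff_tendsto_charFun.1 hclt.tendsto 1
  have hlim : charFun ((gaussianReal 0 v).map id) 1
      = Complex.exp (-((∫ y, f y ^ 2 ∂P : ℝ) : ℂ) / 2) := by
    rw [Measure.map_id, charFun_gaussianReal, hv, Real.coe_toNNReal _ (variance_nonneg _ _), hvar]
    congr 1
    push_cast
    ring
  simp only [ProbabilityMeasure.coe_mk] at h
  rw [hlim] at h
  refine h.congr fun n => ?_
  have hmeas : Measurable fun ω => (√(n : ℝ))⁻¹ *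
      (∑ k ∈ Finset.range n, f (X k ω) - n * ∫ ω, f (X 0 ω) ∂Pr) :=
    ((Finset.measurable_sum _ fun k _ => hf.comp (hX k)).sub_const _).const_mul _
  rw [charFun_apply, integral_map hmeas.aemeasurable (by fun_prop)]
  refine integral_congr_ae (Eventually.of_forall fun ω => ?_)
  simp only
  rw [empProc_of_integral_eq_zero _ hf0, hmean, mul_zero, sub_zero, Finset.sum_range]
  simp [sample]

/-- Cramér–Wold: the characteristic function at `t` is that of the scalar process at `∑ tⱼ φⱼ`,
whose variance is `‖t‖²` by orthonormality. -/
theorem tendstoInDistribution_empProc {Pr : Measure Ω} [IsProbabilityMeasure Pr] {P : Measure 𝓧}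
    {X : ℕ → Ω → 𝓧} (hX : ∀ i, Measurable (X i)) (hlaw : ∀ i, Pr.map (X i) = P)
    (hindep : iIndepFun X Pr) {d : ℕ} {φ : Fin d → 𝓧 → ℝ} (hφ : ∀ j, Measurable (φ j))
    (hφ2 : ∀ j, MemLp (φ j) 2 P) (hφ0 : ∀ j, ∫ y, φ j y ∂P = 0)
    (horth : ∀ i j, ∫ y, φ i y * φ j y ∂P = if i = j then 1 else 0) :
    TendstoInDistribution
      (fun n ω => (WithLp.toLp 2 fun j => empProc P (sample X n ω) (φ j) :
        EuclideanSpace ℝ (Fin d))) atTop id (fun _ => Pr) (multivariateGaussian 0 1) := by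
  have hmeas : ∀ n, Measurable fun ω =>
      (WithLp.toLp 2 fun j => empProc P (sample X n ω) (φ j) : EuclideanSpace ℝ (Fin d)) := by
    intro n
    refine (WithLp.measurable_toLp 2 _).comp (measurable_pi_lambda _ fun j => ?_)
    exact (measurable_empProc (hφ j)).comp (measurable_sample hX n)
  refine ⟨fun n => (hmeas n).aemeasurable, aemeasurable_id, ?_⟩
  refine ProbabilityMeasure.tendsto_iff_tendsto_charFun.2 fun t => ?_
  have hf : Measurable fun y => ∑ j, t j * φ j y :=
    Finset.measurable_sum _ fun j _ => (hφ j).const_mul _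
  have hf2 : MemLp (fun y => ∑ j, t j * φ j y) 2 P :=
    memLp_finsetSum _ fun j _ => (hφ2 j).const_mul (t j)
  have hP : IsProbabilityMeasure P := by
    rw [← hlaw 0]
    exact Measure.isProbabilityMeasure_map (hX 0).aemeasurable
  have hf0 : ∫ y, ∑ j, t j * φ j y ∂P = 0 := by
    rw [integral_finsetSum _ fun j _ => ((hφ2 j).integrable one_le_two).const_mul _]
    simp [integral_const_mul, hφ0]
  have hfsq : ∫ y, (∑ j, t j * φ j y) ^ 2 ∂P = ∑ j, t j * t j := by
    have e : ∀ y, (∑ j, t j * φ j y) ^ 2 = ∑ i, ∑ j, (t i * t j) * (φ i y * φ j y) := by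
      intro y
      rw [sq, Finset.sum_mul_sum]
      refine Finset.sum_congr rfl fun i _ => Finset.sum_congr rfl fun j _ => by ring
    have hint : ∀ i j, Integrable (fun y => (t i * t j) * (φ i y * φ j y)) P := fun i j =>
      ((hφ2 i).integrable_mul (hφ2 j)).const_mul _
    simp only [e]
    rw [integral_finsetSum _ fun i _ => integrable_finsetSum _ fun j _ => hint i j]
    refine Finset.sum_congr rfl fun i _ => ?_
    rw [integral_finsetSum _ fun j _ => hint i j]
    simp [integral_const_mul, horth]
  have h := tendsto_charFun_empProc hX hlaw hindep hf hf2 hf0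
  simp only [ProbabilityMeasure.coe_mk, Measure.map_id,
    charFun_multivariateGaussian Matrix.PosSemidef.one, inner_zero_right, Matrix.one_mulVec]
  rw [hfsq] at h
  convert h using 2 with n
  · rw [charFun_apply, integral_map (hmeas n).aemeasurable (by fun_prop)]
    refine integral_congr_ae (Eventually.of_forall fun ω => ?_)
    simp only
    rw [empProc_of_integral_eq_zero _ hf0, PiLp.inner_apply]
    simp only [empProc_of_integral_eq_zero _ (hφ0 _), RCLike.inner_apply, conj_trivial]
    congr 3
    rw [Finset.sum_comm, Finset.mul_sum]
    refine Finset.sum_congr rfl fun j _ => ?_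
    rw [Finset.mul_sum, Finset.mul_sum, Finset.mul_sum]
    refine Finset.sum_congr rfl fun i _ => by ring
  · simp [dotProduct, neg_div]

end CLT

namespace LikelihoodModel

variable {Θ 𝓧 : Type*} [MeasurableSpace 𝓧] {lam : Measure 𝓧} (M : LikelihoodModel Θ lam)

/-! ### Coordinates of the tangents -/

section FiniteDimensional

variable {d : ℕ} (ψ : OrthonormalBasis (Fin d) ℝ (Submodule.span ℝ M.tangentCone))

theorem measurable_psiFun (j : Fin d) : Measurable (M.psiFun ψ j) :=
  (Lp.stronglyMeasurable _).measurable

theorem memLp_psiFun (j : Fin d) : MemLp (M.psiFun ψ j) 2 M.P₀ := Lp.memLp _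

theorem integral_psiFun (j : Fin d) : ∫ x, M.psiFun ψ j x ∂M.P₀ = 0 :=
  M.integral_span_tangentCone (ψ j).2

theorem integral_psiFun_mul (i j : Fin d) :
    ∫ x, M.psiFun ψ i x * M.psiFun ψ j x ∂M.P₀ = if i = j then 1 else 0 := by
  rw [← orthonormal_iff_ite.1 ψ.orthonormal i j, Submodule.coe_inner, L2.inner_def]
  refine integral_congr_ae (Eventually.of_forall fun x => ?_)
  simp [psiFun, mul_comm]

theorem metricProj_two_smul (hne : M.tangentCone.Nonempty) (hclosed : IsClosed M.tangentCone)
    (hconvex : Convex ℝ M.tangentCone) (θ : Θ) :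
    metricProj M.tangentCone ((2 : ℝ) • M.SLp θ) = (2 : ℝ) • M.projS θ :=
  (isMetricProj_metricProj hne hclosed hconvex _).unique hconvex
    ((isMetricProj_metricProj hne hclosed hconvex (M.SLp θ)).smul
      (fun _ hc _ hs => M.smul_mem_tangentCone hc hs) two_pos)

theorem sum_gamma_smul (hne : M.tangentCone.Nonempty) (hclosed : IsClosed M.tangentCone)
    (hconvex : Convex ℝ M.tangentCone) (θ : Θ) :
    ∑ j, M.gamma ψ θ j • (ψ j : Lp ℝ 2 M.P₀)
      = metricProj M.tangentCone ((2 : ℝ) • M.SLp θ) := by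
  have hmem := (isMetricProj_metricProj hne hclosed hconvex ((2 : ℝ) • M.SLp θ)).1
  have h := ψ.sum_repr' ⟨_, Submodule.subset_span hmem⟩
  have h2 := congrArg (Subtype.val) h
  rw [AddSubmonoidClass.coe_finsetSum] at h2
  exact h2

theorem norm_gamma (hne : M.tangentCone.Nonempty) (hclosed : IsClosed M.tangentCone)
    (hconvex : Convex ℝ M.tangentCone) (θ : Θ) : ‖M.gamma ψ θ‖ = 2 * ‖M.projS θ‖ := by
  have hmem := (isMetricProj_metricProj hne hclosed hconvex ((2 : ℝ) • M.SLp θ)).1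
  have h : M.gamma ψ θ = ψ.repr ⟨_, Submodule.subset_span hmem⟩ := by
    ext j
    rw [ψ.repr_apply_apply]
    rfl
  rw [h, LinearIsometryEquiv.norm_map]
  change ‖metricProj M.tangentCone ((2 : ℝ) • M.SLp θ)‖ = _
  rw [M.metricProj_two_smul hne hclosed hconvex, norm_smul]
  simp

theorem half_sum_gamma_ae_eq (hne : M.tangentCone.Nonempty) (hclosed : IsClosed M.tangentCone)
    (hconvex : Convex ℝ M.tangentCone) (θ : Θ) :
    (fun x => 1 / 2 * ∑ j, M.gamma ψ θ j * M.psiFun ψ j x) =ᵐ[M.P₀] M.projS θ := by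
  have h : M.projS θ = (1 / 2 : ℝ) • ∑ j, M.gamma ψ θ j • (ψ j : Lp ℝ 2 M.P₀) := by
    rw [M.sum_gamma_smul ψ hne hclosed hconvex, M.metricProj_two_smul hne hclosed hconvex,
      smul_smul]
    norm_num
  rw [h]
  have h1 := Lp.coeFn_smul (1 / 2 : ℝ) (∑ j, M.gamma ψ θ j • (ψ j : Lp ℝ 2 M.P₀))
  have h2 := Lp.coeFn_finsetSum Finset.univ fun j => M.gamma ψ θ j • (ψ j : Lp ℝ 2 M.P₀)
  have h3 : ∀ᵐ x ∂M.P₀, ∀ j, (M.gamma ψ θ j • (ψ j : Lp ℝ 2 M.P₀)) x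
      = M.gamma ψ θ j * M.psiFun ψ j x := by
    rw [ae_all_iff]
    intro j
    filter_upwards [Lp.coeFn_smul (M.gamma ψ θ j) (ψ j : Lp ℝ 2 M.P₀)] with x hx
    rw [hx]
    rfl
  filter_upwards [h1, h2, h3] with x e1 e2 e3
  rw [e1, Pi.smul_apply, e2]
  simp [e3]

theorem two_mul_empMean_half_sum_gamma {n : ℕ} (x : Fin n → 𝓧) (θ : Θ) :
    n * empMean x (fun y => 2 * (1 / 2 * ∑ j, M.gamma ψ θ j * M.psiFun ψ j y))
      = √n * inner ℝ (M.V ψ n x) (M.gamma ψ θ) := by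
  rcases n.eq_zero_or_pos with rfl | hn
  · simp
  have hn0 : (0 : ℝ) < n := by exact_mod_cast hn
  rw [natCast_mul_empMean hn, PiLp.inner_apply, Finset.mul_sum]
  simp only [RCLike.inner_apply, conj_trivial, V, empProc_of_integral_eq_zero _
    (M.integral_psiFun ψ _)]
  have e : ∀ j, √(n : ℝ) * (M.gamma ψ θ j * ((√(n : ℝ))⁻¹ * ∑ i, M.psiFun ψ j (x i)))
      = ∑ i, M.gamma ψ θ j * M.psiFun ψ j (x i) := by
    intro j
    rw [← Finset.mul_sum]
    have : √(n : ℝ) ≠ 0 := (Real.sqrt_pos.2 hn0).ne'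
    field_simp
  simp only [e]
  rw [Finset.sum_comm]
  refine Finset.sum_congr rfl fun i _ => by ring

theorem sqrt_smul_gammaHat (n : ℕ) (x : Fin n → 𝓧) :
    √(n : ℝ) • M.gammaHat ψ n x = M.V ψ n x := by
  rcases n.eq_zero_or_pos with rfl | hn
  · ext j
    simp [V, empProc]
  · have hn0 : (0 : ℝ) < n := by exact_mod_cast hn
    rw [gammaHat, smul_smul, mul_inv_cancel₀ (Real.sqrt_pos.2 hn0).ne', one_smul]

variable {M} in
/-- The quadratic expansion follows from the stochastic bounds on the scores. -/
theorem LocalScoreBounds.quadraticExpansion {Ω : Type*} [MeasurableSpace Ω] {Pr : Measure Ω}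
    [IsProbabilityMeasure Pr]
    {X : ℕ → Ω → 𝓧} (hX : ∀ i, Measurable (X i)) (hlaw : ∀ i, Pr.map (X i) = M.P₀)
    (hid : ∀ θ, M.p θ =ᵐ[lam] M.p₀ → M.p θ = M.p₀)
    (hclosed : IsClosed M.tangentCone) (hconvex : Convex ℝ M.tangentCone)
    (hindep : iIndepFun X Pr)
    {r : ℕ → ℝ} (hr0 : ∀ n, 0 < r n) (hrt : Tendsto r atTop atTop)
    (hro : r =o[atTop] (fun n => (n : ℝ) ^ (1 / 2 : ℝ)))
    (hb : M.LocalScoreBounds Pr X r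
      (fun θ x => 1 / 2 * ∑ j, M.gamma ψ θ j * M.psiFun ψ j x)) :
    M.QuadraticExpansion ψ Pr X r := by
  obtain ⟨hac, g, R, hg, hR⟩ := hb.dqm
  have hne := hg.tangentCone_nonempty
  have hnorm : ∀ θ, ‖M.gamma ψ θ‖ ≤ 2 * M.h θ := fun θ => by
    rw [M.norm_gamma ψ hne hclosed hconvex]
    have h1 := M.norm_projS_sq hne hclosed hconvex (hac θ)
    have := abs_le_of_sq_le_sq' (a := ‖M.projS θ‖) (b := M.h θ)
      (by nlinarith [sq_nonneg ‖M.SLp θ - M.projS θ‖]) (M.h_nonneg θ)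
    linarith [this.2]
  refine ⟨fun θ => ?_, ?_, ?_⟩
  · rw [M.sum_gamma_smul ψ hne hclosed hconvex]
    exact isMetricProj_metricProj hne hclosed hconvex _
  -- A single `n` with `rₙ ≥ 1` and `rₙ ‖R‖ < 1` on its neighbourhood gives the radius. If `γ(θ) =
  -- 0` the projection vanishes, so `h = ‖S - 𝕋S‖ ≤ h ‖R‖` with `‖R‖ < 1`, which forces `h = 0`.
  · obtain ⟨n, hn1, hRn, hn0⟩ := ((hrt.eventually_ge_atTop 1).and
      ((hR.eventually (gt_mem_nhds one_pos)).and (eventually_gt_atTop 0))).exists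
    have hn0' : (0 : ℝ) < n := by exact_mod_cast hn0
    refine ⟨r n / √n, div_pos (hr0 n) (Real.sqrt_pos.2 hn0'), fun θ hθ => ⟨fun h0 => ?_, fun h0 => ?_⟩⟩
    · have h1 := (le_iSup₂ (f := fun θ (_ : θ ∈ M.nbhd r n) =>
        ENNReal.ofReal (r n) * ‖R θ‖ₑ) θ hθ).trans_lt hRn
      rw [← ofReal_norm, ← ENNReal.ofReal_mul (hr0 n).le, ← ENNReal.ofReal_one,
        ENNReal.ofReal_lt_ofReal_iff one_pos] at h1
      have h2 : ‖R θ‖ < 1 := by nlinarith [norm_nonneg (R θ)]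
      have h3 := M.norm_gamma ψ hne hclosed hconvex θ
      rw [h0, norm_zero] at h3
      have h4 := M.norm_projS_sq hne hclosed hconvex (hac θ)
      have h5 : ‖M.projS θ‖ = 0 := by linarith
      rw [h5, zero_pow two_ne_zero, zero_add] at h4
      have h6 := (pow_left_inj₀ (M.h_nonneg θ) (norm_nonneg _) two_ne_zero).1 h4
      have h7 := hg.norm_SLp_sub_projS_le hclosed hconvex θ
      rw [← h6] at h7
      nlinarith [M.h_nonneg θ]
    · have h1 := hnorm θ
      rw [h0, mul_zero] at h1
      exact norm_le_zero_iff.1 h1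
  · refine ⟨fun n => ?_, fun n => ?_, ?_, ?_, fun n x => ?_, ?_⟩
    · exact (measurable_empMean (Real.measurable_log.comp
        (M.measurable_p M.θ₀).coe_nnreal_real)).const_mul _
    · have hV : Measurable (M.V ψ n) := (WithLp.measurable_toLp 2 _).comp
        (measurable_pi_lambda _ fun j => measurable_empProc (M.measurable_psiFun ψ j))
      exact hV.const_smul (√(n : ℝ))⁻¹
    · have h := hb.isLittleOP_logLik hX hlaw hid hclosed hconvex hr0 hrt hro
        (fun θ => M.half_sum_gamma_ae_eq ψ hne hclosed hconvex θ)
      convert h using 8 with n ω θ hθ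
      -- Completing the square: `½‖V‖² - ½‖V - √n γ‖² = √n ⟨V, γ⟩ - ½ n ‖γ‖²`, where `‖γ‖²` is the
      -- second moment of `γ'ψ`.
      rw [M.two_mul_empMean_half_sum_gamma ψ, M.sqrt_smul_gammaHat ψ]
      rw [smul_sub, M.sqrt_smul_gammaHat ψ, norm_sub_sq_real, inner_smul_right, norm_smul, mul_pow,
        Real.norm_eq_abs, sq_abs, Real.sq_sqrt (Nat.cast_nonneg n)]
      have e : ∫ x, (2 * (1 / 2 * ∑ j, M.gamma ψ θ j * M.psiFun ψ j x)) ^ 2 ∂M.P₀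
          = ‖M.gamma ψ θ‖ ^ 2 := by
        rw [M.norm_gamma ψ hne hclosed hconvex, mul_pow, norm_sq_Lp_two, ← integral_const_mul]
        refine integral_congr_ae ?_
        filter_upwards [M.half_sum_gamma_ae_eq ψ hne hclosed hconvex θ] with x hx
        rw [hx, mul_pow]
      rw [e]
      ring_nf
    · have h0 : Tendsto (fun n => ENNReal.ofReal (2 * (r n / √(n : ℝ)))) atTop (𝓝 0) := by
        have := ENNReal.tendsto_ofReal ((tendsto_div_sqrt_of_isLittleO hro).const_mul 2)
        simpa using this
      refine tendsto_of_tendsto_of_tendsto_of_le_of_le tendsto_const_nhds h0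
        (fun _ => zero_le) fun n => iSup₂_le fun θ hθ => ?_
      rw [← ofReal_norm]
      have h1 : M.h θ ≤ r n / √(n : ℝ) := hθ
      exact ENNReal.ofReal_le_ofReal ((hnorm θ).trans (by linarith))
    · rw [M.sqrt_smul_gammaHat ψ]
      exact ⟨Set.mem_univ _, fun s _ => by simp⟩
    · exact tendstoInDistribution_empProc hX hlaw hindep (M.measurable_psiFun ψ)
        (M.memLp_psiFun ψ) (M.integral_psiFun ψ) (M.integral_psiFun_mul ψ)

end FiniteDimensional

end LikelihoodModel

/-! ### Slowly increasing sequences of levels -/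

/-- Diagonal argument: take the largest `k ≤ n` whose threshold has been passed. Once the threshold
of `0` is passed, the default value `0` of `Nat.findGreatest` is harmless as well. -/
theorem exists_tendsto_atTop_of_eventually {Q : ℕ → ℕ → Prop}
    (h : ∀ k, ∀ᶠ n in atTop, Q k n) :
    ∃ k : ℕ → ℕ, Tendsto k atTop atTop ∧ ∀ᶠ n in atTop, Q (k n) n := by
  simp only [eventually_atTop] at h
  choose N hN using h
  refine ⟨fun n => Nat.findGreatest (fun k => N k ≤ n) n, tendsto_atTop.2 fun b => ?_, ?_⟩
  · filter_upwards [eventually_ge_atTop (max b (N b))] with n hn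
    exact Nat.le_findGreatest ((le_max_left _ _).trans hn) ((le_max_right _ _).trans hn)
  · filter_upwards [eventually_ge_atTop (N 0)] with n hn
    exact hN _ _ (Nat.findGreatest_spec (P := fun k => N k ≤ n) (Nat.zero_le n) hn)

/-! ### Random signs -/

section Signs

variable {ι : Type*} [DecidableEq ι]

/-- A sign vector is coded by the set `T` of its plus signs. A new index splits each vector in two,
which is the induction step for the moments of signed sums. -/
theorem sum_powerset_insert_signed {a : ι → ℝ} {s : Finset ι} {i : ι} (hi : i ∉ s)
    (φ : ℝ → ℝ) :
    ∑ T ∈ (insert i s).powerset, φ (∑ j ∈ T, a j - ∑ j ∈ insert i s \ T, a j)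
      = ∑ T ∈ s.powerset, (φ ((∑ j ∈ T, a j - ∑ j ∈ s \ T, a j) - a i)
        + φ ((∑ j ∈ T, a j - ∑ j ∈ s \ T, a j) + a i)) := by
  rw [Finset.sum_powerset_insert hi, ← Finset.sum_add_distrib]
  refine Finset.sum_congr rfl fun T hT => ?_
  have hT' := Finset.mem_powerset.1 hT
  have hiT : i ∉ T := fun h => hi (hT' h)
  have e1 : insert i s \ T = insert i (s \ T) := Finset.insert_sdiff_of_notMem _ hiT
  have e2 : insert i s \ insert i T = s \ T := by
    rw [Finset.insert_sdiff_insert, Finset.sdiff_insert_of_notMem hi]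
  rw [e1, e2, Finset.sum_insert hiT, Finset.sum_insert (by simp [hi])]
  congr 2 <;> ring

theorem sum_powerset_signed_sq (a : ι → ℝ) (s : Finset ι) :
    ∑ T ∈ s.powerset, (∑ j ∈ T, a j - ∑ j ∈ s \ T, a j) ^ 2
      = 2 ^ s.card * ∑ j ∈ s, a j ^ 2 := by
  induction s using Finset.induction_on with
  | empty => simp
  | insert i s hi ih =>
    rw [sum_powerset_insert_signed hi (fun u => u ^ 2), Finset.card_insert_of_notMem hi,
      Finset.sum_insert hi]
    have e : ∀ u : ℝ, (u - a i) ^ 2 + (u + a i) ^ 2 = 2 * u ^ 2 + 2 * a i ^ 2 := fun u => by ring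
    simp only [e]
    rw [Finset.sum_add_distrib, ← Finset.mul_sum, ih, Finset.sum_const, Finset.card_powerset,
      nsmul_eq_mul]
    push_cast
    ring

/-- Khinchine's inequality for fourth moments. Odd powers of `a i` cancel between the two signs, and
the cross term `12 a² u²` is exactly what expanding `3(B + a²)²` provides after doubling. -/
theorem sum_powerset_signed_pow_four_le (a : ι → ℝ) (s : Finset ι) :
    ∑ T ∈ s.powerset, (∑ j ∈ T, a j - ∑ j ∈ s \ T, a j) ^ 4
      ≤ 3 * 2 ^ s.card * (∑ j ∈ s, a j ^ 2) ^ 2 := by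
  induction s using Finset.induction_on with
  | empty => simp
  | insert i s hi ih =>
    rw [sum_powerset_insert_signed hi (fun u => u ^ 4), Finset.card_insert_of_notMem hi,
      Finset.sum_insert hi]
    have e : ∀ u : ℝ, (u - a i) ^ 4 + (u + a i) ^ 4
        = 2 * u ^ 4 + 12 * a i ^ 2 * u ^ 2 + 2 * a i ^ 4 := fun u => by ring
    simp only [e]
    rw [Finset.sum_add_distrib, Finset.sum_add_distrib, ← Finset.mul_sum, ← Finset.mul_sum,
      sum_powerset_signed_sq, Finset.sum_const, Finset.card_powerset, nsmul_eq_mul]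
    push_cast
    have h2 : (0 : ℝ) ≤ 2 ^ s.card * a i ^ 4 := by positivity
    calc _ ≤ 2 * (3 * 2 ^ s.card * (∑ j ∈ s, a j ^ 2) ^ 2)
          + 12 * a i ^ 2 * (2 ^ s.card * ∑ j ∈ s, a j ^ 2) + 2 ^ s.card * (2 * a i ^ 4) := by
          gcongr
      _ ≤ _ := by
        rw [pow_succ (2 : ℝ) s.card]
        nlinarith

/-- A Paley–Zygmund inequality: at least a fifth of all sign vectors produce a signed sum that is
at least of the order of the root of the sum of squares. -/
theorem two_pow_card_le_five_mul_card_signed (a : ι → ℝ) (s : Finset ι) {A : ℝ} (hA : 0 ≤ A)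
    (h : A < ∑ j ∈ s, a j ^ 2) :
    2 ^ s.card ≤ 5 * (s.powerset.filter fun T =>
      A / 4 < (∑ j ∈ T, a j - ∑ j ∈ s \ T, a j) ^ 2).card := by
  set B := ∑ j ∈ s, a j ^ 2 with hB
  set Z : Finset ι → ℝ := fun T => ∑ j ∈ T, a j - ∑ j ∈ s \ T, a j with hZ
  have hB0 : 0 < B := hA.trans_lt h
  have h2 : ∑ T ∈ s.powerset, Z T ^ 2 = 2 ^ s.card * B := sum_powerset_signed_sq a s
  have h4 : ∑ T ∈ s.powerset, Z T ^ 4 ≤ 3 * 2 ^ s.card * B ^ 2 :=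
    sum_powerset_signed_pow_four_le a s
  -- As a quadratic in `Z²` the left side has maximum `(31B/8)² ≤ 16B²`, and it is nonpositive when
  -- `Z² ≤ B/4`. By the two moment bounds its average is at least `13B²/4`, so the fraction of good
  -- `T` is at least `13/64 > 1/5`.
  have hpt : ∀ T, (Z T ^ 2 - B / 4) * (8 * B - Z T ^ 2)
      ≤ 16 * B ^ 2 * if A / 4 < Z T ^ 2 then 1 else 0 := by
    intro T
    split_ifs with hT
    · nlinarith [sq_nonneg (Z T ^ 2 - 33 / 8 * B)]
    · nlinarith [sq_nonneg (Z T)]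
  have hsum := Finset.sum_le_sum fun T (_ : T ∈ s.powerset) => hpt T
  have e : ∀ T, (Z T ^ 2 - B / 4) * (8 * B - Z T ^ 2)
      = 33 / 4 * B * Z T ^ 2 - Z T ^ 4 - 2 * B ^ 2 := fun T => by ring
  simp only [e] at hsum
  rw [Finset.sum_sub_distrib, Finset.sum_sub_distrib, ← Finset.mul_sum, ← Finset.mul_sum, h2,
    ← Finset.mul_sum, Finset.sum_const, Finset.card_powerset, nsmul_eq_mul,
    Finset.sum_boole] at hsum
  push_cast at hsum
  have h5 : B ^ 2 * (2 : ℝ) ^ s.card ≤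
      B ^ 2 * (5 * ((s.powerset.filter fun T => A / 4 < Z T ^ 2).card : ℝ)) := by
    nlinarith [mul_nonneg (sq_nonneg B) (Nat.cast_nonneg (α := ℝ)
      (s.powerset.filter fun T => A / 4 < Z T ^ 2).card), pow_pos (two_pos (α := ℝ)) s.card]
  have h6 := le_of_mul_le_mul_left h5 (by positivity)
  exact_mod_cast h6

end Signs

/-! ### Averaging over sets of small outer measure -/

section Probability

variable {𝓧 Ω : Type*} [MeasurableSpace 𝓧] [MeasurableSpace Ω]

/-- If each point of `E` lies in at least a fifth of the sets `B T`, `T ∈ S`, and these have outer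
measure at most `κ`, then `E` has outer measure at most `5κ`. -/
theorem measure_le_five_mul_of_card_le {ι : Type*} {μ : Measure Ω} {S : Finset ι}
    (hS : S.Nonempty) {B : ι → Set Ω} {κ : ℝ≥0∞} (hB : ∀ T ∈ S, μ (B T) ≤ κ) {E : Set Ω}
    (hE : ∀ ω ∈ E, ∃ S' ⊆ S, (∀ T ∈ S', ω ∈ B T) ∧ S.card ≤ 5 * S'.card) :
    μ E ≤ 5 * κ := by
  classical
  -- The sets need not be measurable. Measurable hulls have the same measure and only increase the
  -- count, so Markov's inequality applies to the number of hulls containing `ω`.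
  have hmeas : Measurable fun ω => ∑ T ∈ S, (toMeasurable μ (B T)).indicator (1 : Ω → ℝ≥0∞) ω :=
    Finset.measurable_sum _ fun T _ => measurable_one.indicator (measurableSet_toMeasurable _ _)
  have hsub : E ⊆ {ω | (S.card : ℝ≥0∞) / 5 ≤
      ∑ T ∈ S, (toMeasurable μ (B T)).indicator (1 : Ω → ℝ≥0∞) ω} := by
    intro ω hω
    obtain ⟨S', hS', hmem, hcard⟩ := hE ω hω
    rw [Set.mem_ofPred_eq]
    refine (ENNReal.div_le_of_le_mul ?_).trans (Finset.sum_le_sum_of_subset hS')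
    have e : ∑ T ∈ S', (toMeasurable μ (B T)).indicator (1 : Ω → ℝ≥0∞) ω = S'.card := by
      rw [Finset.sum_congr rfl fun T hT =>
        Set.indicator_of_mem (subset_toMeasurable μ (B T) (hmem T hT)) _]
      simp
    rw [e, mul_comm]
    exact_mod_cast hcard
  have hM := mul_meas_ge_le_lintegral (μ := μ) hmeas ((S.card : ℝ≥0∞) / 5)
  rw [lintegral_finsetSum _ fun T _ =>
    measurable_one.indicator (measurableSet_toMeasurable _ _)] at hM
  have hle : ∑ T ∈ S, ∫⁻ ω, (toMeasurable μ (B T)).indicator (1 : Ω → ℝ≥0∞) ω ∂μ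
      ≤ S.card * κ := by
    refine (Finset.sum_le_card_nsmul _ _ κ fun T hT => ?_).trans_eq (nsmul_eq_mul _ _)
    rw [lintegral_indicator_one (measurableSet_toMeasurable _ _), measure_toMeasurable]
    exact hB T hT
  have hc : (S.card : ℝ≥0∞) ≠ 0 := by exact_mod_cast hS.card_pos.ne'
  have h1 : (S.card : ℝ≥0∞) / 5 * μ E ≤ S.card * κ :=
    (mul_le_mul_right (measure_mono hsub) _).trans (hM.trans hle)
  rw [div_eq_mul_inv, mul_assoc, ENNReal.mul_le_mul_iff_right hc (ENNReal.natCast_ne_top _)] at h1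
  calc μ E = 5 * (5⁻¹ * μ E) := by
        rw [← mul_assoc, ENNReal.mul_inv_cancel (by norm_num) (by norm_num), one_mul]
    _ ≤ 5 * κ := by gcongr

/-! ### Independent and identically distributed observations -/

/-- Any `k` distinct observations have the product law. For a nonmeasurable event passing to a
measurable hull yields an inequality, which is the direction needed to transport Donsker bounds to
arbitrary subsamples. -/
theorem measure_sample_mem_le {Pr : Measure Ω} {P : Measure 𝓧} {X : ℕ → Ω → 𝓧}
    (hX : ∀ i, Measurable (X i)) (hlaw : ∀ i, Pr.map (X i) = P) (hindep : iIndepFun X Pr)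
    {k : ℕ} {e : Fin k → ℕ} (he : Function.Injective e) (A : Set (Fin k → 𝓧)) :
    Pr {ω | (fun i => X (e i) ω) ∈ A} ≤ Measure.pi (fun _ : Fin k => P) A := by
  have hmap : Pr.map (fun ω i => X (e i) ω) = Measure.pi (fun _ : Fin k => P) := by
    rw [(hindep.precomp he).map_fun_eq_pi_map fun i => (hX (e i)).aemeasurable]
    simp only [hlaw]
  rw [← measure_toMeasurable A, ← hmap,
    Measure.map_apply (measurable_pi_lambda _ fun i => hX (e i)) (measurableSet_toMeasurable _ _)]
  exact measure_mono fun ω hω => by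
    have := subset_toMeasurable (Measure.pi fun _ : Fin k => P) A hω
    rw [← hmap] at this
    exact this

theorem measure_preimage_le_of_map_eq {Pr : Measure Ω} {P : Measure 𝓧} {Y : Ω → 𝓧}
    (hY : Measurable Y) (hlaw : Pr.map Y = P) (A : Set 𝓧) : Pr {ω | Y ω ∈ A} ≤ P A := by
  rw [← measure_toMeasurable A, ← hlaw, Measure.map_apply hY (measurableSet_toMeasurable _ _)]
  exact measure_mono fun ω hω => subset_toMeasurable _ A hω

theorem measure_lt_abs_empProc_le {Pr : Measure Ω} [IsProbabilityMeasure Pr] {P : Measure 𝓧}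
    [IsProbabilityMeasure P]
    {X : ℕ → Ω → 𝓧} (hX : ∀ i, Measurable (X i)) (hlaw : ∀ i, Pr.map (X i) = P)
    (hindep : iIndepFun X Pr) {f : 𝓧 → ℝ} (hf : Measurable f) (hf2 : MemLp f 2 P) {η : ℝ}
    (hη : 0 < η) (n : ℕ) :
    Pr {ω | η < |empProc P (sample X n ω) f|} ≤ ENNReal.ofReal ((∫ y, f y ^ 2 ∂P) / η ^ 2) := by
  rcases n.eq_zero_or_pos with rfl | hn
  · simp [empProc, not_lt.2 hη.le]
  have hn0 : (0 : ℝ) < n := by exact_mod_cast hn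
  have hmp : ∀ i, MeasurePreserving (X i) Pr P := fun i => ⟨hX i, hlaw i⟩
  have hmap : ∀ i, MemLp (fun ω => f (X i ω)) 2 Pr := fun i => hf2.comp_measurePreserving (hmp i)
  have hmean : ∀ i, ∫ ω, f (X i ω) ∂Pr = ∫ y, f y ∂P := fun i => by
    rw [← hlaw i, integral_map (hX i).aemeasurable hf.aestronglyMeasurable]
  have hvar : ∀ i, Var[fun ω => f (X i ω); Pr] ≤ ∫ y, f y ^ 2 ∂P := fun i => by
    refine (variance_le_expectation_sq (hf.comp (hX i)).aestronglyMeasurable).trans_eq ?_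
    simp only [Pi.pow_apply, Function.comp_apply]
    rw [← hlaw i, integral_map (hX i).aemeasurable (hf.pow_const 2).aestronglyMeasurable]
  set W : Ω → ℝ := fun ω => ∑ i ∈ Finset.range n, f (X i ω) with hW
  have hWL : MemLp W 2 Pr := memLp_finsetSum _ fun i _ => hmap i
  have hWmean : ∫ ω, W ω ∂Pr = n * ∫ y, f y ∂P := by
    rw [integral_finsetSum _ fun i _ => (hmap i).integrable one_le_two]
    simp [hmean]
  have hWvar : Var[W; Pr] ≤ n * ∫ y, f y ^ 2 ∂P := by
    have e : W = ∑ i ∈ Finset.range n, fun ω => f (X i ω) := by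
      funext ω
      simp [hW]
    rw [e, IndepFun.variance_sum (fun i _ => hmap i) fun i _ j _ hij =>
      (hindep.indepFun hij).comp hf hf]
    refine (Finset.sum_le_card_nsmul _ _ _ fun i _ => hvar i).trans_eq ?_
    simp
  have hsub : {ω | η < |empProc P (sample X n ω) f|}
      ⊆ {ω | √(n : ℝ) * η ≤ |W ω - ∫ ω, W ω ∂Pr|} := by
    intro ω hω
    have hω' : η < |empProc P (sample X n ω) f| := hω
    have e : W ω - ∫ ω, W ω ∂Pr = √(n : ℝ) * empProc P (sample X n ω) f := by
      have h1 := natCast_mul_empMean hn (sample X n ω) f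
      rw [hWmean, empProc, ← mul_assoc, Real.mul_self_sqrt hn0.le, mul_sub, h1]
      simp [hW, sample, Finset.sum_range]
    rw [Set.mem_ofPred_eq, e, abs_mul, abs_of_nonneg (Real.sqrt_nonneg _)]
    gcongr
  refine (measure_mono hsub).trans
    ((meas_ge_le_variance_div_sq hWL (by positivity)).trans (ENNReal.ofReal_le_ofReal ?_))
  rw [mul_pow, Real.sq_sqrt hn0.le, div_le_div_iff₀ (by positivity) (by positivity)]
  calc Var[W; Pr] * η ^ 2 ≤ (n * ∫ y, f y ^ 2 ∂P) * η ^ 2 := by gcongr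
    _ = _ := by ring

theorem tendsto_measure_lt_abs_empMean_sub {Pr : Measure Ω} [IsProbabilityMeasure Pr]
    {P : Measure 𝓧} {X : ℕ → Ω → 𝓧} (hX : ∀ i, Measurable (X i))
    (hlaw : ∀ i, Pr.map (X i) = P) (hindep : iIndepFun X Pr) {f : 𝓧 → ℝ} (hf : Measurable f)
    (hf1 : Integrable f P) {η : ℝ} (hη : 0 < η) :
    Tendsto (fun n => Pr {ω | η < |empMean (sample X n ω) f - ∫ y, f y ∂P|}) atTop (𝓝 0) := by
  have hint : Integrable (fun ω => f (X 0 ω)) Pr := by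
    rw [← hlaw 0] at hf1
    exact hf1.comp_measurable (hX 0)
  have hslln := strong_law_ae_real (fun i ω => f (X i ω)) hint
    (fun i j hij => (hindep.indepFun hij).comp hf hf) fun i => identDistrib_comp hX hlaw hf i 0
  have hmean : ∫ ω, f (X 0 ω) ∂Pr = ∫ y, f y ∂P := by
    rw [← hlaw 0, integral_map (hX 0).aemeasurable hf.aestronglyMeasurable]
  have hae : ∀ᵐ ω ∂Pr, Tendsto (fun n => empMean (sample X n ω) f) atTop (𝓝 (∫ y, f y ∂P)) := by
    filter_upwards [hslln] with ω hω
    rw [hmean] at hω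
    refine hω.congr fun n => ?_
    simp [empMean, sample, Finset.sum_range, div_eq_inv_mul]
  have h := tendstoInMeasure_of_tendsto_ae (fun n => ((measurable_empMean hf).comp
    (measurable_sample hX n)).aestronglyMeasurable) hae (ENNReal.ofReal η)
    (ENNReal.ofReal_pos.2 hη)
  refine tendsto_of_tendsto_of_tendsto_of_le_of_le tendsto_const_nhds h (fun _ => zero_le)
    fun n => measure_mono fun ω hω => ?_
  have hω' : η < |empMean (sample X n ω) f - ∫ y, f y ∂P| := hω
  rw [Set.mem_ofPred_eq, edist_dist, Real.dist_eq]
  exact ENNReal.ofReal_le_ofReal hω'.le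

/-- Chebyshev alone gives only boundedness. Keeping the integral of `D²` over the tail `{D² ≥ η² n}`
gives the limit zero, by integrability of `D²`. -/
theorem tendsto_natCast_mul_measure_lt {P : Measure 𝓧} [IsProbabilityMeasure P] {D : 𝓧 → ℝ}
    (hD : MemLp D 2 P) {η : ℝ} (hη : 0 < η) :
    Tendsto (fun n : ℕ => (n : ℝ≥0∞) * P {x | η * √(n : ℝ) < D x}) atTop (𝓝 0) := by
  set f : 𝓧 → ℝ≥0∞ := fun x => ENNReal.ofReal (hD.1.mk D x ^ 2) with hf
  have hfm : Measurable f :=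
    ENNReal.measurable_ofReal.comp (hD.1.stronglyMeasurable_mk.measurable.pow_const 2)
  have hfint : ∫⁻ x, f x ∂P ≠ ∞ := by
    have h := ((memLp_congr_ae hD.1.ae_eq_mk).1 hD).integrable_sq
    rw [hf, ← ofReal_integral_eq_lintegral_ofReal h (Eventually.of_forall fun _ => sq_nonneg _)]
    exact ENNReal.ofReal_ne_top
  set s : ℕ → Set 𝓧 := fun n => {x | ENNReal.ofReal (η ^ 2 * n) ≤ f x} with hs
  have hsm : ∀ n, MeasurableSet (s n) := fun n => measurableSet_le measurable_const hfm
  have hle : ∀ n : ℕ, ENNReal.ofReal (η ^ 2 * n) * P (s n) ≤ ∫⁻ x in s n, f x ∂P := fun n => by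
    rw [← setLIntegral_const]
    exact setLIntegral_mono hfm fun x hx => hx
  have hs0 : Tendsto (fun n => P (s n)) atTop (𝓝 0) := by
    have hc : Tendsto (fun n : ℕ => (∫⁻ x, f x ∂P) / ENNReal.ofReal (η ^ 2 * n)) atTop (𝓝 0) := by
      refine ENNReal.Tendsto.const_div (b := ∞) ?_ (Or.inr hfint) |>.trans_eq (by simp)
      exact ENNReal.tendsto_ofReal_atTop.comp
        (tendsto_natCast_atTop_atTop.const_mul_atTop (by positivity))
    refine tendsto_of_tendsto_of_tendsto_of_le_of_le' tendsto_const_nhds hc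
      (Eventually.of_forall fun _ => zero_le) ?_
    filter_upwards [eventually_gt_atTop 0] with n hn
    have hn0 : (0 : ℝ) < n := by exact_mod_cast hn
    exact meas_ge_le_lintegral_div hfm.aemeasurable
      (ENNReal.ofReal_pos.2 (by positivity)).ne' ENNReal.ofReal_ne_top
  have hlim := tendsto_setLIntegral_zero hfint hs0
  have hlim2 : Tendsto (fun n => ENNReal.ofReal ((η ^ 2)⁻¹) * ∫⁻ x in s n, f x ∂P) atTop (𝓝 0) := by
    simpa using ENNReal.Tendsto.const_mul hlim (Or.inr ENNReal.ofReal_ne_top)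
  refine tendsto_of_tendsto_of_tendsto_of_le_of_le tendsto_const_nhds hlim2 (fun _ => zero_le)
    fun n => ?_
  have h1 : P {x | η * √(n : ℝ) < D x} ≤ P (s n) := by
    refine measure_mono_ae ?_
    filter_upwards [hD.1.ae_eq_mk] with x hx hlt
    have hlt' : η * √(n : ℝ) < D x := hlt
    change ENNReal.ofReal (η ^ 2 * n) ≤ f x
    rw [hf]
    refine ENNReal.ofReal_le_ofReal ?_
    rw [← hx, ← Real.sq_sqrt (Nat.cast_nonneg n), ← mul_pow]
    gcongr
  calc (n : ℝ≥0∞) * P {x | η * √(n : ℝ) < D x} ≤ n * P (s n) := by gcongr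
    _ = ENNReal.ofReal ((η ^ 2)⁻¹) * (ENNReal.ofReal (η ^ 2 * n) * P (s n)) := by
      rw [← mul_assoc, ← ENNReal.ofReal_mul (by positivity), inv_mul_cancel_left₀ (by positivity),
        ENNReal.ofReal_natCast]
    _ ≤ _ := by gcongr; exact hle n

theorem tendsto_measure_exists_lt {Pr : Measure Ω} {P : Measure 𝓧} [IsProbabilityMeasure P]
    {X : ℕ → Ω → 𝓧} (hX : ∀ i, Measurable (X i)) (hlaw : ∀ i, Pr.map (X i) = P)
    {D : 𝓧 → ℝ} (hD : MemLp D 2 P) {η : ℝ} (hη : 0 < η) :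
    Tendsto (fun n : ℕ => Pr {ω | ∃ i : Fin n, η * √(n : ℝ) < D (sample X n ω i)})
      atTop (𝓝 0) := by
  refine tendsto_of_tendsto_of_tendsto_of_le_of_le tendsto_const_nhds
    (tendsto_natCast_mul_measure_lt hD hη) (fun _ => zero_le) fun n => ?_
  have e : {ω | ∃ i : Fin n, η * √(n : ℝ) < D (sample X n ω i)}
      = ⋃ i : Fin n, {ω | X i ω ∈ {x | η * √(n : ℝ) < D x}} := by
    ext ω
    simp [sample]
  rw [e]
  refine (measure_iUnion_fintype_le _ _).trans ((Finset.sum_le_card_nsmul Finset.univ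
    (fun i : Fin n => Pr {ω | X i ω ∈ {x | η * √(n : ℝ) < D x}}) _ fun i _ =>
    measure_preimage_le_of_map_eq (hX i) (hlaw i) _).trans_eq ?_)
  simp

end Probability

/-! ### Oscillation of the empirical process over a Donsker class -/

theorem EllInfty.abs_apply_sub_le {𝓧 : Type*} {F : Set (𝓧 → ℝ)} (z w : EllInfty F) (f : F) :
    |z f - w f| ≤ dist z w := by
  rw [dist_eq_norm]
  exact lp.norm_apply_le_norm ENNReal.top_ne_zero (z - w) f

theorem EllInfty.exists_finite_partition {𝓧 : Type*} {F : Set (𝓧 → ℝ)} {K : Set (EllInfty F)}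
    (hK : IsCompact K) {δ : ℝ} (hδ : 0 < δ) :
    ∃ (m : ℕ) (c : F → Fin m), ∀ z ∈ K, ∀ f g, c f = c g → |z f - z g| ≤ 3 * δ := by
  obtain ⟨s, -, hs, hcov⟩ := hK.finite_cover_balls hδ
  have : Finite s := hs
  -- A cell is determined by the values at `f` of the finitely many net points, rounded to multiples
  -- of `δ`; boundedness of these points leaves finitely many cells. Two approximations and one
  -- rounding cost `3δ`.
  set c : F → s → ℤ := fun f z => ⌊z.1 f / δ⌋ with hc
  have hfin : (Set.range c).Finite := by
    refine Set.Finite.subset (Set.Finite.pi' fun z : s =>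
      Set.finite_Icc ⌊-‖z.1‖ / δ⌋ ⌊‖z.1‖ / δ⌋) ?_
    rintro _ ⟨f, rfl⟩ z
    have h := abs_le.1 (lp.norm_apply_le_norm ENNReal.top_ne_zero z.1 f)
    exact ⟨Int.floor_mono (by gcongr; exact h.1), Int.floor_mono (by gcongr; exact h.2)⟩
  have : Finite (Set.range c) := hfin
  refine ⟨Nat.card (Set.range c), fun f => Finite.equivFin _ ⟨c f, f, rfl⟩, fun z hz f g hfg => ?_⟩
  have hcfg : c f = c g := congrArg Subtype.val ((Finite.equivFin _).injective hfg)
  obtain ⟨w, hw, hzw⟩ := Set.mem_iUnion₂.1 (hcov hz)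
  have h1 := EllInfty.abs_apply_sub_le z w f
  have h2 := EllInfty.abs_apply_sub_le z w g
  have h3 : |w f / δ - w g / δ| < 1 := Int.abs_sub_lt_one_of_floor_eq_floor (congrFun hcfg ⟨w, hw⟩)
  rw [← sub_div, abs_div, abs_of_pos hδ, div_lt_one hδ] at h3
  have hd : dist z w < δ := hzw
  have e : z f - z g = (z f - w f) - (z g - w g) + (w f - w g) := by ring
  rw [e]
  have h4 := abs_add_le (z f - w f - (z g - w g)) (w f - w g)
  have h5 := abs_sub (z f - w f) (z g - w g)
  linarith

theorem sum_sub_integral_eq_sqrt_mul_empProc {𝓧 Ω : Type*} [MeasurableSpace 𝓧] {P : Measure 𝓧}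
    (X : ℕ → Ω → 𝓧) (ω : Ω) (T : Finset ℕ) (f : 𝓧 → ℝ) :
    ∑ i ∈ T, (f (X i ω) - ∫ y, f y ∂P)
      = √(T.card : ℝ) * empProc P (fun i : Fin T.card => X (T.orderEmbOfFin rfl i) ω) f := by
  have e : ∑ i ∈ T, f (X i ω) = ∑ i : Fin T.card, f (X (T.orderEmbOfFin rfl i) ω) := by
    conv_lhs => rw [← Finset.map_orderEmbOfFin_univ T rfl, Finset.sum_map]
    rfl
  rcases T.card.eq_zero_or_pos with h0 | h0
  · rw [Finset.card_eq_zero] at h0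
    subst h0
    simp
  · have h0' : (0 : ℝ) < T.card := by exact_mod_cast h0
    rw [empProc, ← mul_assoc, Real.mul_self_sqrt h0'.le, mul_sub, natCast_mul_empMean h0, ← e]
    simp

section Donsker

variable {𝓧 Ω : Type*} [MeasurableSpace 𝓧] [MeasurableSpace Ω]

/-- Values of the empirical process over a `P`-Donsker class concentrate near a compact set. -/
theorem IsDonsker.exists_isCompact {P : Measure 𝓧} [IsProbabilityMeasure P]
    {F : Set (𝓧 → ℝ)} (h : IsDonsker P F) :
    ∃ hF : HasBoundedPaths P F, ∀ κ : ℝ, 0 < κ → ∃ K : Set (EllInfty F), IsCompact K ∧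
      K.Nonempty ∧ ∀ δ : ℝ, 0 < δ → ∀ᶠ n : ℕ in atTop, (Measure.pi fun _ : Fin n => P)
        {x | δ ≤ Metric.infDist (empProcLInfty hF x) K} ≤ ENNReal.ofReal κ := by
  obtain ⟨-, hF, G, hG, htight, hlim⟩ := h
  refine ⟨hF, fun κ hκ => ?_⟩
  obtain ⟨K', hK', hGK'⟩ := isTightMeasureSet_iff_exists_isCompact_measure_compl_le.1 htight
    (ENNReal.ofReal (κ / 2)) (ENNReal.ofReal_pos.2 (by positivity))
  refine ⟨insert 0 K', hK'.insert 0, ⟨0, Set.mem_insert _ _⟩, fun δ hδ => ?_⟩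
  set K := insert 0 K' with hK
  have hKm : MeasurableSet K := (hK'.insert 0).isClosed.measurableSet
  have hGK : G Kᶜ ≤ ENNReal.ofReal (κ / 2) :=
    (measure_mono (Set.compl_subset_compl.2 (Set.subset_insert _ _))).trans (hGK' G rfl)
  -- A continuous test function that vanishes on `K` and equals `1` at distance at least `δ`: its
  -- limiting mean is at most `G Kᶜ`, and its outer expectation dominates the probability sought.
  set φ₀ : EllInfty F → ℝ := fun z => min 1 (Metric.infDist z K / δ) with hφ₀
  have hφ_nonneg : ∀ z, 0 ≤ φ₀ z := fun z =>
    le_min zero_le_one (div_nonneg Metric.infDist_nonneg hδ.le)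
  have hφ_le : ∀ z, φ₀ z ≤ 1 := fun z => min_le_left _ _
  have hφ_cont : Continuous φ₀ :=
    continuous_const.min ((Metric.continuous_infDist_pt K).div_const δ)
  set φ : BoundedContinuousFunction (EllInfty F) ℝ :=
    BoundedContinuousFunction.ofNormedAddCommGroup φ₀ hφ_cont 1 (fun z => by
      rw [Real.norm_eq_abs, abs_of_nonneg (hφ_nonneg z)]; exact hφ_le z) with hφ
  have hint : ∫ z, φ z ∂G ≤ κ / 2 := by
    calc ∫ z, φ z ∂G ≤ ∫ z, Kᶜ.indicator (fun _ => (1 : ℝ)) z ∂G := by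
          refine integral_mono (φ.integrable G)
            ((integrable_const 1).indicator hKm.compl) fun z => ?_
          by_cases hz : z ∈ K
          · have : φ₀ z = 0 := by
              rw [hφ₀]
              simp [Metric.infDist_zero_of_mem hz]
            rw [Set.indicator_of_notMem (by simpa using hz)]
            exact this.le
          · rw [Set.indicator_of_mem hz]
            exact hφ_le z
      _ = G.real Kᶜ := integral_indicator_one hKm.compl
      _ ≤ κ / 2 := ENNReal.toReal_le_of_le_ofReal (by positivity) hGK
  have hev := (hlim φ).eventually (gt_mem_nhds (show ∫ z, φ z ∂G < κ by linarith))
  filter_upwards [hev] with n hn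
  rw [outerExpectation] at hn
  obtain ⟨_, ⟨U, hU, hUint, hUle, rfl⟩, hlt⟩ := exists_lt_of_csInf_lt
    (by exact ⟨_, fun _ => 1, measurable_const, integrable_const 1, fun x => hφ_le _, rfl⟩) hn
  have hU0 : ∀ x, 0 ≤ U x := fun x => (hφ_nonneg _).trans (hUle x)
  have hM := mul_meas_ge_le_integral_of_nonneg (Eventually.of_forall hU0) hUint 1
  rw [one_mul] at hM
  refine (measure_mono (t := {x | 1 ≤ U x}) fun x hx => ?_).trans ?_
  · refine le_trans ?_ (hUle x)
    have hx' : δ ≤ Metric.infDist (empProcLInfty hF x) K := hx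
    exact le_min le_rfl ((one_le_div hδ).2 hx')
  · rw [← ofReal_measureReal]
    exact ENNReal.ofReal_le_ofReal (hM.trans hlt.le)

/-- A Donsker class has a finite partition such that the empirical process oscillates little over
each cell. -/
theorem IsDonsker.exists_finite_partition {P : Measure 𝓧} [IsProbabilityMeasure P]
    {F : Set (𝓧 → ℝ)} (h : IsDonsker P F) {η κ : ℝ} (hη : 0 < η) (hκ : 0 < κ) :
    ∃ (m : ℕ) (c : F → Fin m), ∀ᶠ n : ℕ in atTop, (Measure.pi fun _ : Fin n => P)
      {x | ∃ f g : F, c f = c g ∧ η < |empProc P x f.1 - empProc P x g.1|}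
        ≤ ENNReal.ofReal κ := by
  obtain ⟨hF, h⟩ := h.exists_isCompact
  obtain ⟨K, hK, hKne, hlim⟩ := h κ hκ
  -- One fifth for each of the two approximations by a point of `K`, three fifths for the
  -- oscillation of that point over a cell.
  obtain ⟨m, c, hc⟩ := EllInfty.exists_finite_partition hK (show 0 < η / 5 by positivity)
  refine ⟨m, c, (hlim (η / 5) (by positivity)).mono fun n hn => (measure_mono ?_).trans hn⟩
  rintro x ⟨f, g, hfg, hlt⟩
  by_contra hx
  have hx' : Metric.infDist (empProcLInfty hF x) K < η / 5 := not_le.1 hx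
  obtain ⟨z, hz, hzd⟩ := (Metric.infDist_lt_iff hKne).1 hx'
  have h1 := EllInfty.abs_apply_sub_le (empProcLInfty hF x) z f
  have h2 := EllInfty.abs_apply_sub_le (empProcLInfty hF x) z g
  have h3 := hc z hz f g hfg
  change |empProc P x f.1 - z f| ≤ _ at h1
  change |empProc P x g.1 - z g| ≤ _ at h2
  rw [abs_le] at h1 h2 h3
  refine absurd hlt (not_lt.2 (abs_le.2 ⟨?_, ?_⟩)) <;> linarith

theorem IsDonsker.exists_finite_partition_sample {P : Measure 𝓧} [IsProbabilityMeasure P]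
    {F : Set (𝓧 → ℝ)} (h : IsDonsker P F) {Pr : Measure Ω} {X : ℕ → Ω → 𝓧}
    (hX : ∀ i, Measurable (X i)) (hlaw : ∀ i, Pr.map (X i) = P) (hindep : iIndepFun X Pr)
    {η κ : ℝ} (hη : 0 < η) (hκ : 0 < κ) :
    ∃ (m : ℕ) (c : F → Fin m), ∀ᶠ n : ℕ in atTop,
      Pr {ω | ∃ f g : F, c f = c g ∧
        η < |empProc P (sample X n ω) f.1 - empProc P (sample X n ω) g.1|} ≤ ENNReal.ofReal κ := by
  obtain ⟨m, c, hc⟩ := h.exists_finite_partition hη hκ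
  exact ⟨m, c, hc.mono fun n hn =>
    (measure_sample_mem_le hX hlaw hindep Fin.val_injective _).trans hn⟩

/-! ### Quadratic oscillation over a Donsker class -/

theorem tendsto_measure_exists_mem_lt {Pr : Measure Ω} {P : Measure 𝓧} [IsProbabilityMeasure P]
    {X : ℕ → Ω → 𝓧} (hX : ∀ i, Measurable (X i)) (hlaw : ∀ i, Pr.map (X i) = P)
    {D : 𝓧 → ℝ} (hD : MemLp D 2 P) {η : ℝ} (hη : 0 < η) (N : ℕ) {κ : ℝ} (hκ : 0 < κ) :
    ∀ᶠ n : ℕ in atTop, ∀ T : Finset ℕ, T.card ≤ N →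
      Pr {ω | ∃ i ∈ T, η * √(n : ℝ) < D (X i ω)} ≤ ENNReal.ofReal κ := by
  have hlim : Tendsto (fun n : ℕ => (N : ℝ≥0∞) * P {x | η * √(n : ℝ) < D x}) atTop (𝓝 0) := by
    refine tendsto_of_tendsto_of_tendsto_of_le_of_le' tendsto_const_nhds
      (tendsto_natCast_mul_measure_lt hD hη) (Eventually.of_forall fun _ => zero_le) ?_
    filter_upwards [eventually_ge_atTop N] with n hn
    gcongr
  filter_upwards [hlim.eventually (ge_mem_nhds (ENNReal.ofReal_pos.2 hκ))] with n hn T hT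
  refine le_trans ?_ hn
  have e : {ω | ∃ i ∈ T, η * √(n : ℝ) < D (X i ω)}
      = ⋃ i ∈ T, {ω | X i ω ∈ {x | η * √(n : ℝ) < D x}} := by
    ext ω
    simp
  rw [e]
  refine (measure_biUnion_finset_le _ _).trans ((Finset.sum_le_card_nsmul T _ _ fun i _ =>
    measure_preimage_le_of_map_eq (hX i) (hlaw i) _).trans ?_)
  rw [nsmul_eq_mul]
  gcongr

/-- Oscillation of partial sums over subsamples, uniformly in the subsample. -/
theorem IsDonsker.exists_finite_partition_subsample {P : Measure 𝓧} [IsProbabilityMeasure P]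
    {F : Set (𝓧 → ℝ)} (h : IsDonsker P F) {D : 𝓧 → ℝ} (hD : MemLp D 2 P)
    (hFD : ∀ f ∈ F, ∀ x, |f x| ≤ D x) {Pr : Measure Ω} {X : ℕ → Ω → 𝓧}
    (hX : ∀ i, Measurable (X i)) (hlaw : ∀ i, Pr.map (X i) = P) (hindep : iIndepFun X Pr)
    {η κ : ℝ} (hη : 0 < η) (hκ : 0 < κ) :
    ∃ (m : ℕ) (c : F → Fin m), ∀ᶠ n : ℕ in atTop, ∀ T : Finset ℕ, T.card ≤ n →
      Pr {ω | ∃ f g : F, c f = c g ∧ η * √(n : ℝ) <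
        |∑ i ∈ T, (f.1 (X i ω) - ∫ y, f.1 y ∂P) - ∑ i ∈ T, (g.1 (X i ω) - ∫ y, g.1 y ∂P)|}
          ≤ ENNReal.ofReal κ := by
  obtain ⟨m, c, hc⟩ := h.exists_finite_partition hη hκ
  obtain ⟨N, hN⟩ := eventually_atTop.1 hc
  refine ⟨m, c, ?_⟩
  set D' : 𝓧 → ℝ := fun x => D x + ∫ y, D y ∂P with hD'
  have hD'L : MemLp D' 2 P := hD.add (memLp_const _)
  have hFD' : ∀ f ∈ F, ∀ x, |f x - ∫ y, f y ∂P| ≤ D' x := fun f hf x => by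
    have h1 : |∫ y, f y ∂P| ≤ ∫ y, D y ∂P :=
      abs_integral_le_integral_abs.trans
        (integral_mono_of_nonneg (Eventually.of_forall fun _ => abs_nonneg _)
          (hD.integrable one_le_two) (Eventually.of_forall fun y => hFD f hf y))
    exact (abs_sub _ _).trans (add_le_add (hFD f hf x) h1)
  filter_upwards [tendsto_measure_exists_mem_lt hX hlaw hD'L
    (show 0 < η / (2 * (N + 1)) by positivity) N hκ] with n hn T hT
  -- A large subsample is covered by the Donsker bound at its own size, since `√|T| ≤ √n`. A small
  -- one has at most `N` terms, each negligible against `√n` by the tail of the centred envelope.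
  rcases le_total N T.card with hNT | hNT
  · refine le_trans ?_ ((measure_sample_mem_le hX hlaw hindep
      (e := T.orderEmbOfFin rfl) (T.orderEmbOfFin rfl).injective _).trans (hN _ hNT))
    refine measure_mono ?_
    rintro ω ⟨f, g, hfg, hlt⟩
    refine ⟨f, g, hfg, ?_⟩
    rw [sum_sub_integral_eq_sqrt_mul_empProc, sum_sub_integral_eq_sqrt_mul_empProc, ← mul_sub,
      abs_mul, abs_of_nonneg (Real.sqrt_nonneg _), mul_comm] at hlt
    have hTn : √(T.card : ℝ) ≤ √(n : ℝ) := Real.sqrt_le_sqrt (by exact_mod_cast hT)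
    by_contra hcon
    have h1 := mul_le_mul hTn (not_lt.1 hcon) (abs_nonneg _) (Real.sqrt_nonneg _)
    exact absurd hlt (not_lt.2 h1)
  · refine le_trans (measure_mono ?_) (hn T hNT)
    rintro ω ⟨f, g, -, hlt⟩
    by_contra hcon
    have hcon' : ∀ i ∈ T, D' (X i ω) ≤ η / (2 * (N + 1)) * √(n : ℝ) := fun i hi =>
      not_lt.1 fun hlt' => hcon ⟨i, hi, hlt'⟩
    have hb : ∀ f : F, |∑ i ∈ T, (f.1 (X i ω) - ∫ y, f.1 y ∂P)| ≤ η / 2 * √(n : ℝ) := fun f => by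
      refine (Finset.abs_sum_le_sum_abs _ _).trans ((Finset.sum_le_card_nsmul _ _ _ fun i hi =>
        (hFD' f.1 f.2 _).trans (hcon' i hi)).trans ?_)
      rw [nsmul_eq_mul, ← mul_assoc]
      gcongr
      have hNT' : (T.card : ℝ) ≤ N := by exact_mod_cast hNT
      rw [mul_div_assoc', div_le_div_iff₀ (by positivity) (by positivity)]
      nlinarith
    have h1 := (abs_sub (∑ i ∈ T, (f.1 (X i ω) - ∫ y, f.1 y ∂P))
      (∑ i ∈ T, (g.1 (X i ω) - ∫ y, g.1 y ∂P))).trans (add_le_add (hb f) (hb g))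
    linarith

/-- A Donsker class has a finite partition such that the empirical variances of the differences of
functions in one cell are small. -/
theorem IsDonsker.exists_finite_partition_sq {P : Measure 𝓧} [IsProbabilityMeasure P]
    {F : Set (𝓧 → ℝ)} (h : IsDonsker P F) {D : 𝓧 → ℝ} (hD : MemLp D 2 P)
    (hFD : ∀ f ∈ F, ∀ x, |f x| ≤ D x) {Pr : Measure Ω} {X : ℕ → Ω → 𝓧}
    (hX : ∀ i, Measurable (X i)) (hlaw : ∀ i, Pr.map (X i) = P) (hindep : iIndepFun X Pr)
    {η κ : ℝ} (hη : 0 < η) (hκ : 0 < κ) :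
    ∃ (m : ℕ) (c : F → Fin m), ∀ᶠ n : ℕ in atTop,
      Pr {ω | ∃ f g : F, c f = c g ∧ η * n < ∑ i ∈ Finset.range n,
        ((f.1 (X i ω) - ∫ y, f.1 y ∂P) - (g.1 (X i ω) - ∫ y, g.1 y ∂P)) ^ 2}
          ≤ ENNReal.ofReal κ := by
  -- Two partial sums of size `√η √n / 4` make a signed sum whose square is at most `η n / 4`, the
  -- Paley–Zygmund threshold. The factor `10` is two events per sign vector times the five from
  -- averaging.
  obtain ⟨m, c, hc⟩ := h.exists_finite_partition_subsample hD hFD hX hlaw hindep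
    (show 0 < √η / 4 by positivity) (show 0 < κ / 10 by positivity)
  refine ⟨m, c, hc.mono fun n hn => ?_⟩
  set Bad : Finset ℕ → Set Ω := fun T => {ω | ∃ f g : F, c f = c g ∧ √η / 4 * √(n : ℝ) <
    |∑ i ∈ T, (f.1 (X i ω) - ∫ y, f.1 y ∂P) - ∑ i ∈ T, (g.1 (X i ω) - ∫ y, g.1 y ∂P)|} with hBad
  set s := Finset.range n with hs
  have hcard : ∀ T ⊆ s, T.card ≤ n := fun T hT => by
    simpa [hs] using Finset.card_le_card hT
  have key := measure_le_five_mul_of_card_le (μ := Pr) (S := s.powerset)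
    (B := fun T => Bad T ∪ Bad (s \ T)) (κ := 2 * ENNReal.ofReal (κ / 10))
    ⟨∅, Finset.empty_mem_powerset _⟩ (fun T hT => by
      rw [two_mul]
      exact (measure_union_le _ _).trans (add_le_add
        (hn T (hcard T (Finset.mem_powerset.1 hT))) (hn _ (hcard _ Finset.sdiff_subset))))
    (E := {ω | ∃ f g : F, c f = c g ∧ η * n < ∑ i ∈ s,
        ((f.1 (X i ω) - ∫ y, f.1 y ∂P) - (g.1 (X i ω) - ∫ y, g.1 y ∂P)) ^ 2}) ?_
  · refine key.trans_eq ?_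
    rw [← mul_assoc, show (5 * 2 : ℝ≥0∞) = ENNReal.ofReal 10 by norm_num,
      ← ENNReal.ofReal_mul (by norm_num)]
    congr 1
    ring
  · rintro ω ⟨f, g, hfg, hlt⟩
    have hcount := two_pow_card_le_five_mul_card_signed (fun i =>
      (f.1 (X i ω) - ∫ y, f.1 y ∂P) - (g.1 (X i ω) - ∫ y, g.1 y ∂P)) s
      (show 0 ≤ η * n by positivity) hlt
    refine ⟨_, Finset.filter_subset _ _, fun T hT => ?_, by rwa [Finset.card_powerset]⟩
    have hT2 := (Finset.mem_filter.1 hT).2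
    rw [Finset.sum_sub_distrib (s := T) (fun i => f.1 (X i ω) - ∫ y, f.1 y ∂P),
      Finset.sum_sub_distrib (s := s \ T) (fun i => f.1 (X i ω) - ∫ y, f.1 y ∂P)] at hT2
    by_contra hcon
    rw [Set.mem_union, not_or] at hcon
    have h1 := not_lt.1 fun hlt' => hcon.1 ⟨f, g, hfg, hlt'⟩
    have h2 := not_lt.1 fun hlt' => hcon.2 ⟨f, g, hfg, hlt'⟩
    have h3 := (abs_sub _ _).trans (add_le_add h1 h2)
    have h4 := pow_le_pow_left₀ (abs_nonneg _) h3 2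
    have e : (√η / 4 * √(n : ℝ) + √η / 4 * √(n : ℝ)) ^ 2 = η * n / 4 := by
      have e1 := Real.sq_sqrt hη.le
      have e2 := Real.sq_sqrt (Nat.cast_nonneg (α := ℝ) n)
      calc _ = (√η) ^ 2 * √(n : ℝ) ^ 2 / 4 := by ring
        _ = _ := by rw [e1, e2]
    rw [sq_abs, e] at h4
    linarith

end Donsker

/-! ### Representatives of finite partitions and comparison of empirical second moments -/

theorem exists_finset_representatives {α β : Type*} [Fintype β] (c : α → β) :
    ∃ s : Finset α, s.card ≤ Fintype.card β ∧ ∀ a, ∃ b ∈ s, c b = c a := by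
  classical
  refine ⟨Finset.univ.image fun k : Set.range c => k.2.choose, ?_, fun a => ?_⟩
  · exact Finset.card_image_le.trans (Fintype.card_subtype_le _)
  · exact ⟨_, Finset.mem_image_of_mem _ (Finset.mem_univ ⟨c a, a, rfl⟩),
      (⟨c a, a, rfl⟩ : Set.range c).2.choose_spec⟩

theorem _root_.IsCompact.exists_finite_partition {E : Type*} [PseudoMetricSpace E] {K : Set E}
    (hK : IsCompact K) {δ : ℝ} (hδ : 0 < δ) :
    ∃ (m : ℕ) (c : K → Fin m), ∀ a b, c a = c b → dist (a : E) b ≤ δ := by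
  obtain ⟨s, -, hs, hcov⟩ := hK.finite_cover_balls (half_pos hδ)
  have : Finite s := hs
  have hex : ∀ a : K, ∃ z : s, dist (a : E) z < δ / 2 := fun a => by
    obtain ⟨z, hz, haz⟩ := Set.mem_iUnion₂.1 (hcov a.2)
    exact ⟨⟨z, hz⟩, haz⟩
  choose z hz using hex
  refine ⟨Nat.card s, fun a => Finite.equivFin s (z a), fun a b hab => ?_⟩
  have hzab : z a = z b := (Finite.equivFin s).injective hab
  have h1 := hz b
  rw [← hzab] at h1
  have h2 := dist_triangle_right (a : E) b (z a)
  linarith [hz a]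

/-- Write `u² - v² = (u - v)² + 2(u - v)v` and split the cross term by the weighted
arithmetic–geometric inequality. -/
theorem abs_empMean_sq_sub_le {𝓧 : Type*} {n : ℕ} (x : Fin n → 𝓧) (f g : 𝓧 → ℝ) {b : ℝ}
    (hb : 0 < b) : |empMean x (fun y => f y ^ 2) - empMean x (fun y => g y ^ 2)|
      ≤ (1 + 1 / b) * empMean x (fun y => (f y - g y) ^ 2) + b * empMean x (fun y => g y ^ 2) := by
  rw [← empMean_sub, ← empMean_const_mul, ← empMean_const_mul, ← empMean_add, empMean, empMean,
    abs_mul, abs_of_nonneg (by positivity : (0 : ℝ) ≤ (n : ℝ)⁻¹)]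
  refine mul_le_mul_of_nonneg_left ((Finset.abs_sum_le_sum_abs _ _).trans
    (Finset.sum_le_sum fun i _ => ?_)) (by positivity)
  set u := f (x i)
  set v := g (x i)
  have h1 : 2 * |(u - v) * v| ≤ 1 / b * (u - v) ^ 2 + b * v ^ 2 := by
    rw [abs_mul, ← sq_abs (u - v), ← sq_abs v]
    have h := mul_nonneg (one_div_pos.2 hb).le (sq_nonneg (|u - v| - b * |v|))
    have e : 1 / b * (|u - v| - b * |v|) ^ 2
        = 1 / b * |u - v| ^ 2 - 2 * (|u - v| * |v|) + b * |v| ^ 2 := by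
      field_simp
      ring
    linarith
  have e : u ^ 2 - v ^ 2 = (u - v) ^ 2 + 2 * ((u - v) * v) := by ring
  have h2 := abs_add_le ((u - v) ^ 2) (2 * ((u - v) * v))
  rw [e]
  rw [abs_of_nonneg (sq_nonneg (u - v)), abs_mul, abs_two] at h2
  linarith

namespace LikelihoodModel

variable {Θ 𝓧 Ω : Type*} [MeasurableSpace 𝓧] [MeasurableSpace Ω] {lam : Measure 𝓧}
  (M : LikelihoodModel Θ lam) {Pr : Measure Ω} [IsProbabilityMeasure Pr] {X : ℕ → Ω → 𝓧}

/-! ### Normalized scores -/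

theorem integral_S_div (θ : Θ) (hθ : 0 < M.h θ) :
    ∫ y, M.S θ y / M.h θ ∂M.P₀ = -(M.h θ / 2) := by
  rw [integral_div, M.integral_S]
  field_simp

theorem integral_S_div_sq {θ : Θ} (hac : M.law θ ≪ M.P₀) (hθ : 0 < M.h θ) :
    ∫ y, (M.S θ y / M.h θ) ^ 2 ∂M.P₀ = 1 := by
  simp only [div_pow]
  rw [integral_div, M.integral_S_sq hac, div_self (by positivity)]

/-- Uniform law of large numbers for the squares of the normalized scores near `p₀`. -/
theorem exists_eventually_squares_le (hX : ∀ i, Measurable (X i))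
    (hlaw : ∀ i, Pr.map (X i) = M.P₀) (hindep : iIndepFun X Pr)
    (hac : ∀ θ, M.law θ ≪ M.P₀) {F : Set (𝓧 → ℝ)} (hF : IsDonsker M.P₀ F) {ε : ℝ} (hε : 0 < ε)
    (hεF : M.scores ε ⊆ F) {D : 𝓧 → ℝ} (hD : MemLp D 2 M.P₀)
    (hFD : ∀ f ∈ F, ∀ x, |f x| ≤ D x) {η κ : ℝ} (hη : 0 < η) (hκ : 0 < κ) :
    ∃ ε' > 0, ∀ᶠ n : ℕ in atTop, Pr {ω | ∃ θ, 0 < M.h θ ∧ M.h θ ≤ ε' ∧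
      η < |empMean (sample X n ω) (fun y => (M.S θ y / M.h θ) ^ 2) - 1|} ≤ ENNReal.ofReal κ := by
  obtain ⟨a, ha0, ha1, haη⟩ : ∃ a : ℝ, 0 < a ∧ a ≤ 1 ∧ a ≤ η :=
    ⟨min 1 η, lt_min one_pos hη, min_le_left _ _, min_le_right _ _⟩
  -- Chosen so that `(1 + 8/a) · 3τ = a/4`, the cost of comparing second moments with weight `b =
  -- a/8`. The final error is three times `a/4`, below `η`.
  set τ : ℝ := a / (12 * (1 + 8 / a)) with hτ
  have hτ0 : 0 < τ := by positivity
  obtain ⟨m, c, hc⟩ := hF.exists_finite_partition_sq hD hFD hX hlaw hindep hτ0 (half_pos hκ)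
  -- The partition controls centred differences, while uncentred ones are needed. The means `-h/2`
  -- differ by at most `ε'/2`, and `ε'² ≤ 2τ` makes this cost at most one further `τ`.
  set ε' := min ε (√(2 * τ)) with hε'
  have hε'0 : 0 < ε' := lt_min hε (by positivity)
  have hε'τ : ε' ^ 2 ≤ 2 * τ := by
    rw [← Real.sq_sqrt (show 0 ≤ 2 * τ by positivity)]
    gcongr
    exact min_le_right _ _
  refine ⟨ε', hε'0, ?_⟩
  set f : {θ // 0 < M.h θ ∧ M.h θ ≤ ε'} → F := fun θ =>
    ⟨fun y => M.S θ.1 y / M.h θ.1,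
      hεF ⟨θ.1, θ.2.1, θ.2.2.trans (min_le_left _ _), rfl⟩⟩ with hf
  obtain ⟨s, -, hs⟩ := exists_finset_representatives fun θ => c (f θ)
  have hrep : Tendsto (fun n => ∑ θ ∈ s, Pr {ω | a / 4 <
      |empMean (sample X n ω) (fun y => (f θ).1 y ^ 2) - ∫ y, (f θ).1 y ^ 2 ∂M.P₀|})
      atTop (𝓝 0) := by
    refine (tendsto_finsetSum s fun θ _ => tendsto_measure_lt_abs_empMean_sub hX hlaw hindep ?_ ?_
      (show 0 < a / 4 by positivity)).trans_eq (by rw [Finset.sum_const_zero])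
    · exact ((M.measurable_S θ.1).div_const _).pow_const 2
    · simp only [hf, div_pow]
      exact (M.memLp_S θ.1).integrable_sq.div_const _
  filter_upwards [hc, hrep.eventually (ge_mem_nhds (ENNReal.ofReal_pos.2 (half_pos hκ))),
    eventually_gt_atTop 0] with n hn1 hn2 hn
  have hn0 : (0 : ℝ) < n := by exact_mod_cast hn
  have hsplit : ENNReal.ofReal κ = ENNReal.ofReal (κ / 2) + ENNReal.ofReal (κ / 2) := by
    rw [← ENNReal.ofReal_add (by positivity) (by positivity), add_halves]
  rw [hsplit]
  refine le_trans ?_ (add_le_add hn1 hn2)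
  refine le_trans (measure_mono ?_) ((measure_union_le _ _).trans
    (add_le_add le_rfl (measure_biUnion_finset_le s _)))
  rintro ω ⟨θ, hθ0, hθ1, hlt⟩
  by_contra hcon
  simp only [Set.mem_union, Set.mem_iUnion, not_or, not_exists] at hcon
  obtain ⟨hcon1, hcon2⟩ := hcon
  obtain ⟨θ', hθ's, hθ'⟩ := hs ⟨θ, hθ0, hθ1⟩
  have h1 := not_lt.1 fun h => hcon1 ⟨f ⟨θ, hθ0, hθ1⟩, f θ', hθ'.symm, h⟩
  have h2 : |empMean (sample X n ω) (fun y => (f θ').1 y ^ 2) - ∫ y, (f θ').1 y ^ 2 ∂M.P₀|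
      ≤ a / 4 := not_lt.1 (hcon2 θ' hθ's)
  have hP2 : ∫ y, (f θ').1 y ^ 2 ∂M.P₀ = 1 := M.integral_S_div_sq (hac θ'.1) θ'.2.1
  rw [hP2] at h2
  set g : 𝓧 → ℝ := (f θ').1 with hg
  have hgm : ∫ y, g y ∂M.P₀ = -(M.h θ'.1 / 2) := M.integral_S_div θ'.1 θ'.2.1
  have hfm : ∫ y, (f ⟨θ, hθ0, hθ1⟩).1 y ∂M.P₀ = -(M.h θ / 2) := M.integral_S_div θ hθ0
  rw [hgm, hfm] at h1
  have hdiff : empMean (sample X n ω) (fun y => (M.S θ y / M.h θ - g y) ^ 2) ≤ 3 * τ := by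
    have h3 : ∑ i : Fin n, (M.S θ (X i ω) / M.h θ - g (X i ω)) ^ 2
        ≤ 2 * (τ * n) + n * (ε' ^ 2 / 2) := by
      rw [← Finset.sum_range fun i => (M.S θ (X i ω) / M.h θ - g (X i ω)) ^ 2]
      refine le_trans (Finset.sum_le_sum (g := fun i => 2 * ((M.S θ (X i ω) / M.h θ - -(M.h θ / 2)) -
        (g (X i ω) - -(M.h θ'.1 / 2))) ^ 2 + ε' ^ 2 / 2) fun i _ => ?_) ?_
      · set u := M.S θ (X i ω) / M.h θ - g (X i ω)
        have hp : ((M.h θ - M.h θ'.1) / 2) ^ 2 ≤ (ε' / 2) ^ 2 := by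
          rw [sq_le_sq, abs_of_nonneg (by positivity : 0 ≤ ε' / 2), abs_le]
          have := θ'.2.1
          have := θ'.2.2
          constructor <;> linarith
        have e : (M.S θ (X i ω) / M.h θ - -(M.h θ / 2)) - (g (X i ω) - -(M.h θ'.1 / 2))
            = u + (M.h θ - M.h θ'.1) / 2 := by ring
        rw [e]
        nlinarith [sq_nonneg (u + 2 * ((M.h θ - M.h θ'.1) / 2))]
      · rw [Finset.sum_add_distrib, ← Finset.mul_sum, Finset.sum_const, Finset.card_range,
          nsmul_eq_mul]
        have h1' : ∑ i ∈ Finset.range n, ((M.S θ (X i ω) / M.h θ - -(M.h θ / 2)) -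
          (g (X i ω) - -(M.h θ'.1 / 2))) ^ 2 ≤ τ * n := h1
        linarith
    rw [empMean, inv_mul_le_iff₀ hn0]
    refine h3.trans ?_
    nlinarith
  have h4 := abs_empMean_sq_sub_le (sample X n ω) (fun y => M.S θ y / M.h θ) g
    (show 0 < a / 8 by positivity)
  have h5 : (1 + 1 / (a / 8)) * empMean (sample X n ω) (fun y => (M.S θ y / M.h θ - g y) ^ 2)
      ≤ a / 4 := by
    calc _ ≤ (1 + 1 / (a / 8)) * (3 * τ) := by gcongr
      _ = a / 4 := by
        rw [hτ]
        field_simp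
        ring
  have h6 := abs_le.1 h2
  have h7 : a / 8 * empMean (sample X n ω) (fun y => g y ^ 2) ≤ a / 8 * 2 := by
    gcongr
    linarith [h6.2]
  have h8 := abs_le.1 (h4.trans (add_le_add h5 h7))
  refine absurd hlt (not_lt.2 (abs_le.2 ⟨?_, ?_⟩)) <;> linarith [h6.1, h6.2, h8.1, h8.2]

section FiniteDimensional

variable {d : ℕ} (ψ : OrthonormalBasis (Fin d) ℝ (Submodule.span ℝ M.tangentCone))

variable {M} in
theorem IsHellingerExpansion.integral_normalized_sub_sq_le {g : Θ → Lp ℝ 2 M.P₀}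
    {R : Θ → Lp ℝ 2 lam} (hg : M.IsHellingerExpansion g R) (hclosed : IsClosed M.tangentCone)
    (hconvex : Convex ℝ M.tangentCone) {θ : Θ} (hθ : 0 < M.h θ) :
    ∫ y, ((M.S θ y - 1 / 2 * ∑ j, M.gamma ψ θ j * M.psiFun ψ j y) / M.h θ) ^ 2 ∂M.P₀
      ≤ ‖R θ‖ ^ 2 := by
  have e : ∫ y, ((M.S θ y - 1 / 2 * ∑ j, M.gamma ψ θ j * M.psiFun ψ j y) / M.h θ) ^ 2 ∂M.P₀
      = ‖M.SLp θ - M.projS θ‖ ^ 2 / M.h θ ^ 2 := by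
    simp only [div_pow]
    rw [integral_div, norm_sq_Lp_two]
    congr 1
    refine integral_congr_ae ?_
    filter_upwards [Lp.coeFn_sub (M.SLp θ) (M.projS θ), (M.memLp_S θ).coeFn_toLp,
      M.half_sum_gamma_ae_eq ψ hg.tangentCone_nonempty hclosed hconvex θ] with x h1 h2 h3
    rw [h1, Pi.sub_apply, SLp, h2, ← h3]
  rw [e, div_le_iff₀ (by positivity), ← mul_pow, mul_comm]
  exact pow_le_pow_left₀ (norm_nonneg _) (hg.norm_SLp_sub_projS_le hclosed hconvex θ) 2

theorem empProc_sub_half_sum_gamma {n : ℕ} (x : Fin n → 𝓧) (θ : Θ) :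
    empProc M.P₀ x (fun y => (M.S θ y - 1 / 2 * ∑ j, M.gamma ψ θ j * M.psiFun ψ j y) / M.h θ)
      = empProc M.P₀ x (fun y => M.S θ y / M.h θ)
        - ∑ j, (1 / (2 * M.h θ) * M.gamma ψ θ j) * empProc M.P₀ x (M.psiFun ψ j) := by
  have hint : ∀ j, Integrable (M.psiFun ψ j) M.P₀ := fun j =>
    (M.memLp_psiFun ψ j).integrable one_le_two
  have hint2 : ∀ j, Integrable (fun y => (1 / (2 * M.h θ) * M.gamma ψ θ j) * M.psiFun ψ j y) M.P₀ :=
    fun j => (hint j).const_mul _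
  have e : (fun y => (M.S θ y - 1 / 2 * ∑ j, M.gamma ψ θ j * M.psiFun ψ j y) / M.h θ)
      = fun y => M.S θ y / M.h θ
        - ∑ j, (1 / (2 * M.h θ) * M.gamma ψ θ j) * M.psiFun ψ j y := by
    funext y
    rw [sub_div, Finset.mul_sum, Finset.sum_div]
    congr 1
    refine Finset.sum_congr rfl fun j _ => ?_
    ring
  have h0 : ∫ y, ∑ j, (1 / (2 * M.h θ) * M.gamma ψ θ j) * M.psiFun ψ j y ∂M.P₀ = 0 := by
    rw [integral_finsetSum _ fun j _ => hint2 j]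
    simp only [integral_const_mul, M.integral_psiFun ψ, mul_zero, Finset.sum_const_zero]
  rw [e, empProc_sub x ((M.integrable_S θ).div_const _) (integrable_finsetSum _ fun j _ => hint2 j),
    empProc_of_integral_eq_zero x h0]
  congr 1
  simp only [empProc_of_integral_eq_zero x (M.integral_psiFun ψ _)]
  rw [Finset.sum_comm, Finset.mul_sum]
  refine Finset.sum_congr rfl fun j _ => ?_
  rw [← Finset.mul_sum]
  ring

theorem measure_exists_lt_abs_empProc_psiFun_le (hX : ∀ i, Measurable (X i))
    (hlaw : ∀ i, Pr.map (X i) = M.P₀) (hindep : iIndepFun X Pr) {L : ℝ} (hL : 0 < L) (n : ℕ) :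
    Pr {ω | ∃ j, L < |empProc M.P₀ (sample X n ω) (M.psiFun ψ j)|}
      ≤ ENNReal.ofReal (d / L ^ 2) := by
  have e : {ω | ∃ j, L < |empProc M.P₀ (sample X n ω) (M.psiFun ψ j)|}
      = ⋃ j, {ω | L < |empProc M.P₀ (sample X n ω) (M.psiFun ψ j)|} := by
    ext ω
    simp
  rw [e]
  refine (measure_iUnion_fintype_le _ _).trans ((Finset.sum_le_card_nsmul Finset.univ _
    (ENNReal.ofReal (1 / L ^ 2)) fun j _ => ?_).trans_eq ?_)
  · refine (measure_lt_abs_empProc_le hX hlaw hindep (M.measurable_psiFun ψ j)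
      (M.memLp_psiFun ψ j) hL n).trans_eq ?_
    have := M.integral_psiFun_mul ψ j j
    simp only [if_true, ← sq] at this
    rw [this]
  · rw [Finset.card_univ, Fintype.card_fin, nsmul_eq_mul, ← ENNReal.ofReal_natCast,
      ← ENNReal.ofReal_mul (Nat.cast_nonneg _), mul_one_div]

/-- Asymptotic equivalence of the empirical process at the normalized scores and at their
normalized projections onto the tangent cone. -/
theorem exists_eventually_empProc_le (hX : ∀ i, Measurable (X i))
    (hlaw : ∀ i, Pr.map (X i) = M.P₀) (hindep : iIndepFun X Pr)
    (hclosed : IsClosed M.tangentCone) (hconvex : Convex ℝ M.tangentCone)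
    (hac : ∀ θ, M.law θ ≪ M.P₀) {g : Θ → Lp ℝ 2 M.P₀} {R : Θ → Lp ℝ 2 lam}
    (hg : M.IsHellingerExpansion g R)
    (hR : Tendsto (fun ε : ℝ => ⨆ θ ∈ {θ | M.h θ ≤ ε}, ‖R θ‖ₑ) (𝓝[>] 0) (𝓝 0))
    {F : Set (𝓧 → ℝ)} (hF : IsDonsker M.P₀ F) {ε : ℝ} (hε : 0 < ε)
    (hεF : M.scores ε ⊆ F) {η κ : ℝ} (hη : 0 < η) (hκ : 0 < κ) :
    ∃ ε' > 0, ∀ᶠ n : ℕ in atTop, Pr {ω | ∃ θ, 0 < M.h θ ∧ M.h θ ≤ ε' ∧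
      η < |empProc M.P₀ (sample X n ω)
        (fun y => (M.S θ y - 1 / 2 * ∑ j, M.gamma ψ θ j * M.psiFun ψ j y) / M.h θ)|}
      ≤ ENNReal.ofReal κ := by
  have hne := hg.tangentCone_nonempty
  obtain ⟨m, c, hc⟩ := hF.exists_finite_partition_sample hX hlaw hindep
    (show 0 < η / 3 by positivity) (show 0 < κ / 3 by positivity)
  -- With probability at least `1 - κ/3` all coordinates of `𝔾ₙ(ψ)` are at most `L`; the mesh chosen
  -- next for the normalized tangents in the unit ball compensates `L` and the dimension.
  set L : ℝ := √(3 * (d + 1) / κ) with hL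
  have hL0 : 0 < L := by positivity
  have hLd : d / L ^ 2 ≤ κ / 3 := by
    rw [hL, Real.sq_sqrt (by positivity), div_div_eq_mul_div, div_le_div_iff₀ (by positivity)
      (by positivity)]
    nlinarith
  obtain ⟨q, b, hb⟩ := (isCompact_closedBall (0 : EuclideanSpace ℝ (Fin d)) 1).exists_finite_partition
    (show 0 < η / (3 * (d + 1) * L) by positivity)
  -- The order of choices matters: `m` and `q` do not depend on the neighbourhood, so it can be
  -- shrunk until `‖R‖ ≤ δ`. Chebyshev for one representative in each of at most `m q` cells then
  -- costs `κ/3` in total.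
  set δ : ℝ := √(κ * η ^ 2 / (27 * (m * q + 1))) with hδ
  have hδ0 : 0 < δ := by positivity
  obtain ⟨ε', ⟨hε'R, hε'ε⟩, hε'0⟩ := (((hR.eventually (ge_mem_nhds (ENNReal.ofReal_pos.2 hδ0))).and
    ((eventually_le_nhds hε).filter_mono nhdsWithin_le_nhds)).and self_mem_nhdsWithin).exists
  refine ⟨ε', hε'0, ?_⟩
  have hRδ : ∀ θ, M.h θ ≤ ε' → ‖R θ‖ ≤ δ := fun θ hθ => by
    have h1 := (le_iSup₂ (f := fun θ (_ : θ ∈ {θ | M.h θ ≤ ε'}) => ‖R θ‖ₑ) θ hθ).trans hε'R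
    rw [← ofReal_norm] at h1
    exact (ENNReal.ofReal_le_ofReal_iff hδ0.le).1 h1
  set f : {θ // 0 < M.h θ ∧ M.h θ ≤ ε'} → F := fun θ =>
    ⟨fun y => M.S θ.1 y / M.h θ.1, hεF ⟨θ.1, θ.2.1, θ.2.2.trans hε'ε, rfl⟩⟩ with hf
  set a : {θ // 0 < M.h θ ∧ M.h θ ≤ ε'} → Metric.closedBall (0 : EuclideanSpace ℝ (Fin d)) 1 :=
    fun θ => ⟨(1 / (2 * M.h θ.1)) • M.gamma ψ θ.1, by
      have h1 := M.norm_projS_sq hne hclosed hconvex (hac θ.1)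
      have h2 := abs_le_of_sq_le_sq' (a := ‖M.projS θ.1‖) (b := M.h θ.1)
        (by nlinarith [sq_nonneg ‖M.SLp θ.1 - M.projS θ.1‖]) (M.h_nonneg θ.1)
      have h3 := θ.2.1
      rw [mem_closedBall_zero_iff, norm_smul, M.norm_gamma ψ hne hclosed hconvex, Real.norm_eq_abs,
        abs_of_pos (by positivity), div_mul_eq_mul_div, one_mul, div_le_one (by positivity)]
      linarith [h2.2]⟩ with ha
  -- Cells fix both the normalized score, up to oscillation of the empirical process, and the
  -- coordinates of its normalized projection, up to the mesh.
  obtain ⟨s, hscard, hs⟩ := exists_finset_representatives fun θ => (c (f θ), b (a θ))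
  rw [Fintype.card_prod, Fintype.card_fin, Fintype.card_fin] at hscard
  set u : {θ // 0 < M.h θ ∧ M.h θ ≤ ε'} → 𝓧 → ℝ := fun θ y =>
    (M.S θ.1 y - 1 / 2 * ∑ j, M.gamma ψ θ.1 j * M.psiFun ψ j y) / M.h θ.1 with hu
  have hum : ∀ θ, Measurable (u θ) := fun θ =>
    ((M.measurable_S θ.1).sub ((Finset.measurable_sum _ fun j _ =>
      (M.measurable_psiFun ψ j).const_mul _).const_mul _)).div_const _
  have hu2 : ∀ θ, MemLp (u θ) 2 M.P₀ := fun θ => by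
    have h1 : MemLp (fun y => M.S θ.1 y - 1 / 2 * ∑ j, M.gamma ψ θ.1 j * M.psiFun ψ j y) 2 M.P₀ :=
      (M.memLp_S θ.1).sub ((memLp_finsetSum _ fun j _ =>
        (M.memLp_psiFun ψ j).const_mul _).const_mul _)
    have h2 := h1.const_mul (M.h θ.1)⁻¹
    refine (memLp_congr_ae (Eventually.of_forall fun y => ?_)).1 h2
    exact (div_eq_inv_mul _ _).symm
  have hrep : ∀ n, ∑ θ ∈ s, Pr {ω | η / 3 < |empProc M.P₀ (sample X n ω) (u θ)|}
      ≤ ENNReal.ofReal (κ / 3) := fun n => by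
    refine (Finset.sum_le_card_nsmul _ _ (ENNReal.ofReal (δ ^ 2 / (η / 3) ^ 2)) fun θ _ => ?_).trans
      ?_
    · refine (measure_lt_abs_empProc_le hX hlaw hindep (hum θ) (hu2 θ) (by positivity) n).trans
        (ENNReal.ofReal_le_ofReal ?_)
      have h1 := hg.integral_normalized_sub_sq_le ψ hclosed hconvex θ.2.1
      have h2 : ‖R θ.1‖ ^ 2 ≤ δ ^ 2 := pow_le_pow_left₀ (norm_nonneg _) (hRδ θ.1 θ.2.2) 2
      gcongr
      exact h1.trans h2
    · rw [nsmul_eq_mul, ← ENNReal.ofReal_natCast, ← ENNReal.ofReal_mul (Nat.cast_nonneg _)]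
      refine ENNReal.ofReal_le_ofReal ?_
      have hscard' : (s.card : ℝ) ≤ m * q := by exact_mod_cast hscard
      rw [hδ, Real.sq_sqrt (by positivity)]
      calc s.card * (κ * η ^ 2 / (27 * (m * q + 1)) / (η / 3) ^ 2)
          ≤ (m * q + 1) * (κ * η ^ 2 / (27 * (m * q + 1)) / (η / 3) ^ 2) := by
            gcongr
            linarith
        _ = κ / 3 := by
            field_simp
            norm_num
  filter_upwards [hc] with n hn
  have hsplit : ENNReal.ofReal κ = ENNReal.ofReal (κ / 3) + ENNReal.ofReal (κ / 3)
      + ENNReal.ofReal (κ / 3) := by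
    rw [← ENNReal.ofReal_add (by positivity) (by positivity),
      ← ENNReal.ofReal_add (by positivity) (by positivity)]
    congr 1
    ring
  rw [hsplit]
  refine le_trans ?_ (add_le_add (add_le_add hn
    ((M.measure_exists_lt_abs_empProc_psiFun_le ψ hX hlaw hindep hL0 n).trans
      (ENNReal.ofReal_le_ofReal hLd))) (hrep n))
  refine le_trans (measure_mono ?_) ((measure_union_le _ _).trans
    (add_le_add (measure_union_le _ _) (measure_biUnion_finset_le s _)))
  rintro ω ⟨θ, hθ0, hθ1, hlt⟩
  by_contra hcon
  simp only [Set.mem_union, Set.mem_iUnion, not_or, not_exists] at hcon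
  obtain ⟨⟨hcon1, hcon2⟩, hcon3⟩ := hcon
  obtain ⟨θ', hθ's, hθ'⟩ := hs ⟨θ, hθ0, hθ1⟩
  obtain ⟨hθ'c, hθ'b⟩ := Prod.ext_iff.1 hθ'
  have h1 := not_lt.1 fun h => hcon1 ⟨f ⟨θ, hθ0, hθ1⟩, f θ', hθ'c.symm, h⟩
  have h2 : ∀ j, |empProc M.P₀ (sample X n ω) (M.psiFun ψ j)| ≤ L := fun j =>
    not_lt.1 fun h => hcon2 ⟨j, h⟩
  have h3 : |empProc M.P₀ (sample X n ω) (u θ')| ≤ η / 3 := not_lt.1 (hcon3 θ' hθ's)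
  have h4 := hb _ _ hθ'b
  have e1 := M.empProc_sub_half_sum_gamma ψ (sample X n ω) θ
  have e2 := M.empProc_sub_half_sum_gamma ψ (sample X n ω) θ'.1
  change |empProc M.P₀ (sample X n ω) (fun y => M.S θ y / M.h θ)
    - empProc M.P₀ (sample X n ω) (fun y => M.S θ'.1 y / M.h θ'.1)| ≤ _ at h1
  change |empProc M.P₀ (sample X n ω) (fun y =>
    (M.S θ'.1 y - 1 / 2 * ∑ j, M.gamma ψ θ'.1 j * M.psiFun ψ j y) / M.h θ'.1)| ≤ _ at h3
  have h5 : |∑ j, (1 / (2 * M.h θ'.1) * M.gamma ψ θ'.1 j) * empProc M.P₀ (sample X n ω) (M.psiFun ψ j)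
      - ∑ j, (1 / (2 * M.h θ) * M.gamma ψ θ j) * empProc M.P₀ (sample X n ω) (M.psiFun ψ j)|
      ≤ η / 3 := by
    rw [← Finset.sum_sub_distrib]
    refine (Finset.abs_sum_le_sum_abs _ _).trans ((Finset.sum_le_card_nsmul _ _
      (η / (3 * (d + 1) * L) * L) fun j _ => ?_).trans ?_)
    · rw [← sub_mul, abs_mul]
      refine mul_le_mul ?_ (h2 j) (abs_nonneg _) (by positivity)
      refine le_trans ?_ h4
      rw [dist_eq_norm]
      exact PiLp.norm_apply_le
        ((1 / (2 * M.h θ'.1)) • M.gamma ψ θ'.1 - (1 / (2 * M.h θ)) • M.gamma ψ θ) j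
    · rw [Finset.card_univ, Fintype.card_fin, nsmul_eq_mul]
      calc d * (η / (3 * (d + 1) * L) * L) ≤ (d + 1) * (η / (3 * (d + 1) * L) * L) := by
            gcongr
            linarith
        _ = η / 3 := by field_simp
  rw [e1] at hlt
  rw [e2] at h3
  rw [abs_le] at h1 h3 h5
  refine absurd hlt (not_lt.2 (abs_le.2 ⟨?_, ?_⟩)) <;>
    linarith [h1.1, h1.2, h3.1, h3.2, h5.1, h5.2]

end FiniteDimensional

end LikelihoodModel

/-! ### Bounds at a fixed level and the choice of the rate -/

/-- The single quantity `1/rₙ` serves as tolerance and as probability, so one bound for each large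
`n` replaces the quantifier over `ε`. -/
theorem isLittleOP_of_eventually_le {Ω : Type*} [MeasurableSpace Ω] {Pr : Measure Ω}
    {Y : ℕ → Ω → ℝ≥0∞} {a r : ℕ → ℝ} (ha : ∀ n, 0 ≤ a n) (hr : Tendsto r atTop atTop)
    (h : ∀ᶠ n in atTop, Pr {ω | ENNReal.ofReal (1 / r n * a n) < Y n ω}
      ≤ ENNReal.ofReal (1 / r n)) : IsLittleOP Pr Y a := by
  intro ε hε
  have hr0 : Tendsto (fun n => 1 / r n) atTop (𝓝 0) := by
    simpa only [one_div, Function.comp_def] using tendsto_inv_atTop_zero.comp hr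
  have hlim : Tendsto (fun n => ENNReal.ofReal (1 / r n)) atTop (𝓝 0) := by
    simpa using ENNReal.tendsto_ofReal hr0
  refine tendsto_of_tendsto_of_tendsto_of_le_of_le' tendsto_const_nhds hlim
    (Eventually.of_forall fun _ => zero_le) ?_
  filter_upwards [h, hr0.eventually (ge_mem_nhds hε)] with n hn hnε
  refine (measure_mono fun ω hω => ?_).trans hn
  exact (ENNReal.ofReal_le_ofReal (mul_le_mul_of_nonneg_right hnε (ha n))).trans_lt hω

namespace LikelihoodModel

variable {Θ 𝓧 Ω : Type*} [MeasurableSpace 𝓧] [MeasurableSpace Ω] {lam : Measure 𝓧}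
  (M : LikelihoodModel Θ lam) {Pr : Measure Ω} [IsProbabilityMeasure Pr] {X : ℕ → Ω → 𝓧}

section FiniteDimensional

variable {d : ℕ} (ψ : OrthonormalBasis (Fin d) ℝ (Submodule.span ℝ M.tangentCone))

/-- The bounds on the scores hold at a fixed level `K` in the place of `rₙ`, up to errors `1/K`. -/
structure LevelBounds (Pr : Measure Ω) (X : ℕ → Ω → 𝓧) (R : Θ → Lp ℝ 2 lam) (D : 𝓧 → ℝ)
    (t : Θ → 𝓧 → ℝ) (K : ℝ) (n : ℕ) : Prop where
  rate : K ≤ 1 / K * (n : ℝ) ^ (1 / 4 : ℝ)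
  remainder : ∀ θ, M.h θ ≤ K / √(n : ℝ) → K * ‖R θ‖ ≤ 1 / K
  envelope : Pr {ω | ENNReal.ofReal (1 / K * (√(n : ℝ) / K ^ 3))
    < ⨆ i : Fin n, ENNReal.ofReal (D (sample X n ω i))} ≤ ENNReal.ofReal (1 / K)
  empirical : Pr {ω | ENNReal.ofReal (1 / K * (1 / √(n : ℝ))) < ⨆ θ ∈ {θ | M.h θ ≤ K / √(n : ℝ)},
    ENNReal.ofReal |empProc M.P₀ (sample X n ω) (fun y => M.S θ y - t θ y)|}
      ≤ ENNReal.ofReal (1 / K)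
  squares : Pr {ω | ENNReal.ofReal (1 / K * (1 / (n : ℝ))) < ⨆ θ ∈ {θ | M.h θ ≤ K / √(n : ℝ)},
    ENNReal.ofReal |empMean (sample X n ω) (fun y => M.S θ y ^ 2) - ∫ y, M.S θ y ^ 2 ∂M.P₀|}
      ≤ ENNReal.ofReal (1 / K)

theorem eventually_levelBounds (hX : ∀ i, Measurable (X i))
    (hlaw : ∀ i, Pr.map (X i) = M.P₀) (hid : ∀ θ, M.p θ =ᵐ[lam] M.p₀ → M.p θ = M.p₀)
    (hindep : iIndepFun X Pr)
    (hclosed : IsClosed M.tangentCone) (hconvex : Convex ℝ M.tangentCone)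
    (hac : ∀ θ, M.law θ ≪ M.P₀) {g : Θ → Lp ℝ 2 M.P₀} {R : Θ → Lp ℝ 2 lam}
    (hg : M.IsHellingerExpansion g R)
    (hR : Tendsto (fun ε : ℝ => ⨆ θ ∈ {θ | M.h θ ≤ ε}, ‖R θ‖ₑ) (𝓝[>] 0) (𝓝 0))
    {F : Set (𝓧 → ℝ)} (hF : IsDonsker M.P₀ F) {ε : ℝ} (hε : 0 < ε)
    (hεF : M.scores ε ⊆ F) {D : 𝓧 → ℝ} (hD : MemLp D 2 M.P₀)
    (hFD : ∀ f ∈ F, ∀ x, |f x| ≤ D x) {K : ℝ} (hK : 0 < K) :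
    ∀ᶠ n : ℕ in atTop, M.LevelBounds Pr X R D
      (fun θ x => 1 / 2 * ∑ j, M.gamma ψ θ j * M.psiFun ψ j x) K n := by
  have hne := hg.tangentCone_nonempty
  have hKn : Tendsto (fun n : ℕ => K / √(n : ℝ)) atTop (𝓝 0) :=
    tendsto_const_nhds.div_atTop (Real.tendsto_sqrt_atTop.comp tendsto_natCast_atTop_atTop)
  have hKn' : Tendsto (fun n : ℕ => K / √(n : ℝ)) atTop (𝓝[>] 0) := by
    refine tendsto_nhdsWithin_iff.2 ⟨hKn, ?_⟩
    filter_upwards [eventually_gt_atTop 0] with n hn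
    have hn0 : (0 : ℝ) < n := by exact_mod_cast hn
    exact div_pos hK (Real.sqrt_pos.2 hn0)
  have hrate : Tendsto (fun n : ℕ => 1 / K * (n : ℝ) ^ (1 / 4 : ℝ)) atTop atTop :=
    ((tendsto_rpow_atTop (by norm_num)).comp tendsto_natCast_atTop_atTop).const_mul_atTop
      (by positivity)
  have hRK := (hR.comp hKn').eventually
    (ge_mem_nhds (ENNReal.ofReal_pos.2 (show 0 < 1 / K / K by positivity)))
  have hmax := (tendsto_measure_exists_lt hX hlaw hD (show 0 < 1 / K / K ^ 3 by positivity)).eventually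
    (ge_mem_nhds (ENNReal.ofReal_pos.2 (show 0 < 1 / K by positivity)))
  -- Tolerances for normalized scores are divided in advance by `K` here and by `K²` for the
  -- squares, since undoing the normalization multiplies by `h ≤ K/√n` and by `h² ≤ K²/n`.
  obtain ⟨ε₁, hε₁, hemp⟩ := M.exists_eventually_empProc_le ψ hX hlaw hindep hclosed hconvex hac hg
    hR hF hε hεF (show 0 < 1 / K / K by positivity) (show 0 < 1 / K by positivity)
  obtain ⟨ε₂, hε₂, hsq⟩ := M.exists_eventually_squares_le hX hlaw hindep hac hF hε hεF hD hFD
    (show 0 < 1 / K / K ^ 2 by positivity) (show 0 < 1 / K by positivity)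
  filter_upwards [hrate.eventually_ge_atTop K, hRK, hmax, hemp, hsq,
    hKn.eventually (ge_mem_nhds hε₁), hKn.eventually (ge_mem_nhds hε₂), eventually_gt_atTop 0]
    with n h1 h2 h3 h4 h5 h6 h7 hn
  have hn0 : (0 : ℝ) < n := by exact_mod_cast hn
  have hsn : 0 < √(n : ℝ) := Real.sqrt_pos.2 hn0
  refine ⟨h1, fun θ hθ => ?_, ?_, ?_, ?_⟩
  · have h := (le_iSup₂ (f := fun θ (_ : θ ∈ {θ | M.h θ ≤ K / √(n : ℝ)}) => ‖R θ‖ₑ) θ hθ).trans h2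
    rw [← ofReal_norm, ENNReal.ofReal_le_ofReal_iff (by positivity), le_div_iff₀ hK] at h
    linarith
  · refine (measure_mono fun ω hω => ?_).trans h3
    rw [Set.mem_ofPred_eq] at hω
    obtain ⟨i, hi⟩ := lt_iSup_iff.1 hω
    refine ⟨i, ?_⟩
    rw [ENNReal.ofReal_lt_ofReal_iff_of_nonneg (by positivity)] at hi
    calc 1 / K / K ^ 3 * √(n : ℝ) = 1 / K * (√(n : ℝ) / K ^ 3) := by ring
      _ < _ := hi
  · refine (measure_mono fun ω hω => ?_).trans h4
    rw [Set.mem_ofPred_eq] at hω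
    obtain ⟨θ, hθ⟩ := lt_iSup_iff.1 hω
    obtain ⟨hθK, hlt⟩ := lt_iSup_iff.1 hθ
    have hθK' : M.h θ ≤ K / √(n : ℝ) := hθK
    rw [ENNReal.ofReal_lt_ofReal_iff_of_nonneg (by positivity)] at hlt
    -- At `h = 0` both the score and its tangent coordinates vanish, so such a parameter cannot
    -- exceed the positive threshold.
    have hθ0 : 0 < M.h θ := by
      refine (M.h_nonneg θ).lt_of_ne fun h0 => ?_
      have hS : M.S θ = fun _ => 0 := funext (M.S_eq_zero_of_h_eq_zero hid h0.symm)
      have hγ : M.gamma ψ θ = 0 := by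
        have h8 := M.norm_projS_sq hne hclosed hconvex (hac θ)
        rw [← h0, zero_pow two_ne_zero] at h8
        have h9 : ‖M.projS θ‖ = 0 := by
          refine pow_eq_zero_iff two_ne_zero |>.1 (le_antisymm ?_ (sq_nonneg _))
          nlinarith [sq_nonneg ‖M.SLp θ - M.projS θ‖]
        rw [← norm_eq_zero, M.norm_gamma ψ hne hclosed hconvex, h9, mul_zero]
      rw [hS, hγ] at hlt
      simp [empProc, empMean] at hlt
      linarith [show 0 < (√(n : ℝ))⁻¹ * K⁻¹ by positivity]
    refine ⟨θ, hθ0, hθK'.trans h6, ?_⟩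
    have e : (fun y => M.S θ y - 1 / 2 * ∑ j, M.gamma ψ θ j * M.psiFun ψ j y)
        = fun y => M.h θ * ((M.S θ y - 1 / 2 * ∑ j, M.gamma ψ θ j * M.psiFun ψ j y) / M.h θ) := by
      funext y
      field_simp
    rw [e, empProc_const_mul, abs_mul, abs_of_pos hθ0] at hlt
    by_contra hcon
    have h8 := mul_le_mul hθK' (not_lt.1 hcon) (abs_nonneg _) (by positivity)
    have e2 : K / √(n : ℝ) * (1 / K / K) = 1 / K * (1 / √(n : ℝ)) := by field_simp
    rw [e2] at h8
    exact absurd hlt (not_lt.2 h8)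
  · refine (measure_mono fun ω hω => ?_).trans h5
    rw [Set.mem_ofPred_eq] at hω
    obtain ⟨θ, hθ⟩ := lt_iSup_iff.1 hω
    obtain ⟨hθK, hlt⟩ := lt_iSup_iff.1 hθ
    have hθK' : M.h θ ≤ K / √(n : ℝ) := hθK
    rw [ENNReal.ofReal_lt_ofReal_iff_of_nonneg (by positivity)] at hlt
    have hθ0 : 0 < M.h θ := by
      refine (M.h_nonneg θ).lt_of_ne fun h0 => ?_
      have hS : M.S θ = fun _ => 0 := funext (M.S_eq_zero_of_h_eq_zero hid h0.symm)
      rw [hS] at hlt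
      simp [empMean] at hlt
      linarith [show 0 < (n : ℝ)⁻¹ * K⁻¹ by positivity]
    refine ⟨θ, hθ0, hθK'.trans h7, ?_⟩
    have e : (fun y => M.S θ y ^ 2) = fun y => M.h θ ^ 2 * (M.S θ y / M.h θ) ^ 2 := by
      funext y
      field_simp
    rw [M.integral_S_sq (hac θ), e, empMean_const_mul] at hlt
    have e1 : ∀ z : ℝ, M.h θ ^ 2 * z - M.h θ ^ 2 = M.h θ ^ 2 * (z - 1) := fun z => by ring
    rw [e1, abs_mul, abs_of_pos (by positivity)] at hlt
    by_contra hcon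
    have h8 := mul_le_mul (pow_le_pow_left₀ hθ0.le hθK' 2) (not_lt.1 hcon) (abs_nonneg _)
      (by positivity)
    have e2 : (K / √(n : ℝ)) ^ 2 * (1 / K / K ^ 2) = 1 / K * (1 / (n : ℝ)) := by
      rw [div_pow, Real.sq_sqrt hn0.le]
      field_simp
    rw [e2] at h8
    exact absurd hlt (not_lt.2 h8)

theorem exists_localScoreBounds (hX : ∀ i, Measurable (X i))
    (hlaw : ∀ i, Pr.map (X i) = M.P₀) (hid : ∀ θ, M.p θ =ᵐ[lam] M.p₀ → M.p θ = M.p₀)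
    (hindep : iIndepFun X Pr)
    (hclosed : IsClosed M.tangentCone) (hconvex : Convex ℝ M.tangentCone)
    (hdqm : M.IsDQM) (hdonsker : M.ScoresDonsker) :
    ∃ r : ℕ → ℝ, (∀ n, 0 < r n) ∧ Tendsto r atTop atTop ∧
      r =o[atTop] (fun n => (n : ℝ) ^ (1 / 4 : ℝ)) ∧
      M.LocalScoreBounds Pr X r (fun θ x => 1 / 2 * ∑ j, M.gamma ψ θ j * M.psiFun ψ j x) := by
  obtain ⟨hac, g, R, hg, hR⟩ := hdqm
  obtain ⟨ε, hε, v, -, hF, D, hD, hFD⟩ := hdonsker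
  obtain ⟨k, hk, hlevel⟩ := exists_tendsto_atTop_of_eventually fun k : ℕ =>
    M.eventually_levelBounds ψ hX hlaw hid hindep hclosed hconvex hac hg hR hF hε
      Set.subset_union_left hD hFD (show (0 : ℝ) < k + 1 by positivity)
  -- Levels are indexed by `k + 1` so that they are positive for every `n`, including those before
  -- the level bounds hold.
  set r : ℕ → ℝ := fun n => k n + 1 with hr
  have hr0 : ∀ n, 0 < r n := fun n => by positivity
  have hrt : Tendsto r atTop atTop :=
    tendsto_atTop_add_const_right _ _ (tendsto_natCast_atTop_atTop.comp hk)
  have hr1 : Tendsto (fun n => 1 / r n) atTop (𝓝 0) := by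
    simpa only [one_div, Function.comp_def] using tendsto_inv_atTop_zero.comp hrt
  refine ⟨r, hr0, hrt, ?_, ⟨hac, g, R, hg, ?_⟩, ⟨ε, hε, D, fun f hf => hFD f (Or.inl hf), ?_⟩, ?_, ?_⟩
  · refine isLittleO_iff.2 fun c hc => ?_
    filter_upwards [hlevel, hr1.eventually (ge_mem_nhds hc)] with n hn hnc
    have hn4 : (0 : ℝ) ≤ (n : ℝ) ^ (1 / 4 : ℝ) := by positivity
    rw [Real.norm_eq_abs, abs_of_pos (hr0 n), Real.norm_eq_abs, abs_of_nonneg hn4]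
    exact hn.rate.trans (mul_le_mul_of_nonneg_right hnc hn4)
  · have hlim : Tendsto (fun n => ENNReal.ofReal (1 / r n)) atTop (𝓝 0) := by
      simpa using ENNReal.tendsto_ofReal hr1
    refine tendsto_of_tendsto_of_tendsto_of_le_of_le' tendsto_const_nhds hlim
      (Eventually.of_forall fun _ => zero_le) ?_
    filter_upwards [hlevel] with n hn
    refine iSup₂_le fun θ hθ => ?_
    rw [← ofReal_norm, ← ENNReal.ofReal_mul (hr0 n).le]
    exact ENNReal.ofReal_le_ofReal (hn.remainder θ hθ)
  · exact isLittleOP_of_eventually_le (fun n => by have := hr0 n; positivity) hrt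
      (hlevel.mono fun n hn => hn.envelope)
  · exact isLittleOP_of_eventually_le (fun n => by positivity) hrt
      (hlevel.mono fun n hn => hn.empirical)
  · exact isLittleOP_of_eventually_le (fun n => by positivity) hrt
      (hlevel.mono fun n hn => hn.squares)

end FiniteDimensional

end LikelihoodModel

end GenScore

theorem propositionp {Θ 𝓧 Ω : Type*} [MeasurableSpace 𝓧] [MeasurableSpace Ω]
    (lam : Measure 𝓧) [SigmaFinite lam] (M : LikelihoodModel Θ lam)
    (Pr : Measure Ω) [IsProbabilityMeasure Pr] (X : ℕ → Ω → 𝓧)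
    (hX : ∀ i, Measurable (X i)) (hlaw : ∀ i, Pr.map (X i) = M.P₀)
    (hid : ∀ θ, M.p θ =ᵐ[lam] M.p₀ → M.p θ = M.p₀)
    (hclosed : IsClosed M.tangentCone) (hconvex : Convex ℝ M.tangentCone) :
    -- expansion for identically distributed data, under the high-level conditions
    (∀ r : ℕ → ℝ, (∀ n, 0 < r n) → Tendsto r atTop atTop →
      r =o[atTop] (fun n => (n : ℝ) ^ (1 / 2 : ℝ)) →
      ∀ t : Θ → 𝓧 → ℝ, (∀ θ, t θ =ᵐ[M.P₀] M.projS θ) →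
      M.ScoreConditions Pr X r t →
      IsLittleOP Pr (fun n ω => ⨆ θ ∈ M.nbhd r n,
        EReal.abs (M.logLik n (sample X n ω) θ -
          ((M.ell n (sample X n ω) - 1 / 2 * (n * ∫ x, (2 * t θ x) ^ 2 ∂M.P₀)
            + n * empMean (sample X n ω) (fun x => 2 * t θ x) : ℝ) : EReal)))
        (fun _ => 1)) ∧
    -- i.i.d. data and a tangent cone with finite-dimensional span
    (iIndepFun X Pr → ∀ d : ℕ, 1 ≤ d →
      ∀ ψ : OrthonormalBasis (Fin d) ℝ (Submodule.span ℝ M.tangentCone),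
      -- quadratic expansion under the high-level conditions
      (∀ r : ℕ → ℝ, (∀ n, 0 < r n) → Tendsto r atTop atTop →
        r =o[atTop] (fun n => (n : ℝ) ^ (1 / 2 : ℝ)) →
        M.ScoreConditions Pr X r (fun θ x => 1 / 2 * ∑ j, M.gamma ψ θ j * M.psiFun ψ j x) →
        M.QuadraticExpansion ψ Pr X r) ∧
      -- quadratic expansion under the Glivenko-Cantelli, DQM and Donsker conditions
      (M.LogDensitiesGC Pr X → M.IsDQM → M.ScoresDonsker →
        ∃ r : ℕ → ℝ, (∀ n, 0 < r n) ∧ Tendsto r atTop atTop ∧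
          r =o[atTop] (fun n => (n : ℝ) ^ (1 / 4 : ℝ)) ∧
          M.QuadraticExpansion ψ Pr X r)) := by

  refine ⟨fun r hr0 hrt hro t ht hc => ?_, fun hindep d _ ψ => ⟨fun r hr0 hrt hro hc => ?_, ?_⟩⟩
  · exact hc.localScoreBounds.isLittleOP_logLik hX hlaw hid hclosed hconvex hr0 hrt hro ht
  · exact hc.localScoreBounds.quadraticExpansion ψ hX hlaw hid hclosed hconvex hindep hr0 hrt hro
  · intro _ hdqm hdonsker
    obtain ⟨r, hr0, hrt, hro, hb⟩ :=
      M.exists_localScoreBounds ψ hX hlaw hid hindep hclosed hconvex hdqm hdonsker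
    have hle : (fun n : ℕ => (n : ℝ) ^ (1 / 4 : ℝ)) =O[atTop] fun n : ℕ => (n : ℝ) ^ (1 / 2 : ℝ) := by
      refine IsBigO.of_bound 1 ?_
      filter_upwards [eventually_ge_atTop 1] with n hn
      have hn1 : (1 : ℝ) ≤ n := by exact_mod_cast hn
      rw [one_mul, Real.norm_eq_abs, Real.norm_eq_abs, abs_of_nonneg (by positivity),
        abs_of_nonneg (by positivity)]
      exact Real.rpow_le_rpow_of_exponent_le hn1 (by norm_num)
    exact ⟨r, hr0, hrt, hro,
      hb.quadraticExpansion ψ hX hlaw hid hclosed hconvex hindep hr0 hrt (hro.trans_isBigO hle)⟩
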